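/- Let $\mathsf k$ be an algebraically closed field, let $n, r$ be natural numbers with $2r \le n$, let $B \subset \mathrm{SL}_n(\mathsf k)$ be the subgroup of upper triangular matrices, acting on matrices by conjugation, written $g.x = gxg^{-1}$. Let $\mathcal N_2 = \{x \in \mathfrak{sl}_n(\mathsf k) : x^2 = 0\}$ and $\mathbb O_r = \{x \in \mathcal N_2 : \operatorname{rk} x = r\}$. Let $e_1,\dots,e_n$ be the canonical basis of $\mathsf k^n$, let $V_i$ be the span of $e_1,\dots,e_i$ (so $V_0=0$), and let $x_r \in \mathbb O_r$ be the matrix with $x_r(e_i) = 0$ for $i \le n-r$ and $x_r(e_i) = e_{i-(n-r)}$ for $i > n-r$. Let $W = S_n$, acting on matrices through conjugation by permutation matrices, with length function $l$ (with respect to the adjacent transpositions) and Bruhat order $\le$. Let $W_{P^r} \subset W$ be the subgroup of permutations preserving $\{1,\dots,r\}$ and $\{1,\dots,n-r\}$, and let $W^{P^r}$ be the set of minimal length representatives of the cosets in $W/W_{P^r}$. Let $W_r = S_r$, embedded in $W$ as the permutations fixing all $i>r$, and let $W(C_r) = \{\tau \in W : \tau . x_r = x_r\}$. For $x \in M_n(\mathsf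 k)$ put $r(i,j,x) = \dim\bigl(x(V_i)+V_j\bigr)$. Closures and dimensions refer to the Zariski topology. Then: 1. $\mathbb O_r = \coprod_{(\sigma,w) \in W^{P^r}\times W_r} B\,\sigma w . x_r$ (a disjoint union, distinct pairs giving distinct orbits). 2. For $(\sigma,w), (\sigma',w') \in W^{P^r}\times W_r$, the orbit $B\,\sigma'w'.x_r$ is contained in the closure of $B\,\sigma w.x_r$ in $\mathbb O_r$ if and only if there is $\tau \in W$ with $\tau \le \sigma w$ and $\sigma'w'\,W(C_r) = \tau\, W(C_r)$. 3. For $(\sigma,w) \in W^{P^r}\times W_r$, $\dim B\,\sigma w.x_r = l(\sigma)+l(w)+\binom{r+1}{2}$. 4. For $(\sigma,w) \in W^{P^r}\times W_r$, the closure $Z(\sigma,w)$ of $B\,\sigma w.x_r$ in $\mathcal N_2$ is, as a set, $$Z(\sigma,w) = \{x \in \mathcal N_2 : r(i,j,x) \le r(i,j,\sigma w.x_r) \text{ for all } 1\le i\le n,\ 0 \le j \le n\}.$$ -/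

import Mathlib

namespace SquareZero

/-! ### Zariski closure and dimension in the affine space of matrices -/

section Zariski

variable {k : Type*} [Field k] {n : ℕ}

/-- A matrix as a point of the affine space with coordinates indexed by `Fin n × Fin n`. -/
def coords (x : Matrix (Fin n) (Fin n) k) : Fin n × Fin n → k := fun p => x p.1 p.2

/-- The ideal of all polynomials in the matrix entries that vanish on `S`. -/
noncomputable def idealOf (S : Set (Matrix (Fin n) (Fin n) k)) :
    Ideal (MvPolynomial (Fin n × Fin n) k) :=
  MvPolynomial.vanishingIdeal k (coords '' S)

/-- The Zariski closure of `S` in the space of all `n × n` matrices. The closure of `S` in a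
subset `Y ⊇ S` is `Y ∩ zariskiClosure S`. -/
def zariskiClosure (S : Set (Matrix (Fin n) (Fin n) k)) : Set (Matrix (Fin n) (Fin n) k) :=
  {x | coords x ∈ MvPolynomial.zeroLocus k (idealOf S)}

/-- The dimension of a (locally closed) set of matrices: the Krull dimension of the coordinate
ring of its Zariski closure. -/
noncomputable def dimension (S : Set (Matrix (Fin n) (Fin n) k)) : WithBot ℕ∞ :=
  ringKrullDim (MvPolynomial (Fin n × Fin n) k ⧸ idealOf S)

end Zariski

/-! ### The symmetric group: length, Bruhat order -/

section Weyl

variable {n : ℕ}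

/-- The Coxeter length of a permutation (with respect to the adjacent transpositions), that is,
its number of inversions. -/
def length (σ : Equiv.Perm (Fin n)) : ℕ :=
  (Finset.univ.filter fun p : Fin n × Fin n => p.1 < p.2 ∧ σ p.2 < σ p.1).card

/-- The (non-strict) Bruhat order: the reflexive and transitive closure of the relation
`u → u t`, for `t` a transposition with `length u < length (u t)`. -/
def Bruhat : Equiv.Perm (Fin n) → Equiv.Perm (Fin n) → Prop :=
  Relation.ReflTransGen fun u v =>
    length u < length v ∧ ∃ i j : Fin n, i ≠ j ∧ v = u * Equiv.swap i j

/-- The Weyl group of the parabolic subgroup stabilising the flag `V_r ⊂ V_{n-r}` of coordinate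
subspaces: the permutations preserving the first `r` and the first `n - r` indices. -/
def weylParabolic (n r : ℕ) : Set (Equiv.Perm (Fin n)) :=
  {τ | ∀ i : Fin n, ((i : ℕ) < r → (τ i : ℕ) < r) ∧ ((i : ℕ) < n - r → (τ i : ℕ) < n - r)}

/-- The elements of minimal length in their left coset modulo `weylParabolic n r`. -/
def minReps (n r : ℕ) : Set (Equiv.Perm (Fin n)) :=
  {σ | ∀ τ ∈ weylParabolic n r, length σ ≤ length (σ * τ)}

/-- A permutation of the first `r` indices, extended by the identity. -/
def extend {r : ℕ} (h : 2 * r ≤ n) (w : Equiv.Perm (Fin r)) : Equiv.Perm (Fin n) :=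
  w.viaFintypeEmbedding (Fin.castLEEmb (show r ≤ n by omega))

end Weyl

/-! ### Square-zero matrices and their orbits under the Borel subgroup -/

section Orbits

variable (k : Type*) [Field k]

/-- The Borel subgroup of upper triangular matrices in `SL_n`. -/
def borel (n : ℕ) : Subgroup (Matrix.SpecialLinearGroup (Fin n) k) where
  carrier := {b | Matrix.BlockTriangular (b : Matrix (Fin n) (Fin n) k) id}
  one_mem' := by
    simpa using (Matrix.blockTriangular_one : Matrix.BlockTriangular
      (1 : Matrix (Fin n) (Fin n) k) id)
  mul_mem' := by
    intro a b ha hb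
    simpa using Matrix.BlockTriangular.mul ha hb
  inv_mem' := by
    intro b hb
    have hdet : IsUnit (b : Matrix (Fin n) (Fin n) k).det := by simp
    have : Invertible (b : Matrix (Fin n) (Fin n) k) :=
      Matrix.invertibleOfIsUnitDet _ hdet
    have h := Matrix.blockTriangular_inv_of_blockTriangular
      (M := (b : Matrix (Fin n) (Fin n) k)) (b := id) hb
    have e : ((b⁻¹ : Matrix.SpecialLinearGroup (Fin n) k) : Matrix (Fin n) (Fin n) k)
        = (b : Matrix (Fin n) (Fin n) k)⁻¹ := by
      refine (Matrix.inv_eq_left_inv ?_).symm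
      rw [← Matrix.SpecialLinearGroup.coe_mul, inv_mul_cancel,
        Matrix.SpecialLinearGroup.coe_one]
    change Matrix.BlockTriangular
      ((b⁻¹ : Matrix.SpecialLinearGroup (Fin n) k) : Matrix (Fin n) (Fin n) k) id
    rw [e]
    exact h

variable {k}

/-- The orbit of `x` under conjugation by the Borel subgroup. -/
def borelOrbit {n : ℕ} (x : Matrix (Fin n) (Fin n) k) : Set (Matrix (Fin n) (Fin n) k) :=
  {y | ∃ b ∈ borel k n, y = (b : Matrix (Fin n) (Fin n) k) * x *
    ((b⁻¹ : Matrix.SpecialLinearGroup (Fin n) k) : Matrix (Fin n) (Fin n) k)}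

/-- The matrix of the linear map `e_j ↦ e_{σ j}`. -/
def permMat (k : Type*) [Field k] {n : ℕ} (σ : Equiv.Perm (Fin n)) : Matrix (Fin n) (Fin n) k :=
  Matrix.of fun i j => if i = σ j then 1 else 0

/-- Conjugation of `x` by the permutation matrix of `σ` (see `weylAct_eq`). -/
def weylAct {n : ℕ} (σ : Equiv.Perm (Fin n)) (x : Matrix (Fin n) (Fin n) k) :
    Matrix (Fin n) (Fin n) k :=
  Matrix.reindex σ σ x

theorem weylAct_eq {n : ℕ} (σ : Equiv.Perm (Fin n)) (x : Matrix (Fin n) (Fin n) k) :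
    weylAct σ x = permMat k σ * x * permMat k σ⁻¹ := by
  ext i j
  simp only [weylAct, permMat, Matrix.mul_apply, Matrix.of_apply, Matrix.reindex_apply,
    Matrix.submatrix_apply, ite_mul, one_mul, zero_mul, mul_ite, mul_one, mul_zero]
  have h1 : ∀ a : Fin n, (i = σ a) ↔ (σ.symm i = a) := fun a => (Equiv.symm_apply_eq σ).symm
  simp [h1, Equiv.Perm.inv_def]

variable (k)

/-- The nilpotent elements of order at most two in `sl_n`. -/
def N2 (n : ℕ) : Set (Matrix (Fin n) (Fin n) k) := {x | x.trace = 0 ∧ x * x = 0}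

/-- The square-zero matrices of rank `r` in `sl_n`. -/
def rankOrbit (n r : ℕ) : Set (Matrix (Fin n) (Fin n) k) := {x | x ∈ N2 k n ∧ x.rank = r}

/-- The matrix `x_r` sending the last `r` basis vectors, in order, to the first `r` ones and
all other basis vectors to zero. -/
def baseMat (n r : ℕ) : Matrix (Fin n) (Fin n) k :=
  Matrix.of fun i j => if (j : ℕ) = i + (n - r) then 1 else 0

/-- The group `W(C_r)` of permutations whose permutation matrices stabilise `x_r`. -/
def weylStab (n r : ℕ) : Subgroup (Equiv.Perm (Fin n)) where
  carrier := {τ | weylAct τ (baseMat k n r) = baseMat k n r}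
  one_mem' := by
    ext i j
    simp [weylAct, Equiv.Perm.one_def]
  mul_mem' := by
    intro a b ha hb
    have h : weylAct (a * b) (baseMat k n r) = weylAct a (weylAct b (baseMat k n r)) := by
      ext i j
      rfl
    change weylAct (a * b) (baseMat k n r) = baseMat k n r
    rw [h, hb, ha]
  inv_mem' := by
    intro a ha
    change weylAct a⁻¹ (baseMat k n r) = baseMat k n r
    conv_lhs => rw [← show weylAct a (baseMat k n r) = baseMat k n r from ha]
    ext i j
    simp [weylAct, Equiv.Perm.inv_def]

/-- The matrix `σ w . x_r`. -/
def orbitRep {n r : ℕ} (h : 2 * r ≤ n) (σ : Equiv.Perm (Fin n)) (w : Equiv.Perm (Fin r)) :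
    Matrix (Fin n) (Fin n) k :=
  weylAct (σ * extend h w) (baseMat k n r)

/-- The span `V_i` of the first `i` vectors of the canonical basis of `k ^ n`. -/
def coordSpan (n i : ℕ) : Submodule k (Fin n → k) :=
  Submodule.span k ((fun j : Fin n => (Pi.single j 1 : Fin n → k)) '' {j | (j : ℕ) < i})

variable {k}

/-- The number `r(i, j, x) = dim (x(V_i) + V_j)`. -/
noncomputable def rankFn {n : ℕ} (i j : ℕ) (x : Matrix (Fin n) (Fin n) k) : ℕ :=
  Module.finrank k ↥((coordSpan k n i).map (Matrix.toLin' x) ⊔ coordSpan k n j)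

/-- The closure `Z(σ, w)` in `N2` of the orbit of `σ w . x_r` under the Borel subgroup. -/
def Z (k : Type*) [Field k] {n r : ℕ} (h : 2 * r ≤ n) (σ : Equiv.Perm (Fin n))
    (w : Equiv.Perm (Fin r)) : Set (Matrix (Fin n) (Fin n) k) :=
  N2 k n ∩ zariskiClosure (borelOrbit (orbitRep k h σ w))

end Orbits

end SquareZero

/-!
The Borel orbits of square-zero matrices are encoded by oriented link patterns, that is, sets `T`
of pairs `(b, a)` with no repeated endpoints, through the matrix `arcMat k T` with entries `1` at
these positions. Eliminating along the coordinate flag brings every square-zero matrix into this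
form by upper triangular conjugation (`exists_arcMat_orbit`). The numbers `r(i, j, x)` are
constant on orbits and equal `j` plus the number `arcCount T i j` of arcs from the first `i` points
to points beyond the first `j` (`rankFn_arcMat`); they determine `T`, so distinct patterns give
distinct orbits. They can only drop on the closure of an orbit, since they are detected by minors
(`patternLE_of_mem_closure`). The patterns with `r` arcs are the images of the pattern `baseArcs`
of `x_r` under the permutations `v = σ w`, which are exactly the permutations increasing on the
last two of the three blocks of sizes `r`, `n - 2 r`, `r` (`BlockMono`), each pattern being
obtained once.

Everything else is an induction along descents: if `v ≠ 1`, there is an adjacent transposition `s`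
with `l(s v) < l(v)`, and `u = s v` is again block monotone. Two facts relate the orbits of `u` and
`v`. First, `s` maps the orbit of `u . x_r` into that of `v . x_r`, and the latter is
swept out by the simple root subgroup from the image (`IsDescent.weylAct_mem`,
`exists_transvection_weylAct`). The point is that the simple root pulled back by `u` is a positive
root that `v` makes negative, and its root subgroup either fixes `x_r` or acts on it like a root
subgroup of the last block, whose positive roots `v` keeps positive (`BlockMono.root_mem`).
Second, the orbit of `u . x_r` lies in the closure of that of `v . x_r`, by letting the negative simple root
subgroup tend to the identity (`IsDescent.subset_closure`).

On the combinatorial side, the order `PatternLE` by arc counts and the Bruhat order both have the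
lifting property for adjacent transpositions (`IsLinkPattern.lift`, `Bruhat.lift`): what lies below
`v` either lies below `s v`, or does so after applying `s`. Descending to `v = 1`, where the
closure of the orbit of `x_r` is an explicit linear space (`mem_closure_base`), gives that
`T ≤ v . x_r` for arc counts implies both that `arcMat k T` is in the closure
(`PatternLE.mem_closure`) and, if `T` has `r` arcs, that `T = τ . x_r` for some `τ ≤ v`
(`PatternLE.exists_bruhat`); conversely `τ ≤ v` puts `τ . x_r` in the closure
(`Bruhat.mem_closure`). Together with the rank inequalities satisfied on closures, this gives
the closure order and the description of the closures by ranks.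

For the dimension, the sweeping map `𝔸¹ × O_u → O_v` embeds the coordinate ring of `O_v` into the
polynomial ring over that of `O_u`. So the ideal of `O_v` is prime and the transcendence degree
grows by at most one; by Noether normalisation it bounds the Krull dimension
(`ringKrullDim_le_of_trdeg_le`). On the other hand the closure of `O_u` is a proper closed subset
of the irreducible closure of `O_v`, so the Krull dimension grows by at least one. The
induction starts with the linear space of dimension `r (r + 1) / 2` attached to `x_r`.
-/

namespace SquareZero

/-! ### Link patterns and their rank functions -/

section Patterns

open Finset

variable {n : ℕ}

/-- An oriented link pattern on `n` points: a set of arcs, no two of which share an endpoint.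
The arc with tail `a` and head `b` is recorded as the pair `(b, a)`, the position of the
corresponding matrix entry. -/
structure IsLinkPattern (T : Finset (Fin n × Fin n)) : Prop where
  head_inj : ∀ e ∈ T, ∀ f ∈ T, e.1 = f.1 → e = f
  tail_inj : ∀ e ∈ T, ∀ f ∈ T, e.2 = f.2 → e = f
  head_ne_tail : ∀ e ∈ T, ∀ f ∈ T, e.1 ≠ f.2

/-- The number of arcs whose tail is among the first `i` points and whose head is not among the
first `j` points. -/
def arcCount (T : Finset (Fin n × Fin n)) (i j : ℕ) : ℕ :=
  (T.filter fun e => j ≤ (e.1 : ℕ) ∧ (e.2 : ℕ) < i).card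

/-- The number (zero or one, for a link pattern) of arcs with tail `q` whose head is not among
the first `j` points. -/
def tailCount (T : Finset (Fin n × Fin n)) (q j : ℕ) : ℕ :=
  (T.filter fun e => (e.2 : ℕ) = q ∧ j ≤ (e.1 : ℕ)).card

/-- The number (zero or one, for a link pattern) of arcs with head `q` whose tail is among
the first `i` points. -/
def headCount (T : Finset (Fin n × Fin n)) (q i : ℕ) : ℕ :=
  (T.filter fun e => (e.1 : ℕ) = q ∧ (e.2 : ℕ) < i).card

theorem arcCount_succ_left (T : Finset (Fin n × Fin n)) (i j : ℕ) :
    arcCount T (i + 1) j = arcCount T i j + tailCount T i j := by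
  simp only [arcCount, tailCount, card_filter, ← sum_add_distrib]
  refine sum_congr rfl fun e _ => ?_
  split_ifs <;> omega

theorem arcCount_succ_right (T : Finset (Fin n × Fin n)) (i j : ℕ) :
    arcCount T i j = arcCount T i (j + 1) + headCount T j i := by
  simp only [arcCount, headCount, card_filter, ← sum_add_distrib]
  refine sum_congr rfl fun e _ => ?_
  split_ifs <;> omega

theorem headCount_succ (T : Finset (Fin n × Fin n)) (a b : Fin n) :
    headCount T b (a + 1) = headCount T b a + if (b, a) ∈ T then 1 else 0 := by
  have h : (if (b, a) ∈ T then 1 else 0) = ∑ e ∈ T, if e = (b, a) then 1 else 0 := by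
    rw [sum_ite_eq']
  rw [h]
  simp only [headCount, card_filter, ← sum_add_distrib]
  refine sum_congr rfl fun e _ => ?_
  have : e = (b, a) ↔ (e.1 : ℕ) = b ∧ (e.2 : ℕ) = a := by
    rw [Prod.ext_iff, Fin.ext_iff, Fin.ext_iff]
  simp only [this]
  split_ifs <;> omega

/-- The arcs are recovered from the counting function by inclusion and exclusion. -/
theorem eq_of_arcCount_eq {T T' : Finset (Fin n × Fin n)}
    (h : ∀ i j : ℕ, i ≤ n → j ≤ n → arcCount T i j = arcCount T' i j) : T = T' := by
  ext ⟨b, a⟩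
  have h1 := h (a + 1) b (by omega) (by omega)
  have h2 := h (a + 1) (b + 1) (by omega) (by omega)
  have h3 := h a b (by omega) (by omega)
  have h4 := h a (b + 1) (by omega) (by omega)
  have e1 := arcCount_succ_right T (a + 1) b
  have e2 := arcCount_succ_right T a b
  have e3 := arcCount_succ_right T' (a + 1) b
  have e4 := arcCount_succ_right T' a b
  have f1 := headCount_succ T a b
  have f2 := headCount_succ T' a b
  by_cases m1 : (b, a) ∈ T <;> by_cases m2 : (b, a) ∈ T' <;> simp only [m1, m2, if_true, if_false,
    iff_true, iff_false, not_true, not_false_iff] at * <;> omega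

/-- The pattern obtained by renaming the points. -/
def movePattern (s : Equiv.Perm (Fin n)) (T : Finset (Fin n × Fin n)) :
    Finset (Fin n × Fin n) :=
  T.map (Equiv.prodCongr s s).toEmbedding

theorem mem_movePattern {s : Equiv.Perm (Fin n)} {T : Finset (Fin n × Fin n)}
    {e : Fin n × Fin n} : e ∈ movePattern s T ↔ (s.symm e.1, s.symm e.2) ∈ T := by
  simp only [movePattern, mem_map_equiv]
  rfl

theorem card_movePattern (s : Equiv.Perm (Fin n)) (T : Finset (Fin n × Fin n)) :
    (movePattern s T).card = T.card := card_map _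

theorem movePattern_mul (s t : Equiv.Perm (Fin n)) (T : Finset (Fin n × Fin n)) :
    movePattern (s * t) T = movePattern s (movePattern t T) := by
  ext e
  simp only [mem_movePattern]
  rfl

theorem movePattern_one (T : Finset (Fin n × Fin n)) : movePattern 1 T = T := by
  ext e
  simp only [mem_movePattern]
  rfl

theorem IsLinkPattern.move {T : Finset (Fin n × Fin n)} (hT : IsLinkPattern T)
    (s : Equiv.Perm (Fin n)) : IsLinkPattern (movePattern s T) := by
  refine ⟨fun e he f hf h => ?_, fun e he f hf h => ?_, fun e he f hf h => ?_⟩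
  · have := hT.head_inj _ (mem_movePattern.1 he) _ (mem_movePattern.1 hf) (by simp [h])
    simpa [Prod.ext_iff] using this
  · have := hT.tail_inj _ (mem_movePattern.1 he) _ (mem_movePattern.1 hf) (by simp [h])
    simpa [Prod.ext_iff] using this
  · exact hT.head_ne_tail _ (mem_movePattern.1 he) _ (mem_movePattern.1 hf) (by simp [h])

/-- The adjacent transposition exchanging `p` and `p + 1`. -/
def simpleSwap (p : ℕ) (hp : p + 1 < n) : Equiv.Perm (Fin n) :=
  Equiv.swap ⟨p, by omega⟩ ⟨p + 1, hp⟩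

theorem simpleSwap_val (p : ℕ) (hp : p + 1 < n) (x : Fin n) :
    (simpleSwap p hp x : ℕ) =
      if (x : ℕ) = p then p + 1 else if (x : ℕ) = p + 1 then p else x := by
  rw [simpleSwap, Equiv.swap_apply_def]
  simp only [Fin.ext_iff]
  split_ifs <;> rfl

theorem simpleSwap_mul_self (p : ℕ) (hp : p + 1 < n) : simpleSwap p hp * simpleSwap p hp = 1 :=
  Equiv.swap_mul_self _ _

theorem arcCount_movePattern (s : Equiv.Perm (Fin n)) (T : Finset (Fin n × Fin n)) (i j : ℕ) :
    arcCount (movePattern s T) i j =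
      ∑ e ∈ T, if j ≤ (s e.1 : ℕ) ∧ (s e.2 : ℕ) < i then 1 else 0 := by
  rw [arcCount, card_filter, movePattern, sum_map]
  rfl

theorem arcCount_simpleSwap_of_ne (p : ℕ) (hp : p + 1 < n) (T : Finset (Fin n × Fin n)) {i j : ℕ}
    (hi : i ≠ p + 1) (hj : j ≠ p + 1) :
    arcCount (movePattern (simpleSwap p hp) T) i j = arcCount T i j := by
  rw [arcCount_movePattern, arcCount, card_filter]
  refine sum_congr rfl fun e _ => ?_
  simp only [simpleSwap_val]
  split_ifs <;> omega

theorem arcCount_simpleSwap_left (p : ℕ) (hp : p + 1 < n) (T : Finset (Fin n × Fin n)) {j : ℕ}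
    (hj : j ≠ p + 1) :
    arcCount (movePattern (simpleSwap p hp) T) (p + 1) j =
      arcCount T p j + tailCount T (p + 1) j := by
  rw [arcCount_movePattern, arcCount, tailCount, card_filter, card_filter, ← sum_add_distrib]
  refine sum_congr rfl fun e _ => ?_
  simp only [simpleSwap_val]
  split_ifs <;> omega

theorem arcCount_simpleSwap_right (p : ℕ) (hp : p + 1 < n) (T : Finset (Fin n × Fin n)) {i : ℕ}
    (hi : i ≠ p + 1) :
    arcCount (movePattern (simpleSwap p hp) T) i (p + 1) =
      arcCount T i (p + 2) + headCount T p i := by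
  rw [arcCount_movePattern, arcCount, headCount, card_filter, card_filter, ← sum_add_distrib]
  refine sum_congr rfl fun e _ => ?_
  simp only [simpleSwap_val]
  split_ifs <;> omega

theorem arcCount_simpleSwap_both (p : ℕ) (hp : p + 1 < n) {T : Finset (Fin n × Fin n)}
    (hT : IsLinkPattern T) :
    arcCount (movePattern (simpleSwap p hp) T) (p + 1) (p + 1) =
      arcCount T p (p + 2) + headCount T p p + tailCount T (p + 1) p := by
  rw [arcCount_movePattern, arcCount, headCount, tailCount, card_filter, card_filter, card_filter,
    ← sum_add_distrib, ← sum_add_distrib]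
  refine sum_congr rfl fun e he => ?_
  have := hT.head_ne_tail e he e he
  rw [Ne, Fin.ext_iff] at this
  simp only [simpleSwap_val]
  split_ifs <;> omega

/-- For a link pattern the counts at a point `q` are threshold functions: `t ≤ n` is the tail of
the arc with head `q` (or `n`), `h` is one more than the head of the arc with tail `q` (or `0`),
and `q` is not both a head and a tail. -/
theorem IsLinkPattern.exists_threshold {T : Finset (Fin n × Fin n)} (hT : IsLinkPattern T)
    (q : ℕ) : ∃ h t : ℕ, (∀ j, tailCount T q j = if j < h then 1 else 0) ∧
      (∀ i ≤ n, headCount T q i = if t < i then 1 else 0) ∧ (h = 0 ∨ t = n) ∧ t ≤ n ∧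
      h ≠ q + 1 := by
  have key1 : ∃ h, (∀ j, tailCount T q j = if j < h then 1 else 0) ∧ h ≠ q + 1 ∧
      (h ≠ 0 → ∃ e ∈ T, (e.2 : ℕ) = q) := by
    by_cases H : ∃ e ∈ T, (e.2 : ℕ) = q
    · obtain ⟨e, he, heq⟩ := H
      refine ⟨e.1 + 1, fun j => ?_, ?_, fun _ => ⟨e, he, heq⟩⟩
      · have : (T.filter fun f => (f.2 : ℕ) = q ∧ j ≤ (f.1 : ℕ)) =
            if j < (e.1 : ℕ) + 1 then {e} else ∅ := by
          ext f
          constructor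
          · intro hf
            rw [mem_filter] at hf
            obtain rfl := hT.tail_inj f hf.1 e he (Fin.ext (by omega))
            rw [if_pos (by omega)]
            simp
          · split_ifs with hj
            · intro hf
              rw [mem_singleton] at hf
              subst hf
              exact mem_filter.2 ⟨he, heq, by omega⟩
            · simp
        rw [tailCount, this]
        split_ifs <;> simp
      · have := hT.head_ne_tail e he e he
        rw [Ne, Fin.ext_iff] at this
        omega
    · refine ⟨0, fun j => ?_, by omega, fun h => absurd rfl h⟩
      rw [tailCount, if_neg (by omega), card_eq_zero, filter_eq_empty_iff]
      intro e he h
      exact H ⟨e, he, h.1⟩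
  have key2 : ∃ t ≤ n, (∀ i ≤ n, headCount T q i = if t < i then 1 else 0) ∧
      (t ≠ n → ∃ e ∈ T, (e.1 : ℕ) = q) := by
    by_cases H : ∃ e ∈ T, (e.1 : ℕ) = q
    · obtain ⟨e, he, heq⟩ := H
      refine ⟨e.2, by omega, fun i _ => ?_, fun _ => ⟨e, he, heq⟩⟩
      have : (T.filter fun f => (f.1 : ℕ) = q ∧ (f.2 : ℕ) < i) =
          if (e.2 : ℕ) < i then {e} else ∅ := by
        ext f
        constructor
        · intro hf
          rw [mem_filter] at hf
          obtain rfl := hT.head_inj f hf.1 e he (Fin.ext (by omega))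
          rw [if_pos (by omega)]
          simp
        · split_ifs with hj
          · intro hf
            rw [mem_singleton] at hf
            subst hf
            exact mem_filter.2 ⟨he, heq, by omega⟩
          · simp
      rw [headCount, this]
      split_ifs <;> simp
    · refine ⟨n, le_rfl, fun i hi => ?_, fun h => absurd rfl h⟩
      rw [headCount, if_neg (by omega), card_eq_zero, filter_eq_empty_iff]
      intro e he h
      exact H ⟨e, he, h.1⟩
  obtain ⟨h, h1, h2, h3⟩ := key1
  obtain ⟨t, t0, t1, t2⟩ := key2
  refine ⟨h, t, h1, t1, ?_, t0, h2⟩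
  by_contra! hc
  obtain ⟨e, he, e1⟩ := h3 hc.1
  obtain ⟨f, hf, f1⟩ := t2 hc.2
  exact hT.head_ne_tail f hf e he (Fin.ext (by omega))

/-- The order on link patterns by their counting functions, over the index range that matters. -/
def PatternLE (T T' : Finset (Fin n × Fin n)) : Prop :=
  ∀ i j : ℕ, i ≤ n → j ≤ n → arcCount T i j ≤ arcCount T' i j

/-- Exchanging two adjacent points makes a link pattern smaller or larger. -/
theorem IsLinkPattern.comparable {T : Finset (Fin n × Fin n)} (hT : IsLinkPattern T) (p : ℕ)
    (hp : p + 1 < n) : PatternLE T (movePattern (simpleSwap p hp) T) ∨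
      PatternLE (movePattern (simpleSwap p hp) T) T := by
  obtain ⟨h, t, h1, t1, c, tn, hq⟩ := hT.exists_threshold p
  obtain ⟨h', t', h1', t1', c', tn', hq'⟩ := hT.exists_threshold (p + 1)
  have key : (h ≤ h' ∧ t ≤ t') ∨ (h' ≤ h ∧ t' ≤ t) := by omega
  refine key.imp (fun hk i j hi hj => ?_) (fun hk i j hi hj => ?_)
  all_goals
    by_cases hi' : i = p + 1
    · subst hi'
      have e1 := arcCount_succ_left T p j
      have e2 := show arcCount T p (p + 1) = arcCount T p (p + 2) + headCount T (p + 1) p from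
        arcCount_succ_right T p _
      by_cases hj' : j = p + 1
      · subst hj'
        rw [arcCount_simpleSwap_both p hp hT]
        rw [h1] at e1
        rw [t1' _ (by omega)] at e2
        rw [t1 _ (by omega), h1']
        split_ifs at * <;> omega
      · rw [arcCount_simpleSwap_left p hp T hj']
        rw [h1] at e1
        rw [h1']
        split_ifs at * <;> omega
    · by_cases hj' : j = p + 1
      · subst hj'
        have e2 := show arcCount T i (p + 1) = arcCount T i (p + 2) + headCount T (p + 1) i from
          arcCount_succ_right T i _
        rw [arcCount_simpleSwap_right p hp T hi']
        rw [t1' _ hi] at e2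
        rw [t1 _ hi]
        split_ifs at * <;> omega
      · rw [arcCount_simpleSwap_of_ne p hp T hi' hj']

/-- A point that is a tail is not a head, hence does not contribute as the head of an arc. -/
theorem IsLinkPattern.tailCount_eq {T : Finset (Fin n × Fin n)} (hT : IsLinkPattern T)
    {m j : ℕ} (h : 0 < tailCount T m j) (q : ℕ) : tailCount T q m = tailCount T q (m + 1) := by
  obtain ⟨f, hf⟩ := card_pos.1 h
  rw [mem_filter] at hf
  rw [tailCount, tailCount]
  congr 1
  refine filter_congr fun e he => ?_
  have := hT.head_ne_tail e he f hf.1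
  rw [Ne, Fin.ext_iff] at this
  omega

/-- The entry of the counting functions affected by both coordinates of the transposition in the
lifting property. -/
theorem IsLinkPattern.lift_corner {T T' : Finset (Fin n × Fin n)} (hT : IsLinkPattern T)
    (hT' : IsLinkPattern T') (h : PatternLE T' T) (p : ℕ) (hp : p + 1 < n) :
    arcCount T' (p + 1) (p + 1) ≤
        arcCount T p (p + 2) + headCount T p p + tailCount T (p + 1) p ∨
      arcCount T' p (p + 2) + headCount T' p p + tailCount T' (p + 1) p ≤
        arcCount T p (p + 2) + headCount T p p + tailCount T (p + 1) p := by
  have bound : ∀ {S : Finset (Fin n × Fin n)}, IsLinkPattern S → ∀ q i j l, i ≤ n →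
      headCount S q i + tailCount S q j ≤ 1 ∧ (j ≤ l → tailCount S q l ≤ tailCount S q j) := by
    intro S hS q i j l hi
    obtain ⟨a, t, a1, t1, c, tn, aq⟩ := hS.exists_threshold q
    rw [a1, a1, t1 i hi]
    split_ifs <;> omega
  have e0 : arcCount T' (p + 1) (p + 1) =
      arcCount T' p (p + 2) + headCount T' (p + 1) p + tailCount T' p (p + 1) := by
    rw [arcCount_succ_left, arcCount_succ_right T' p (p + 1)]
  have e1 : arcCount T p p = arcCount T p (p + 2) + headCount T (p + 1) p + headCount T p p := by
    rw [arcCount_succ_right, arcCount_succ_right T p (p + 1)]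
  have e2 : arcCount T' p p =
      arcCount T' p (p + 2) + headCount T' (p + 1) p + headCount T' p p := by
    rw [arcCount_succ_right, arcCount_succ_right T' p (p + 1)]
  have e3 : arcCount T (p + 2) (p + 2) =
      arcCount T p (p + 2) + tailCount T p (p + 2) + tailCount T (p + 1) (p + 2) := by
    rw [arcCount_succ_left, arcCount_succ_left]
  have e4 : arcCount T' (p + 2) (p + 2) =
      arcCount T' p (p + 2) + tailCount T' p (p + 2) + tailCount T' (p + 1) (p + 2) := by
    rw [arcCount_succ_left, arcCount_succ_left]
  have g0 := h p (p + 2) (by omega) (by omega)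
  have g1 := h p p (by omega) (by omega)
  have g2 := h (p + 2) (p + 2) (by omega) (by omega)
  have b1 := (bound hT (p + 1) p p (p + 2) (by omega)).1
  have b2 := (bound hT (p + 1) p p (p + 2) (by omega)).2 (by omega)
  have b3 := (bound hT p p (p + 2) (p + 2) (by omega)).1
  have b1' := (bound hT' (p + 1) p p (p + 2) (by omega)).1
  have b3' := (bound hT' p p (p + 1) (p + 2) (by omega)).1
  rcases Nat.eq_zero_or_pos (tailCount T' p (p + 1)) with z | z
  · omega
  · rcases Nat.eq_zero_or_pos (tailCount T' (p + 1) p) with y | y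
    · omega
    · have z1 := hT'.tailCount_eq z (p + 1)
      have y1 : tailCount T' (p + 1) (p + 1) = tailCount T' (p + 1) (p + 2) :=
        hT'.tailCount_eq y (p + 1)
      have y2 : tailCount T' p (p + 1) = tailCount T' p (p + 2) := hT'.tailCount_eq y p
      omega

/-- The lifting property: if `T' ≤ T` then the smaller one of `T'` and its image under an adjacent
transposition `s` lies below `s T`. -/
theorem IsLinkPattern.lift {T T' : Finset (Fin n × Fin n)} (hT : IsLinkPattern T)
    (hT' : IsLinkPattern T') (h : PatternLE T' T) (p : ℕ) (hp : p + 1 < n) :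
    PatternLE T' (movePattern (simpleSwap p hp) T) ∨
      PatternLE (movePattern (simpleSwap p hp) T') (movePattern (simpleSwap p hp) T) := by
  have main : ∀ i j : ℕ, i ≤ n → j ≤ n →
      min (arcCount T' i j) (arcCount (movePattern (simpleSwap p hp) T') i j) ≤
        arcCount (movePattern (simpleSwap p hp) T) i j := by
    obtain ⟨a, t, a1, t1, c, tn, aq⟩ := hT.exists_threshold p
    obtain ⟨b, u, b1, u1, d, un, bq⟩ := hT.exists_threshold (p + 1)
    obtain ⟨a', t', a1', t1', c', tn', aq'⟩ := hT'.exists_threshold p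
    obtain ⟨b', u', b1', u1', d', un', bq'⟩ := hT'.exists_threshold (p + 1)
    intro i j hi hj
    rw [min_le_iff]
    have e0 := h i j hi hj
    by_cases hi' : i = p + 1
    · subst hi'
      have e1 := arcCount_succ_left T p j
      have e1' := arcCount_succ_left T' p j
      have e2 : arcCount T (p + 2) j = arcCount T (p + 1) j + tailCount T (p + 1) j :=
        arcCount_succ_left T (p + 1) j
      have e2' : arcCount T' (p + 2) j = arcCount T' (p + 1) j + tailCount T' (p + 1) j :=
        arcCount_succ_left T' (p + 1) j
      have g1 := h p j (by omega) hj
      have g2 := h (p + 2) j (by omega) hj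
      rw [a1] at e1
      rw [a1'] at e1'
      rw [b1] at e2
      rw [b1'] at e2'
      by_cases hj' : j = p + 1
      · subst hj'
        rw [arcCount_simpleSwap_both p hp hT, arcCount_simpleSwap_both p hp hT']
        exact hT.lift_corner hT' h p hp
      · rw [arcCount_simpleSwap_left p hp T hj', arcCount_simpleSwap_left p hp T' hj', b1, b1']
        split_ifs at * <;> omega
    · by_cases hj' : j = p + 1
      · subst hj'
        have e1 := show arcCount T i (p + 1) = arcCount T i (p + 2) + headCount T (p + 1) i from
          arcCount_succ_right T i _
        have e1' := show arcCount T' i (p + 1) = arcCount T' i (p + 2) + headCount T' (p + 1) i from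
          arcCount_succ_right T' i _
        have e2 := arcCount_succ_right T i p
        have e2' := arcCount_succ_right T' i p
        have g1 := h i p hi (by omega)
        have g2 := h i (p + 2) hi (by omega)
        rw [u1 _ hi] at e1
        rw [u1' _ hi] at e1'
        rw [t1 _ hi] at e2
        rw [t1' _ hi] at e2'
        rw [arcCount_simpleSwap_right p hp T hi', arcCount_simpleSwap_right p hp T' hi', t1 _ hi,
          t1' _ hi]
        split_ifs at * <;> omega
      · rw [arcCount_simpleSwap_of_ne p hp T hi' hj']
        omega
  refine (hT'.comparable p hp).imp (fun hc i j hi hj => ?_) (fun hc i j hi hj => ?_)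
  · have := main i j hi hj
    rwa [min_eq_left (hc i j hi hj)] at this
  · have := main i j hi hj
    rwa [min_eq_right (hc i j hi hj)] at this

end Patterns

/-! ### Length and Bruhat order -/

section Perms

open Finset

variable {n : ℕ}

/-- The inversions of a permutation. -/
def inversions (u : Equiv.Perm (Fin n)) : Finset (Fin n × Fin n) :=
  univ.filter fun p => p.1 < p.2 ∧ u p.2 < u p.1

theorem perm_apply_inv (f : Equiv.Perm (Fin n)) (x : Fin n) : f (f⁻¹ x) = x :=
  f.apply_symm_apply x

theorem mem_inversions {u : Equiv.Perm (Fin n)} {e : Fin n × Fin n} :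
    e ∈ inversions u ↔ e.1 < e.2 ∧ u e.2 < u e.1 := by simp [inversions]

theorem length_eq (u : Equiv.Perm (Fin n)) : length u = (inversions u).card := rfl

theorem length_lt_mul_swap {u : Equiv.Perm (Fin n)} {i j : Fin n} (hij : i < j) (h : u i < u j) :
    length u < length (u * Equiv.swap i j) := by
  -- Renaming the points by the transposition, unless this reverses the pair, embeds the
  -- inversions of `u` into those of `u * swap i j`, and misses `(i, j)`.
  set t := Equiv.swap i j with ht
  have tt : ∀ x, t (t x) = x := Equiv.swap_apply_self i j
  let g : Fin n × Fin n → Fin n × Fin n := fun e => if t e.1 < t e.2 then (t e.1, t e.2) else e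
  have tv : ∀ x, t x = if x = i then j else if x = j then i else x := fun x =>
    Equiv.swap_apply_def i j x
  rw [length_eq, length_eq]
  have hsub : (inversions u).image g ⊆ (inversions (u * t)).erase (i, j) := by
    intro e he
    obtain ⟨⟨a, b⟩, hab, rfl⟩ := mem_image.1 he
    rw [mem_inversions] at hab
    dsimp only at hab
    rw [mem_erase, mem_inversions]
    by_cases hlt : t a < t b
    · simp only [g, hlt, if_true, Equiv.Perm.mul_apply, tt]
      refine ⟨fun hc => ?_, trivial, hab.2⟩
      rw [Prod.mk.injEq] at hc
      have ha : a = j := by rw [← tt a, hc.1, tv]; simp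
      have hb : b = i := by rw [← tt b, hc.2, tv]; simp [hij.ne']
      subst ha hb
      exact absurd hab.1 (not_lt.2 hij.le)
    · simp only [g, hlt, if_false, Equiv.Perm.mul_apply]
      refine ⟨fun hc => ?_, hab.1, ?_⟩
      · rw [Prod.mk.injEq] at hc
        rw [hc.1, hc.2] at hab
        exact absurd hab.2 (not_lt.2 h.le)
      · have h1 := hab.1
        have h2 := hab.2
        rw [tv, tv] at hlt
        rw [tv, tv]
        have hu : ∀ x y, x = y → u x = u y := fun x y h => by rw [h]
        split_ifs at hlt ⊢ <;> subst_vars <;>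
          first
            | exact h2.trans h
            | exact h.trans h2
            | exact h
            | exact absurd h1 hlt
            | exact absurd h1 (lt_asymm hij)
            | omega
  have hinj : Set.InjOn g (inversions u : Set (Fin n × Fin n)) := by
    rintro ⟨a, b⟩ hab ⟨c, d⟩ hcd hg
    rw [mem_coe, mem_inversions] at hab hcd
    dsimp only at hab hcd
    simp only [g] at hg
    split_ifs at hg with c1 c2 c2
    · rw [Prod.mk.injEq] at hg
      rw [← tt a, ← tt b, hg.1, hg.2, tt, tt]
    · rw [Prod.mk.injEq] at hg
      rw [← hg.1, ← hg.2, tt, tt] at c2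
      exact absurd hab.1 c2
    · rw [Prod.mk.injEq] at hg
      rw [hg.1, hg.2, tt, tt] at c1
      exact absurd hcd.1 c1
    · exact hg
  have hmem : (i, j) ∈ inversions (u * t) := by
    rw [mem_inversions]
    refine ⟨hij, ?_⟩
    simpa [t] using h
  calc (inversions u).card = ((inversions u).image g).card := (card_image_of_injOn hinj).symm
    _ ≤ ((inversions (u * t)).erase (i, j)).card := card_le_card hsub
    _ < (inversions (u * t)).card := card_erase_lt_of_mem hmem

theorem length_lt_mul_swap_iff {u : Equiv.Perm (Fin n)} {i j : Fin n} (hij : i < j) :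
    length u < length (u * Equiv.swap i j) ↔ u i < u j := by
  refine ⟨fun h => ?_, length_lt_mul_swap hij⟩
  by_contra hc
  have h1 : (u * Equiv.swap i j) i < (u * Equiv.swap i j) j := by
    simpa using lt_of_le_of_ne (not_lt.1 hc) fun hh => hij.ne' (u.injective hh)
  have h2 := length_lt_mul_swap hij h1
  rw [mul_assoc, Equiv.swap_mul_self, mul_one] at h2
  omega

theorem simpleSwap_lt_iff (p : ℕ) (hp : p + 1 < n) {x y : Fin n} (h : ¬ ((x : ℕ) = p ∧
    (y : ℕ) = p + 1)) (h' : ¬ ((x : ℕ) = p + 1 ∧ (y : ℕ) = p)) :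
    simpleSwap p hp x < simpleSwap p hp y ↔ x < y := by
  rw [Fin.lt_def, Fin.lt_def, simpleSwap_val, simpleSwap_val]
  split_ifs <;> omega

/-- Left multiplication by an adjacent transposition that exchanges two values in increasing
position creates exactly one inversion. -/
theorem length_simpleSwap_mul (p : ℕ) (hp : p + 1 < n) {u : Equiv.Perm (Fin n)} {a b : Fin n}
    (ha : (u a : ℕ) = p) (hb : (u b : ℕ) = p + 1) (hab : a < b) :
    length (simpleSwap p hp * u) = length u + 1 := by
  have : inversions (simpleSwap p hp * u) = insert (a, b) (inversions u) := by
    ext ⟨x, y⟩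
    rw [mem_insert, mem_inversions, mem_inversions, Prod.mk.injEq]
    dsimp only
    rw [Equiv.Perm.mul_apply, Equiv.Perm.mul_apply]
    have hx : ∀ z, (u z : ℕ) = p ↔ z = a := fun z => by
      rw [← ha, ← Fin.ext_iff, u.injective.eq_iff]
    have hy : ∀ z, (u z : ℕ) = p + 1 ↔ z = b := fun z => by
      rw [← hb, ← Fin.ext_iff, u.injective.eq_iff]
    by_cases c1 : x = a ∧ y = b
    · obtain ⟨rfl, rfl⟩ := c1
      simp only [and_self, true_or, iff_true]
      refine ⟨hab, ?_⟩
      rw [Fin.lt_def, simpleSwap_val, simpleSwap_val]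
      split_ifs <;> omega
    · by_cases c2 : x = b ∧ y = a
      · obtain ⟨rfl, rfl⟩ := c2
        have := hab.not_gt
        have h3 : ¬ (x = y) := hab.ne'
        simp [this, h3]
      · rw [simpleSwap_lt_iff p hp (by rw [hx, hy]; tauto) (by rw [hx, hy]; tauto)]
        simp [c1]
  rw [length_eq, this, card_insert_of_notMem, length_eq]
  rw [mem_inversions]
  dsimp only
  rw [Fin.lt_def (a := u b)]
  omega

theorem exists_descent {u : Equiv.Perm (Fin n)} (hu : u ≠ 1) :
    ∃ (p : ℕ) (_ : p + 1 < n) (a b : Fin n), (u a : ℕ) = p + 1 ∧ (u b : ℕ) = p ∧ a < b := by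
  by_contra! hc
  apply hu
  have hmono : ∀ k : ℕ, ∀ x y : Fin n, (y : ℕ) = x + k + 1 → u⁻¹ x < u⁻¹ y := by
    intro k
    induction k with
    | zero =>
      intro x y hxy
      have := hc x (by omega) (u⁻¹ y) (u⁻¹ x) (by simp; omega) (by simp)
      exact lt_of_le_of_ne this fun h => by
        have := u⁻¹.injective h
        rw [this] at hxy
        omega
    | succ k ih =>
      intro x y hxy
      have h1 := ih x ⟨x + k + 1, by omega⟩ rfl
      have := hc (x + k + 1) (by omega) (u⁻¹ y) (u⁻¹ ⟨x + k + 1, by omega⟩) (by simp; omega)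
        (by simp)
      exact h1.trans_le this
  have hs : StrictMono (u⁻¹ : Equiv.Perm (Fin n)) := fun x y hxy =>
    hmono (y - x - 1) x y (by have := Fin.lt_def.1 hxy; omega)
  have : (u⁻¹ : Equiv.Perm (Fin n)) = 1 := by
    ext x
    rw [hs.eq_id]
    rfl
  rwa [inv_eq_one] at this

/-- The exchange step behind the lifting property of the Bruhat order. -/
theorem simpleSwap_mul_step {u v : Equiv.Perm (Fin n)}
    (h : length u < length v ∧ ∃ i j : Fin n, i ≠ j ∧ v = u * Equiv.swap i j) (p : ℕ)
    (hp : p + 1 < n) : simpleSwap p hp * u = v ∨ (length (simpleSwap p hp * u) <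
      length (simpleSwap p hp * v) ∧ ∃ i j : Fin n, i ≠ j ∧
        simpleSwap p hp * v = simpleSwap p hp * u * Equiv.swap i j) := by
  obtain ⟨hl, i, j, hij, rfl⟩ := h
  wlog hlt : i < j generalizing i j
  · rw [Equiv.swap_comm] at hl ⊢
    exact this j i hij.symm hl (lt_of_le_of_ne (not_lt.1 hlt) hij.symm)
  rw [length_lt_mul_swap_iff hlt] at hl
  by_cases hc : (u i : ℕ) = p ∧ (u j : ℕ) = p + 1
  · left
    rw [Equiv.mul_swap_eq_swap_mul]
    congr 1
    rw [simpleSwap]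
    congr 1 <;> exact Fin.ext (by simp [hc.1, hc.2])
  · right
    refine ⟨?_, i, j, hij, by rw [mul_assoc]⟩
    rw [← mul_assoc, length_lt_mul_swap_iff hlt, Equiv.Perm.mul_apply, Equiv.Perm.mul_apply]
    rw [Fin.lt_def] at hl
    rw [simpleSwap_lt_iff p hp hc (by omega)]
    exact hl

/-- The lifting property of the Bruhat order, in a form that does not ask how `s` changes the
lengths. -/
theorem Bruhat.lift {u v : Equiv.Perm (Fin n)} (h : Bruhat u v) (p : ℕ) (hp : p + 1 < n) :
    Bruhat u (simpleSwap p hp * v) ∨ Bruhat (simpleSwap p hp * u) (simpleSwap p hp * v) := by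
  induction h using Relation.ReflTransGen.head_induction_on with
  | refl => exact Or.inr Relation.ReflTransGen.refl
  | head hac _ ih =>
    rcases simpleSwap_mul_step hac p hp with h1 | h1
    · rcases ih with h2 | h2
      · exact Or.inr (h1 ▸ h2)
      · rw [← h1, ← mul_assoc, simpleSwap_mul_self, one_mul] at h2
        exact Or.inl h2
    · rcases ih with h2 | h2
      · exact Or.inl (h2.head hac)
      · exact Or.inr (h2.head h1)

theorem bruhat_simpleSwap_mul {u : Equiv.Perm (Fin n)} {p : ℕ} {hp : p + 1 < n}
    (h : length u < length (simpleSwap p hp * u)) : Bruhat u (simpleSwap p hp * u) := by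
  refine Relation.ReflTransGen.single ⟨h, u⁻¹ ⟨p, by omega⟩, u⁻¹ ⟨p + 1, hp⟩, ?_, ?_⟩
  · intro hc
    have := u⁻¹.injective hc
    rw [Fin.mk.injEq] at this
    omega
  · rw [Equiv.mul_swap_eq_swap_mul]
    simp [simpleSwap]

theorem Bruhat.simpleSwap_mul {u v : Equiv.Perm (Fin n)} (h : Bruhat u v) {p : ℕ}
    {hp : p + 1 < n} (hv : length v < length (simpleSwap p hp * v)) :
    Bruhat (simpleSwap p hp * u) (simpleSwap p hp * v) := by
  induction h using Relation.ReflTransGen.head_induction_on with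
  | refl => exact Relation.ReflTransGen.refl
  | head hac hcv ih =>
    rcases simpleSwap_mul_step hac p hp with h1 | h1
    · rw [h1]
      exact Relation.ReflTransGen.trans hcv (bruhat_simpleSwap_mul hv)
    · exact ih.head h1

theorem bruhat_one {u : Equiv.Perm (Fin n)} (h : Bruhat u 1) : u = 1 := by
  induction h using Relation.ReflTransGen.head_induction_on with
  | refl => rfl
  | head hac _ ih =>
    subst ih
    have h1 := hac.1
    have h0 : length (1 : Equiv.Perm (Fin n)) = 0 := by
      rw [length_eq, card_eq_zero]
      ext e
      rw [mem_inversions]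
      simp only [Equiv.Perm.one_apply, notMem_empty, iff_false, not_and, not_lt]
      exact fun h => h.le
    omega

/-! ### Block monotone permutations and the arcs they define -/

/-- The permutations that increase on the middle and on the last of the three blocks of sizes
`r`, `n - 2 r` and `r`. These are the products `σ w` of the parametrisation. -/
def BlockMono (r : ℕ) (v : Equiv.Perm (Fin n)) : Prop :=
  ∀ i j : Fin n, i < j → (r ≤ (i : ℕ) ∧ (j : ℕ) < n - r ∨ n - r ≤ (i : ℕ)) → v i < v j

theorem BlockMono.one (r : ℕ) : BlockMono r (1 : Equiv.Perm (Fin n)) := fun _ _ h _ => h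

theorem BlockMono.simpleSwap_mul {r : ℕ} {v : Equiv.Perm (Fin n)} (hv : BlockMono r v) {p : ℕ}
    (hp : p + 1 < n) {a b : Fin n} (ha : (v a : ℕ) = p + 1) (hb : (v b : ℕ) = p) (hab : a < b) :
    BlockMono r (simpleSwap p hp * v) := by
  intro i j hij hb'
  have h := hv i j hij hb'
  rw [Equiv.Perm.mul_apply, Equiv.Perm.mul_apply, simpleSwap_lt_iff p hp]
  · exact h
  · rintro ⟨h1, h2⟩
    have e1 : i = b := v.injective (Fin.ext (by omega))
    have e2 : j = a := v.injective (Fin.ext (by omega))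
    subst e1 e2
    exact absurd hij hab.not_gt
  · rw [Fin.lt_def] at h
    omega

/-- A permutation preserving an interval and increasing on it fixes the interval pointwise. -/
theorem fixes_interval {τ : Equiv.Perm (Fin n)} {a b : ℕ}
    (hp : ∀ i : Fin n, a ≤ (i : ℕ) → (i : ℕ) < b → a ≤ (τ i : ℕ) ∧ (τ i : ℕ) < b)
    (hm : ∀ i j : Fin n, a ≤ (i : ℕ) → (j : ℕ) < b → i < j → τ i < τ j) :
    ∀ i : Fin n, a ≤ (i : ℕ) → (i : ℕ) < b → τ i = i := by
  have h1 : ∀ m : ℕ, ∀ i : Fin n, (i : ℕ) = m → a ≤ (i : ℕ) → (i : ℕ) < b → i ≤ τ i := by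
    intro m
    induction m using Nat.strong_induction_on with
    | _ m ih =>
      intro i him hai hib
      by_contra hc
      rw [not_le] at hc
      have hh := hp i hai hib
      have h2 := ih (τ i) (by rw [Fin.lt_def] at hc; omega) (τ i) rfl hh.1 hh.2
      have h3 := hm (τ i) i hh.1 hib hc
      exact absurd h2 (not_le.2 h3)
  have h2 : ∀ m : ℕ, ∀ i : Fin n, b - (i : ℕ) = m → a ≤ (i : ℕ) → (i : ℕ) < b → τ i ≤ i := by
    intro m
    induction m using Nat.strong_induction_on with
    | _ m ih =>
      intro i him hai hib
      by_contra hc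
      rw [not_le] at hc
      have hh := hp i hai hib
      have h2 := ih (b - τ i) (by rw [Fin.lt_def] at hc; omega) (τ i) rfl hh.1 hh.2
      have h3 := hm i (τ i) hai hh.2 hc
      exact absurd h2 (not_le.2 h3)
  exact fun i hai hib => le_antisymm (h2 _ i rfl hai hib) (h1 _ i rfl hai hib)

/-- The arcs of the matrix `x_r`: they join the last `r` points, in order, to the first `r`. -/
def baseArcs (n r : ℕ) : Finset (Fin n × Fin n) :=
  univ.filter fun e => (e.2 : ℕ) = e.1 + (n - r)

theorem mem_baseArcs {r : ℕ} {e : Fin n × Fin n} :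
    e ∈ baseArcs n r ↔ (e.2 : ℕ) = e.1 + (n - r) := by simp [baseArcs]

theorem baseArcs_isLinkPattern {r : ℕ} (h : 2 * r ≤ n) : IsLinkPattern (baseArcs n r) := by
  refine ⟨fun e he f hf hh => ?_, fun e he f hf hh => ?_, fun e he f hf hh => ?_⟩ <;>
    rw [mem_baseArcs] at he hf <;> rw [Fin.ext_iff] at hh
  · exact Prod.ext (Fin.ext hh) (Fin.ext (by omega))
  · exact Prod.ext (Fin.ext (by omega)) (Fin.ext hh)
  · omega

theorem card_baseArcs {r : ℕ} (h : r ≤ n) : (baseArcs n r).card = r := by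
  have : (baseArcs n r).card = (univ : Finset (Fin r)).card := by
    symm
    refine card_bij (fun i _ => (⟨i, by omega⟩, ⟨i + (n - r), by omega⟩)) ?_ ?_ ?_
    · intro i _
      rw [mem_baseArcs]
    · intro i _ j _ hij
      simp only [Prod.mk.injEq, Fin.mk.injEq] at hij
      exact Fin.ext hij.1
    · intro e he
      rw [mem_baseArcs] at he
      refine ⟨⟨e.1, by omega⟩, mem_univ _, Prod.ext rfl (Fin.ext he.symm)⟩
  rw [this, card_univ, Fintype.card_fin]

/-- Block monotone permutations are determined by their link patterns. -/
theorem BlockMono.eq_of_movePattern_eq {r : ℕ} (h : 2 * r ≤ n) {v v' : Equiv.Perm (Fin n)}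
    (hv : BlockMono r v) (hv' : BlockMono r v')
    (he : movePattern v (baseArcs n r) = movePattern v' (baseArcs n r)) : v = v' := by
  set τ := v⁻¹ * v' with hτ
  have hvτ : ∀ i, v (τ i) = v' i := fun i => by simp [τ]
  -- `τ` stabilises the arcs of `x_r`, hence respects the three blocks.
  have key : ∀ b a : Fin n, (b, a) ∈ baseArcs n r → (τ b, τ a) ∈ baseArcs n r := by
    intro b a hab
    have : (v' b, v' a) ∈ movePattern v' (baseArcs n r) := mem_movePattern.2 (by simpa using hab)
    rw [← he] at this
    have h2 := mem_movePattern.1 this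
    simpa [τ, Equiv.Perm.inv_def] using h2
  have key' : ∀ b a : Fin n, (τ b, τ a) ∈ baseArcs n r → (b, a) ∈ baseArcs n r := by
    intro b a hab
    have : (v' b, v' a) ∈ movePattern v (baseArcs n r) :=
      mem_movePattern.2 (by simpa [τ, Equiv.Perm.inv_def] using hab)
    rw [he] at this
    have h2 := mem_movePattern.1 this
    simpa using h2
  have first : ∀ i : Fin n, (i : ℕ) < r ↔ (τ i : ℕ) < r := by
    intro i
    constructor
    · intro hi
      have := key i ⟨i + (n - r), by omega⟩ (mem_baseArcs.2 rfl)
      rw [mem_baseArcs] at this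
      dsimp only at this
      omega
    · intro hi
      have := key' i (τ⁻¹ ⟨τ i + (n - r), by omega⟩) (mem_baseArcs.2 (by simp))
      rw [mem_baseArcs] at this
      dsimp only at this
      omega
  have last : ∀ i : Fin n, n - r ≤ (i : ℕ) ↔ n - r ≤ (τ i : ℕ) := by
    intro i
    constructor
    · intro hi
      have := key ⟨i - (n - r), by omega⟩ i (mem_baseArcs.2 (by simp; omega))
      rw [mem_baseArcs] at this
      dsimp only at this
      omega
    · intro hi
      have := key' (τ⁻¹ ⟨τ i - (n - r), by omega⟩) i (mem_baseArcs.2 (by simp; omega))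
      rw [mem_baseArcs] at this
      dsimp only at this
      omega
  have mono : ∀ i j : Fin n, i < j → (r ≤ (i : ℕ) ∧ (j : ℕ) < n - r ∨ n - r ≤ (i : ℕ)) →
      τ i < τ j := by
    intro i j hij hb
    by_contra hc
    have h1 := hv' i j hij hb
    rw [← hvτ, ← hvτ] at h1
    have hne : τ j < τ i := lt_of_le_of_ne (not_lt.1 hc) fun hh => hij.ne' (τ.injective hh)
    have f1 := first i
    have f2 := first j
    have l1 := last i
    have l2 := last j
    rw [Fin.lt_def] at hij
    exact absurd h1 (hv _ _ hne (by omega)).not_gt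
  have mid : ∀ i : Fin n, r ≤ (i : ℕ) → (i : ℕ) < n - r → τ i = i :=
    fixes_interval (fun i h1 h2 => by have := first i; have := last i; omega)
      (fun i j h1 h2 hij => mono i j hij (Or.inl ⟨h1, h2⟩))
  have lst : ∀ i : Fin n, n - r ≤ (i : ℕ) → (i : ℕ) < n → τ i = i :=
    fixes_interval (fun i h1 h2 => by have := last i; omega)
      (fun i j h1 h2 hij => mono i j hij (Or.inr h1))
  have : τ = 1 := by
    ext i
    by_cases c1 : (i : ℕ) < r
    · have h1 := key i ⟨i + (n - r), by omega⟩ (mem_baseArcs.2 rfl)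
      have h2 := lst ⟨i + (n - r), by omega⟩ (Nat.le_add_left _ _)
        (show (i : ℕ) + (n - r) < n by omega)
      rw [h2, mem_baseArcs] at h1
      dsimp only at h1
      rw [Equiv.Perm.one_apply]
      omega
    · by_cases c2 : (i : ℕ) < n - r
      · rw [mid i (by omega) c2]; rfl
      · rw [lst i (by omega) (by omega)]; rfl
  exact (inv_mul_eq_one.1 this)

/-! ### Minimal representatives -/

theorem simpleSwap_mem_weylParabolic {r p : ℕ} (hp : p + 1 < n) (h1 : p + 1 ≠ r)
    (h2 : p + 1 ≠ n - r) : simpleSwap p hp ∈ weylParabolic n r := by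
  intro i
  rw [simpleSwap_val]
  split_ifs <;> omega

/-- Minimal representatives increase on each of the three blocks. -/
theorem minReps_lt {r : ℕ} {σ : Equiv.Perm (Fin n)} (hσ : σ ∈ minReps n r) {i j : Fin n}
    (hij : i < j) (h1 : (i : ℕ) < r → (j : ℕ) < r) (h2 : (i : ℕ) < n - r → (j : ℕ) < n - r) :
    σ i < σ j := by
  have step : ∀ (p : ℕ) (hp : p + 1 < n), p + 1 ≠ r → p + 1 ≠ n - r →
      σ ⟨p, Nat.lt_of_succ_lt hp⟩ < σ ⟨p + 1, hp⟩ := by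
    intro p hp c1 c2
    by_contra hc
    have h3 := hσ _ (simpleSwap_mem_weylParabolic hp c1 c2)
    have hlt : (⟨p, by omega⟩ : Fin n) < ⟨p + 1, hp⟩ := by rw [Fin.lt_def]; simp
    have h4 : length (σ * simpleSwap p hp) < length (σ * simpleSwap p hp * simpleSwap p hp) := by
      refine length_lt_mul_swap hlt ?_
      simp only [simpleSwap, Equiv.Perm.mul_apply, Equiv.swap_apply_left, Equiv.swap_apply_right]
      exact lt_of_le_of_ne (not_lt.1 hc) fun hh => hlt.ne' (σ.injective hh)
    rw [mul_assoc, simpleSwap_mul_self, mul_one] at h4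
    omega
  obtain ⟨k, hk⟩ : ∃ k, (j : ℕ) = i + k + 1 := ⟨j - i - 1, by rw [Fin.lt_def] at hij; omega⟩
  clear hij
  revert h1 h2
  induction k generalizing j with
  | zero =>
    intro h1 h2
    have hj : j = ⟨i + 1, by omega⟩ := Fin.ext hk
    rw [hj]
    exact step i (by omega) (by omega) (by omega)
  | succ k ih =>
    intro h1 h2
    have h3 := ih (j := ⟨i + k + 1, by omega⟩) rfl (by simp only; omega) (by simp only; omega)
    have h4 := step (i + k + 1) (by omega) (by omega) (by omega)
    have hj : j = ⟨i + k + 1 + 1, by omega⟩ := Fin.ext hk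
    rw [hj]
    exact h3.trans h4

variable {r : ℕ}

theorem extend_apply_lt (h : 2 * r ≤ n) (w : Equiv.Perm (Fin r)) {i : Fin n} (hi : (i : ℕ) < r) :
    (extend h w i : ℕ) = w ⟨i, hi⟩ := by
  have := Equiv.Perm.viaFintypeEmbedding_apply_image w
    (Fin.castLEEmb (show r ≤ n by omega)) ⟨i, hi⟩
  have e : (Fin.castLEEmb (show r ≤ n by omega)) ⟨i, hi⟩ = i := Fin.ext rfl
  rw [e] at this
  rw [extend, this]
  rfl

theorem extend_apply_ge (h : 2 * r ≤ n) (w : Equiv.Perm (Fin r)) {i : Fin n}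
    (hi : r ≤ (i : ℕ)) : extend h w i = i := by
  refine Equiv.Perm.viaFintypeEmbedding_apply_notMem_range w _ ?_
  rintro ⟨j, rfl⟩
  have : ((Fin.castLEEmb (show r ≤ n by omega)) j : ℕ) = j := rfl
  omega

theorem blockMono_of_mem_minReps (h : 2 * r ≤ n) {σ : Equiv.Perm (Fin n)} (hσ : σ ∈ minReps n r)
    (w : Equiv.Perm (Fin r)) : BlockMono r (σ * extend h w) := by
  intro i j hij hb
  rw [Fin.lt_def] at hij
  rw [Equiv.Perm.mul_apply, Equiv.Perm.mul_apply, extend_apply_ge h w (by omega),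
    extend_apply_ge h w (by omega)]
  exact minReps_lt hσ hij (by omega) (by omega)

theorem length_mul_extend (h : 2 * r ≤ n) {σ : Equiv.Perm (Fin n)} (hσ : σ ∈ minReps n r)
    (w : Equiv.Perm (Fin r)) : length (σ * extend h w) = length σ + length w := by
  set c : Fin r → Fin n := Fin.castLE (by omega) with hc
  have hcw : ∀ i, extend h w (c i) = c (w i) := fun i => Fin.ext (extend_apply_lt h w i.2)
  -- The inversions inside the first block are those of `w`.
  have e1 : ((inversions (σ * extend h w)).filter fun e => (e.2 : ℕ) < r).card = length w := by
    rw [length_eq]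
    symm
    refine card_bij (fun e _ => (c e.1, c e.2)) ?_ ?_ ?_
    · intro e he
      rw [mem_inversions] at he
      rw [mem_filter, mem_inversions]
      refine ⟨⟨he.1, ?_⟩, e.2.2⟩
      simp only [Equiv.Perm.mul_apply, hcw]
      exact minReps_lt hσ he.2 (fun _ => (w e.1).2) (fun _ => by
        have := (w e.1).2
        simp only [hc, Fin.val_castLE]
        omega)
    · intro e _ f _ hef
      simp only [Prod.mk.injEq, hc, Fin.castLE_inj] at hef
      exact Prod.ext hef.1 hef.2
    · rintro ⟨a, b⟩ hab
      rw [mem_filter, mem_inversions] at hab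
      dsimp only at hab
      have hlt := hab.1.1
      rw [Fin.lt_def] at hlt
      refine ⟨(⟨a, by omega⟩, ⟨b, by omega⟩), ?_, rfl⟩
      rw [mem_inversions]
      refine ⟨hab.1.1, ?_⟩
      by_contra hcon
      have h2 := hab.1.2
      rw [Equiv.Perm.mul_apply, Equiv.Perm.mul_apply] at h2
      change σ (extend h w (c ⟨b, by omega⟩)) < σ (extend h w (c ⟨a, by omega⟩)) at h2
      rw [hcw, hcw] at h2
      have hne : w ⟨a, by omega⟩ < w ⟨b, by omega⟩ := by
        refine lt_of_le_of_ne (not_lt.1 hcon) fun hh => ?_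
        have := w.injective hh
        rw [Fin.mk.injEq] at this
        omega
      have := minReps_lt hσ (i := c (w ⟨a, by omega⟩)) (j := c (w ⟨b, by omega⟩)) hne
        (fun _ => (w _).2) (fun _ => by
          have := (w ⟨b, by omega⟩).2
          simp only [hc, Fin.val_castLE]
          omega)
      exact absurd h2 this.not_gt
  -- The other inversions are those of `σ`, which has none inside the first block.
  have e2 : ((inversions (σ * extend h w)).filter fun e => ¬ (e.2 : ℕ) < r).card = length σ := by
    rw [length_eq]
    refine card_bij (fun e _ => (extend h w e.1, extend h w e.2)) ?_ ?_ ?_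
    · rintro ⟨a, b⟩ hab
      rw [mem_filter, mem_inversions] at hab
      dsimp only at hab
      rw [mem_inversions]
      refine ⟨?_, hab.1.2⟩
      dsimp only
      have hlt := hab.1.1
      rw [Fin.lt_def] at hlt ⊢
      rw [extend_apply_ge h w (not_lt.1 hab.2)]
      by_cases ha : (a : ℕ) < r
      · rw [extend_apply_lt h w ha]
        omega
      · rw [extend_apply_ge h w (not_lt.1 ha)]
        exact hlt
    · intro e _ f _ hef
      rw [Prod.mk.injEq] at hef
      exact Prod.ext ((extend h w).injective hef.1) ((extend h w).injective hef.2)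
    · rintro ⟨a, b⟩ hab
      rw [mem_inversions] at hab
      dsimp only at hab
      have hb : ¬ (b : ℕ) < r := fun hb =>
        absurd hab.2 (minReps_lt hσ hab.1 (fun _ => hb) (fun _ => by omega)).not_gt
      have hlt := hab.1
      rw [Fin.lt_def] at hlt
      refine ⟨((extend h w)⁻¹ a, b), ?_, ?_⟩
      · rw [mem_filter, mem_inversions]
        simp only [Equiv.Perm.mul_apply, extend_apply_ge h w (not_lt.1 hb), perm_apply_inv]
        refine ⟨⟨?_, hab.2⟩, hb⟩
        rw [Fin.lt_def]
        by_cases hh : ((extend h w)⁻¹ a : ℕ) < r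
        · omega
        · have := extend_apply_ge h w (not_lt.1 hh)
          rw [perm_apply_inv] at this
          rw [← this]
          exact hlt
      · simp only [extend_apply_ge h w (not_lt.1 hb), perm_apply_inv]
  rw [← e1, ← e2, add_comm, length_eq, card_filter_add_card_filter_not]

theorem minReps_mul_extend_injective (h : 2 * r ≤ n) {σ σ' : Equiv.Perm (Fin n)}
    (hσ : σ ∈ minReps n r) (hσ' : σ' ∈ minReps n r) {w w' : Equiv.Perm (Fin r)}
    (he : σ * extend h w = σ' * extend h w') : σ = σ' ∧ w = w' := by
  set τ := extend h w' * (extend h w)⁻¹ with hτ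
  have hs : ∀ i, σ i = σ' (τ i) := fun i => by
    have : σ = σ' * τ := by rw [hτ, ← mul_assoc, ← he, mul_inv_cancel_right]
    rw [this]; rfl
  have lt_inv : ∀ i : Fin n, (i : ℕ) < r → ((extend h w)⁻¹ i : ℕ) < r := by
    intro i hi
    by_contra hc
    have := extend_apply_ge h w (not_lt.1 hc)
    rw [perm_apply_inv] at this
    rw [← this] at hc
    exact hc hi
  have hlt : ∀ i : Fin n, (i : ℕ) < r → (τ i : ℕ) < r := by
    intro i hi
    rw [hτ, Equiv.Perm.mul_apply, extend_apply_lt h w' (lt_inv i hi)]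
    exact (w' _).2
  have hfix : ∀ i : Fin n, τ i = i := by
    intro i
    by_cases hi : (i : ℕ) < r
    · refine fixes_interval (a := 0) (b := r) (fun i _ h2 => ⟨Nat.zero_le _, hlt i h2⟩)
        (fun i j _ hj hij => ?_) i (Nat.zero_le _) hi
      have hij' := Fin.lt_def.1 hij
      by_contra hc
      have h1 := minReps_lt hσ hij (fun _ => hj) (fun _ => by omega)
      rw [hs, hs] at h1
      have h2 := hlt i (by omega)
      have h3 := minReps_lt hσ' (lt_of_le_of_ne (not_lt.1 hc)
        fun hh => hij.ne' (τ.injective hh)) (fun _ => h2) (fun _ => by omega)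
      exact absurd h1 h3.not_gt
    · have : (extend h w)⁻¹ i = i := by
        rw [Equiv.Perm.inv_eq_iff_eq, extend_apply_ge h w (not_lt.1 hi)]
      rw [hτ, Equiv.Perm.mul_apply, this, extend_apply_ge h w' (not_lt.1 hi)]
  have hσσ : σ = σ' := by
    ext i
    rw [hs, hfix]
  refine ⟨hσσ, ?_⟩
  subst hσσ
  have := mul_left_cancel he
  ext i
  have e := congrArg (fun f : Equiv.Perm (Fin n) => (f (Fin.castLE (by omega) i) : ℕ)) this
  rw [extend_apply_lt h w (i := Fin.castLE (by omega) i) i.2,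
    extend_apply_lt h w' (i := Fin.castLE (by omega) i) i.2] at e
  exact e

/-- Every link pattern with `r` arcs is obtained by renaming the points of the base pattern. -/
theorem IsLinkPattern.exists_movePattern {T : Finset (Fin n × Fin n)} (hT : IsLinkPattern T)
    (hc : T.card = r) (h : 2 * r ≤ n) : ∃ v, movePattern v (baseArcs n r) = T := by
  classical
  let e : Fin r ≃ T := (T.equivFinOfCardEq hc).symm
  let P : Fin n → Prop := fun i => (i : ℕ) < r ∨ n - r ≤ (i : ℕ)
  let f : {i // P i} → Fin n := fun i =>
    if hi : ((i : Fin n) : ℕ) < r then (e ⟨i, hi⟩).1.1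
    else (e ⟨(i : Fin n) - (n - r), by have := i.1.2; omega⟩).1.2
  have hf : Function.Injective f := by
    rintro ⟨i, hi⟩ ⟨j, hj⟩ hij
    apply Subtype.ext
    apply Fin.ext
    have inj : ∀ a b : Fin r, (e a).1 = (e b).1 → (a : ℕ) = b := fun a b hab => by
      rw [e.injective (Subtype.ext hab)]
    simp only [P] at hi hj
    simp only [f] at hij
    split_ifs at hij with c1 c2 c2
    · exact inj _ _ (hT.head_inj _ (e _).2 _ (e _).2 hij)
    · exact absurd hij (hT.head_ne_tail _ (e _).2 _ (e _).2)
    · exact absurd hij.symm (hT.head_ne_tail _ (e _).2 _ (e _).2)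
    · have := inj _ _ (hT.tail_inj _ (e _).2 _ (e _).2 hij)
      dsimp only at this ⊢
      omega
  let v : Equiv.Perm (Fin n) := (Equiv.ofInjective f hf).extendSubtype
  have hv : ∀ i (hi : P i), v i = f ⟨i, hi⟩ := fun i hi =>
    Equiv.extendSubtype_apply_of_mem _ i hi
  refine ⟨v, eq_of_subset_of_card_le (fun p hp => ?_) ?_⟩
  · rw [mem_movePattern, mem_baseArcs] at hp
    dsimp only at hp
    have h1 := hv (v.symm p.1) (Or.inl (by omega))
    have h2 := hv (v.symm p.2) (Or.inr (by omega))
    rw [Equiv.apply_symm_apply] at h1 h2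
    simp only [f] at h1 h2
    rw [dif_pos (by omega)] at h1
    rw [dif_neg (by omega)] at h2
    have h3 : p = (e ⟨v.symm p.1, by omega⟩).1 := by
      refine Prod.ext h1 (h2.trans ?_)
      congr
      omega
    rw [h3]
    exact (e _).2
  · rw [card_movePattern, card_baseArcs (by omega), hc]

/-- A permutation preserving the first `m` points preserves the others, by counting. -/
theorem weylParabolic_ge {m : ℕ} {τ : Equiv.Perm (Fin n)}
    (hτ : ∀ i : Fin n, (i : ℕ) < m → (τ i : ℕ) < m) {i : Fin n} (hi : m ≤ (i : ℕ)) :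
    m ≤ (τ i : ℕ) := by
  by_contra hc
  have hsub : (univ.filter fun j : Fin n => (j : ℕ) < m).image τ ⊆
      univ.filter fun j : Fin n => (j : ℕ) < m := by
    intro j hj
    obtain ⟨a, ha, rfl⟩ := mem_image.1 hj
    simp only [mem_filter, mem_univ, true_and] at ha ⊢
    exact hτ a ha
  have heq := eq_of_subset_of_card_le hsub (by rw [card_image_of_injective _ τ.injective])
  have hmem : τ i ∈ univ.filter fun j : Fin n => (j : ℕ) < m := by simpa using hc
  rw [← heq] at hmem
  obtain ⟨a, ha, hai⟩ := mem_image.1 hmem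
  rw [τ.injective hai] at ha
  simp only [mem_filter, mem_univ, true_and] at ha
  omega

/-- Every link pattern with `r` arcs comes from one of the parameters `(σ, w)`. -/
theorem exists_minReps_movePattern {T : Finset (Fin n × Fin n)} (hT : IsLinkPattern T)
    (hc : T.card = r) (h : 2 * r ≤ n) : ∃ σ ∈ minReps n r, ∃ w : Equiv.Perm (Fin r),
      movePattern (σ * extend h w) (baseArcs n r) = T := by
  classical
  obtain ⟨v, rfl⟩ := hT.exists_movePattern hc h
  have hone : (1 : Equiv.Perm (Fin n)) ∈ weylParabolic n r := fun i => ⟨id, id⟩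
  obtain ⟨τ, hτ, hmin⟩ := exists_min_image (univ.filter fun τ => τ ∈ weylParabolic n r)
    (fun τ => length (v * τ)) ⟨1, by simpa using hone⟩
  simp only [mem_filter, mem_univ, true_and] at hτ hmin
  have hσ : v * τ ∈ minReps n r := by
    intro τ' hτ'
    rw [mul_assoc]
    refine hmin _ fun i => ⟨fun hi => ?_, fun hi => ?_⟩
    · exact (hτ _).1 ((hτ' i).1 hi)
    · exact (hτ _).2 ((hτ' i).2 hi)
  have hge : ∀ i : Fin n, n - r ≤ (i : ℕ) → n - r ≤ (τ i : ℕ) := fun i hi =>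
    weylParabolic_ge (fun i => (hτ i).2) hi
  -- The actions of `τ` on the first and on the last block differ by a permutation `w` of the
  -- first block, since only their quotient acts on the arcs.
  have h1inj : Function.Injective fun i : Fin r =>
      (⟨τ ⟨i, by omega⟩, (hτ _).1 i.2⟩ : Fin r) := by
    intro i j hij
    simp only [Fin.mk.injEq] at hij
    have := τ.injective (Fin.ext hij)
    rw [Fin.mk.injEq] at this
    exact Fin.ext this
  have h3inj : Function.Injective fun i : Fin r =>
      (⟨τ ⟨i + (n - r), by omega⟩ - (n - r), by have := i.2; omega⟩ : Fin r) := by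
    intro i j hij
    simp only [Fin.mk.injEq] at hij
    have a1 := hge ⟨i + (n - r), by omega⟩ (Nat.le_add_left _ _)
    have a2 := hge ⟨j + (n - r), by omega⟩ (Nat.le_add_left _ _)
    have := τ.injective (Fin.ext (show (τ ⟨i + (n - r), by omega⟩ : ℕ) =
      τ ⟨j + (n - r), by omega⟩ by omega))
    rw [Fin.mk.injEq] at this
    exact Fin.ext (by omega)
  let u1 : Equiv.Perm (Fin r) := Equiv.ofBijective _ (Finite.injective_iff_bijective.1 h1inj)
  let u3 : Equiv.Perm (Fin r) := Equiv.ofBijective _ (Finite.injective_iff_bijective.1 h3inj)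
  have hu1 : ∀ i, (u1 i : ℕ) = τ ⟨i, by omega⟩ := fun i => rfl
  have hu3 : ∀ i, (u3 i : ℕ) = τ ⟨i + (n - r), by omega⟩ - (n - r) := fun i => rfl
  refine ⟨v * τ, hσ, u1⁻¹ * u3, ?_⟩
  rw [mul_assoc, movePattern_mul]
  congr 1
  symm
  refine (eq_of_subset_of_card_le (fun p hp => ?_) ?_).symm
  · obtain ⟨⟨b, a⟩, hba, rfl⟩ := mem_map.1 hp
    rw [mem_baseArcs] at hba ⊢
    dsimp only at hba
    have hb : (b : ℕ) < r := by omega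
    have e1 : ((τ * extend h (u1⁻¹ * u3)) b : ℕ) = u3 ⟨b, hb⟩ := by
      rw [Equiv.Perm.mul_apply]
      have : extend h (u1⁻¹ * u3) b = ⟨((u1⁻¹ * u3) ⟨b, hb⟩ : ℕ), by omega⟩ :=
        Fin.ext (extend_apply_lt h _ hb)
      rw [this, ← hu1]
      congr 1
      exact u1.apply_symm_apply _
    have e2 : (τ * extend h (u1⁻¹ * u3)) a = τ ⟨b + (n - r), by omega⟩ := by
      rw [Equiv.Perm.mul_apply, extend_apply_ge h _ (by omega)]
      congr 1
      exact Fin.ext hba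
    have e3 := hge ⟨b + (n - r), by omega⟩ (Nat.le_add_left _ _)
    change (((τ * extend h (u1⁻¹ * u3)) a : Fin n) : ℕ) =
      ((τ * extend h (u1⁻¹ * u3)) b : Fin n) + (n - r)
    rw [e1, e2, hu3]
    dsimp only
    omega
  · rw [card_movePattern]

/-- Below the base pattern every arc from `a` to `b` satisfies `b + (n - r) ≤ a`. -/
theorem PatternLE.base_arc {T : Finset (Fin n × Fin n)} (hT : PatternLE T (baseArcs n r))
    {e : Fin n × Fin n} (he : e ∈ T) : (e.1 : ℕ) + (n - r) ≤ e.2 := by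
  by_contra hc
  have h1 := hT (e.2 + 1) e.1 (by omega) (by omega)
  have h2 : arcCount (baseArcs n r) (e.2 + 1) e.1 = 0 := by
    rw [arcCount, card_eq_zero, filter_eq_empty_iff]
    intro f hf
    rw [mem_baseArcs] at hf
    omega
  have h3 : 0 < arcCount T (e.2 + 1) e.1 :=
    card_pos.2 ⟨e, mem_filter.2 ⟨he, le_rfl, Nat.lt_succ_self _⟩⟩
  omega

/-- The base pattern is minimal among the link patterns with `r` arcs. -/
theorem PatternLE.eq_base {T : Finset (Fin n × Fin n)} (hT : PatternLE T (baseArcs n r))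
    (hp : IsLinkPattern T) (hc : T.card = r) (h : 2 * r ≤ n) : T = baseArcs n r := by
  -- The heads are all of the first `r` points, so comparing `∑ a` with `∑ (b + (n - r))` over
  -- all arcs forces equality throughout.
  have hheads : T.image (fun e => (e.1 : ℕ)) = range r := by
    refine eq_of_subset_of_card_le (fun m hm => ?_) ?_
    · obtain ⟨e, he, rfl⟩ := mem_image.1 hm
      have := hT.base_arc he
      rw [mem_range]
      omega
    · rw [card_range, card_image_of_injOn, hc]
      exact fun e he f hf hef => hp.head_inj e he f hf (Fin.ext hef)
  have htails : T.image (fun e => (e.2 : ℕ) - (n - r)) = range r := by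
    refine eq_of_subset_of_card_le (fun m hm => ?_) ?_
    · obtain ⟨e, he, rfl⟩ := mem_image.1 hm
      have := hT.base_arc he
      rw [mem_range]
      omega
    · rw [card_range, card_image_of_injOn, hc]
      intro e he f hf hef
      have := hT.base_arc he
      have := hT.base_arc hf
      change (e.2 : ℕ) - (n - r) = f.2 - (n - r) at hef
      exact hp.tail_inj e he f hf (Fin.ext (by omega))
  have s1 : ∑ e ∈ T, (e.1 : ℕ) = ∑ m ∈ range r, m := by
    rw [← hheads, sum_image]
    exact fun e he f hf hef => hp.head_inj e he f hf (Fin.ext hef)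
  have s2 : ∑ e ∈ T, ((e.2 : ℕ) - (n - r)) = ∑ m ∈ range r, m := by
    rw [← htails, sum_image]
    intro e he f hf hef
    have := hT.base_arc he
    have := hT.base_arc hf
    change (e.2 : ℕ) - (n - r) = f.2 - (n - r) at hef
    exact hp.tail_inj e he f hf (Fin.ext (by omega))
  have s3 := (sum_eq_sum_iff_of_le (s := T) (f := fun e => (e.1 : ℕ))
    (g := fun e => (e.2 : ℕ) - (n - r)) (fun e he => by
      have := hT.base_arc he
      omega)).1 (s1.trans s2.symm)
  refine eq_of_subset_of_card_le (fun e he => ?_) (by rw [card_baseArcs (by omega), hc])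
  have h1 := s3 e he
  have := hT.base_arc he
  rw [mem_baseArcs]
  omega

end Perms

/-! ### Zariski closures -/

section Closure

variable {k : Type*} [Field k] {n : ℕ}

theorem mem_zariskiClosure {S : Set (Matrix (Fin n) (Fin n) k)} {x : Matrix (Fin n) (Fin n) k} :
    x ∈ zariskiClosure S ↔ ∀ p : MvPolynomial (Fin n × Fin n) k,
      (∀ y ∈ S, MvPolynomial.aeval (coords y) p = 0) → MvPolynomial.aeval (coords x) p = 0 := by
  simp only [zariskiClosure, idealOf, Set.mem_ofPred_eq, MvPolynomial.mem_zeroLocus_iff,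
    MvPolynomial.mem_vanishingIdeal_iff, Set.forall_mem_image]

theorem subset_zariskiClosure (S : Set (Matrix (Fin n) (Fin n) k)) : S ⊆ zariskiClosure S :=
  fun x hx => mem_zariskiClosure.2 fun _ hp => hp x hx

/-- Linear maps `y ↦ g y h` are continuous for the Zariski topology. -/
theorem mul_mul_mem_zariskiClosure {S T : Set (Matrix (Fin n) (Fin n) k)}
    {g h : Matrix (Fin n) (Fin n) k} (H : ∀ y ∈ S, g * y * h ∈ zariskiClosure T)
    {x : Matrix (Fin n) (Fin n) k} (hx : x ∈ zariskiClosure S) : g * x * h ∈ zariskiClosure T := by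
  rw [mem_zariskiClosure] at hx ⊢
  intro p hp
  let φ : Fin n × Fin n → MvPolynomial (Fin n × Fin n) k := fun e =>
    ∑ b, (∑ a, MvPolynomial.C (g e.1 a) * MvPolynomial.X (a, b)) * MvPolynomial.C (h b e.2)
  have key : ∀ y : Matrix (Fin n) (Fin n) k, MvPolynomial.aeval (coords (g * y * h)) p =
      MvPolynomial.aeval (coords y) (MvPolynomial.bind₁ φ p) := by
    intro y
    rw [MvPolynomial.aeval_bind₁]
    congr 2
    funext e
    simp [φ, coords, Matrix.mul_apply]
  rw [key]
  refine hx _ fun y hy => ?_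
  rw [← key]
  exact mem_zariskiClosure.1 (H y hy) p hp

theorem zariskiClosure_subset {S T : Set (Matrix (Fin n) (Fin n) k)}
    (H : S ⊆ zariskiClosure T) : zariskiClosure S ⊆ zariskiClosure T := by
  intro x hx
  have := mul_mul_mem_zariskiClosure (g := 1) (h := 1) (S := S) (T := T)
    (fun y hy => by simpa using H hy) hx
  simpa using this

/-- A curve lying in `S` away from the parameter `0` has its value at `0` in the closure. -/
theorem eval_zero_mem_zariskiClosure [Infinite k] {S : Set (Matrix (Fin n) (Fin n) k)}
    (M : Matrix (Fin n) (Fin n) (Polynomial k))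
    (H : ∀ t : k, t ≠ 0 → M.map (Polynomial.eval t) ∈ S) :
    M.map (Polynomial.eval 0) ∈ zariskiClosure S := by
  rw [mem_zariskiClosure]
  intro p hp
  set q : Polynomial k := MvPolynomial.aeval (fun e : Fin n × Fin n => M e.1 e.2) p with hq
  have key : ∀ t : k, MvPolynomial.aeval (coords (M.map (Polynomial.eval t))) p =
      Polynomial.eval t q := by
    intro t
    have : Polynomial.eval t q = (Polynomial.aeval t) q := by
      rw [Polynomial.coe_aeval_eq_eval]
    rw [this, hq, ← AlgHom.comp_apply, MvPolynomial.comp_aeval]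
    congr 2
  have h0 : q * Polynomial.X = 0 := by
    refine Polynomial.funext fun t => ?_
    rw [Polynomial.eval_mul, Polynomial.eval_X, Polynomial.eval_zero]
    by_cases ht : t = 0
    · rw [ht, mul_zero]
    · rw [← key, hp _ (H t ht), zero_mul]
  have h1 : q = 0 := by simpa using h0
  rw [key, h1, Polynomial.eval_zero]

/-- Minors are polynomial functions, so they vanish on the closure if they do on the set. -/
theorem submatrix_det_eq_zero {S : Set (Matrix (Fin n) (Fin n) k)} {m : ℕ}
    {β α : Fin m → Fin n} (H : ∀ y ∈ S, (y.submatrix β α).det = 0)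
    {x : Matrix (Fin n) (Fin n) k} (hx : x ∈ zariskiClosure S) : (x.submatrix β α).det = 0 := by
  let X : Matrix (Fin m) (Fin m) (MvPolynomial (Fin n × Fin n) k) :=
    Matrix.of fun i j => MvPolynomial.X (β i, α j)
  have key : ∀ y : Matrix (Fin n) (Fin n) k,
      MvPolynomial.aeval (coords y) X.det = (y.submatrix β α).det := by
    intro y
    rw [AlgHom.map_det]
    congr 1
    ext i j
    simp [X, coords]
  rw [← key]
  exact mem_zariskiClosure.1 hx _ fun y hy => by rw [key, H y hy]

end Closure

/-! ### Orbits under the Borel subgroup -/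

section BorelOrbits

open Matrix

variable {k : Type*} [Field k] {n : ℕ}

theorem blockTriangular_of_mul_eq_one {b c : Matrix (Fin n) (Fin n) k}
    (hb : b.BlockTriangular id) (hbc : b * c = 1) : c.BlockTriangular id := by
  have : Invertible b := invertibleOfRightInverse b c hbc
  rw [← inv_eq_right_inv hbc]
  exact blockTriangular_inv_of_blockTriangular hb

/-- Over an algebraically closed field, conjugation by invertible upper triangular matrices has
the same orbits as conjugation by those of determinant one. -/
theorem mem_borelOrbit [IsAlgClosed k] {x y : Matrix (Fin n) (Fin n) k} :
    y ∈ borelOrbit x ↔ ∃ b c : Matrix (Fin n) (Fin n) k,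
      b.BlockTriangular id ∧ b * c = 1 ∧ y = b * x * c := by
  constructor
  · rintro ⟨b, hb, rfl⟩
    refine ⟨b, (b⁻¹ : Matrix.SpecialLinearGroup (Fin n) k), hb, ?_, rfl⟩
    exact (Matrix.SpecialLinearGroup.coe_mul b b⁻¹).symm.trans
      (by rw [mul_inv_cancel, Matrix.SpecialLinearGroup.coe_one])
  · rintro ⟨b, c, hb, hbc, rfl⟩
    rcases Nat.eq_zero_or_pos n with rfl | hn
    · exact ⟨1, one_mem _, Subsingleton.elim _ _⟩
    · have hdet : b.det ≠ 0 := by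
        intro h
        have := congrArg det hbc
        rw [det_mul, h, zero_mul, det_one] at this
        exact zero_ne_one this
      obtain ⟨t, ht⟩ := IsAlgClosed.exists_pow_nat_eq (b.det)⁻¹ hn
      have ht0 : t ≠ 0 := by
        rintro rfl
        rw [zero_pow hn.ne'] at ht
        exact hdet (inv_eq_zero.1 ht.symm)
      let B : Matrix.SpecialLinearGroup (Fin n) k := ⟨t • b, by
        rw [det_smul, Fintype.card_fin, ht, inv_mul_cancel₀ hdet]⟩
      have hB : (B : Matrix (Fin n) (Fin n) k) * (t⁻¹ • c) = 1 := by
        change (t • b) * (t⁻¹ • c) = 1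
        rw [smul_mul_smul_comm, mul_inv_cancel₀ ht0, one_smul, hbc]
      have hinv : ((B⁻¹ : Matrix.SpecialLinearGroup (Fin n) k) : Matrix (Fin n) (Fin n) k) =
          t⁻¹ • c := by
        have h2 : ((B⁻¹ : Matrix.SpecialLinearGroup (Fin n) k) : Matrix (Fin n) (Fin n) k) * B =
            1 :=
          (Matrix.SpecialLinearGroup.coe_mul B⁻¹ B).symm.trans
            (by rw [inv_mul_cancel, Matrix.SpecialLinearGroup.coe_one])
        exact left_inv_eq_right_inv h2 hB
      refine ⟨B, fun i j hij => ?_, ?_⟩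
      · change t * b i j = 0
        rw [hb hij, mul_zero]
      · rw [hinv]
        change b * x * c = (t • b) * x * (t⁻¹ • c)
        rw [smul_mul_assoc, smul_mul_smul_comm, mul_inv_cancel₀ ht0, one_smul]

theorem self_mem_borelOrbit (x : Matrix (Fin n) (Fin n) k) : x ∈ borelOrbit x :=
  ⟨1, one_mem _, by simp⟩

variable [IsAlgClosed k]

theorem mul_mul_mem_borelOrbit {x y b c : Matrix (Fin n) (Fin n) k}
    (hb : b.BlockTriangular id) (hbc : b * c = 1) (hy : y ∈ borelOrbit x) :
    b * y * c ∈ borelOrbit x := by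
  obtain ⟨b', c', hb', hbc', rfl⟩ := mem_borelOrbit.1 hy
  refine mem_borelOrbit.2 ⟨b * b', c' * c, hb.mul hb', ?_, by simp only [mul_assoc]⟩
  rw [mul_assoc, ← mul_assoc b', hbc', one_mul, hbc]

theorem mem_borelOrbit_symm {x y : Matrix (Fin n) (Fin n) k} (hy : y ∈ borelOrbit x) :
    x ∈ borelOrbit y := by
  obtain ⟨b, c, hb, hbc, rfl⟩ := mem_borelOrbit.1 hy
  have hcb : c * b = 1 := mul_eq_one_comm.1 hbc
  refine mem_borelOrbit.2 ⟨c, b, blockTriangular_of_mul_eq_one hb hbc, hcb, ?_⟩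
  rw [← mul_assoc, ← mul_assoc, hcb, one_mul, mul_assoc, hcb, mul_one]

theorem borelOrbit_subset_iff {x : Matrix (Fin n) (Fin n) k} {S : Set (Matrix (Fin n) (Fin n) k)}
    (hS : ∀ b c y : Matrix (Fin n) (Fin n) k, b.BlockTriangular id → b * c = 1 → y ∈ S →
      b * y * c ∈ S) : borelOrbit x ⊆ S ↔ x ∈ S := by
  refine ⟨fun h => h (self_mem_borelOrbit x), fun h y hy => ?_⟩
  obtain ⟨b, c, hb, hbc, rfl⟩ := mem_borelOrbit.1 hy
  exact hS b c x hb hbc h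

theorem mul_mul_mem_closure_borelOrbit {x : Matrix (Fin n) (Fin n) k}
    (b c y : Matrix (Fin n) (Fin n) k) (hb : b.BlockTriangular id) (hbc : b * c = 1)
    (hy : y ∈ zariskiClosure (borelOrbit x)) : b * y * c ∈ zariskiClosure (borelOrbit x) :=
  mul_mul_mem_zariskiClosure (fun _ hz => subset_zariskiClosure _
    (mul_mul_mem_borelOrbit hb hbc hz)) hy

end BorelOrbits

/-! ### Rank functions -/

section Ranks

open Matrix Module

variable {k : Type*} [Field k] {n : ℕ}

theorem mem_coordSpan {i : ℕ} {v : Fin n → k} :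
    v ∈ coordSpan k n i ↔ ∀ l : Fin n, i ≤ (l : ℕ) → v l = 0 := by
  constructor
  · intro hv l hl
    rw [coordSpan] at hv
    induction hv using Submodule.span_induction with
    | mem x hx =>
      obtain ⟨j, hj, rfl⟩ := hx
      have hj' : (j : ℕ) < i := hj
      exact Pi.single_eq_of_ne (fun h => by rw [h] at hl; omega) _
    | zero => rfl
    | add x y _ _ hx hy => rw [Pi.add_apply, hx, hy, add_zero]
    | smul a x _ hx => rw [Pi.smul_apply, hx, smul_zero]
  · intro hv
    have : v = ∑ l, v l • (Pi.single l 1 : Fin n → k) := by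
      ext m
      simp [Finset.sum_apply, Pi.single_apply]
    rw [this]
    refine Submodule.sum_mem _ fun l _ => ?_
    by_cases hl : (l : ℕ) < i
    · exact Submodule.smul_mem _ _ (Submodule.subset_span ⟨l, hl, rfl⟩)
    · rw [hv l (not_lt.1 hl), zero_smul]
      exact Submodule.zero_mem _

theorem map_coordSpan_le {b : Matrix (Fin n) (Fin n) k} (hb : b.BlockTriangular id) (i : ℕ) :
    (coordSpan k n i).map (toLin' b) ≤ coordSpan k n i := by
  rintro _ ⟨v, hv, rfl⟩
  have hv' := mem_coordSpan.1 hv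
  refine mem_coordSpan.2 fun l hl => ?_
  rw [toLin'_apply]
  change ∑ m, b l m * v m = 0
  refine Finset.sum_eq_zero fun m _ => ?_
  by_cases hm : (m : ℕ) < i
  · rw [hb (show (m : Fin n) < l from Fin.lt_def.2 (by omega)), zero_mul]
  · rw [hv' m (not_lt.1 hm), mul_zero]

theorem map_coordSpan {b c : Matrix (Fin n) (Fin n) k} (hb : b.BlockTriangular id)
    (hbc : b * c = 1) (i : ℕ) : (coordSpan k n i).map (toLin' b) = coordSpan k n i := by
  refine le_antisymm (map_coordSpan_le hb i) fun v hv => ?_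
  refine ⟨toLin' c v, map_coordSpan_le (blockTriangular_of_mul_eq_one hb hbc) i ⟨v, hv, rfl⟩, ?_⟩
  rw [← LinearMap.comp_apply, ← toLin'_mul, hbc, toLin'_one, LinearMap.id_apply]

theorem rankFn_conj {b c : Matrix (Fin n) (Fin n) k} (hb : b.BlockTriangular id)
    (hbc : b * c = 1) (i j : ℕ) (x : Matrix (Fin n) (Fin n) k) :
    rankFn i j (b * x * c) = rankFn i j x := by
  have hcb : c * b = 1 := mul_eq_one_comm.1 hbc
  have hc := blockTriangular_of_mul_eq_one hb hbc
  have hinj : Function.Injective (toLin' b) := by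
    refine Function.LeftInverse.injective (g := toLin' c) fun v => ?_
    rw [← LinearMap.comp_apply, ← toLin'_mul, hcb, toLin'_one, LinearMap.id_apply]
  have : (coordSpan k n i).map (toLin' (b * x * c)) ⊔ coordSpan k n j =
      ((coordSpan k n i).map (toLin' x) ⊔ coordSpan k n j).map (toLin' b) := by
    rw [Submodule.map_sup, map_coordSpan hb hbc, toLin'_mul, toLin'_mul, Submodule.map_comp,
      map_coordSpan hc hcb, Submodule.map_comp]
  rw [rankFn, rankFn, this]
  exact (LinearEquiv.finrank_eq (Submodule.equivMapOfInjective _ hinj _)).symm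

theorem rankFn_eq_of_mem_borelOrbit [IsAlgClosed k] {x y : Matrix (Fin n) (Fin n) k}
    (h : y ∈ borelOrbit x) (i j : ℕ) : rankFn i j y = rankFn i j x := by
  obtain ⟨b, c, hb, hbc, rfl⟩ := mem_borelOrbit.1 h
  exact rankFn_conj hb hbc i j x

theorem rankFn_eq_rank (x : Matrix (Fin n) (Fin n) k) : rankFn n 0 x = x.rank := by
  have h1 : coordSpan k n n = ⊤ :=
    eq_top_iff.2 fun v _ => mem_coordSpan.2 fun l hl => absurd l.2 (not_lt.2 hl)
  have h2 : coordSpan k n 0 = ⊥ :=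
    eq_bot_iff.2 fun v hv => by
      rw [Submodule.mem_bot]
      ext l
      exact mem_coordSpan.1 hv l (Nat.zero_le _)
  rw [rankFn, h1, h2, sup_bot_eq, Submodule.map_top, Matrix.rank, toLin'_apply']

theorem finrank_span_single (A : Finset (Fin n)) :
    finrank k (Submodule.span k ((fun j : Fin n => (Pi.single j 1 : Fin n → k)) '' A)) =
      A.card := by
  have hli : LinearIndependent k fun j : A => (Pi.single (j : Fin n) 1 : Fin n → k) := by
    have := (Pi.basisFun k (Fin n)).linearIndependent.comp (Subtype.val : A → Fin n)
      Subtype.val_injective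
    convert this using 2
    simp
  have h := finrank_span_eq_card hli
  rw [Fintype.card_coe] at h
  have hset : (fun j : Fin n => (Pi.single j 1 : Fin n → k)) '' A =
      Set.range fun j : A => (Pi.single (j : Fin n) 1 : Fin n → k) := by
    rw [Set.image_eq_range]
    rfl
  rw [← h, hset]

theorem finrank_coordSpan {j : ℕ} (hj : j ≤ n) : finrank k (coordSpan k n j) = j := by
  have h := finrank_span_single (k := k) (Finset.univ.filter fun l : Fin n => (l : ℕ) < j)
  rw [show (Finset.univ.filter fun l : Fin n => (l : ℕ) < j).card = j by
    rw [Fin.card_filter_val_lt, min_eq_right hj]] at h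
  have hs : ((Finset.univ.filter fun l : Fin n => (l : ℕ) < j : Finset (Fin n)) : Set (Fin n)) =
      {l : Fin n | (l : ℕ) < j} := by
    ext l
    simp
  rw [hs] at h
  exact h

/-- A non-vanishing minor in the rows from `j` on and the first `i` columns bounds the rank
function from below. -/
theorem le_rankFn_of_submatrix {x : Matrix (Fin n) (Fin n) k} {i j m : ℕ} (hj : j ≤ n)
    {β α : Fin m → Fin n} (hβ : ∀ c, j ≤ (β c : ℕ)) (hα : ∀ c, (α c : ℕ) < i)
    (hdet : (x.submatrix β α).det ≠ 0) : j + m ≤ rankFn i j x := by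
  set W := (coordSpan k n i).map (toLin' x) ⊔ coordSpan k n j with hW
  let F : (Fin n → k) →ₗ[k] (Fin m → k) := LinearMap.funLeft k k β
  let f : W →ₗ[k] (Fin m → k) := F.comp W.subtype
  -- The coordinates indexed by `β` kill the first `j` basis vectors.
  have hker : (coordSpan k n j).comap W.subtype ≤ LinearMap.ker f := by
    intro v hv
    rw [LinearMap.mem_ker]
    ext c
    exact mem_coordSpan.1 hv _ (hβ c)
  have hker' : j ≤ finrank k (LinearMap.ker f) := by
    have h1 := Submodule.finrank_mono hker
    rw [(Submodule.comapSubtypeEquivOfLe (le_sup_right : coordSpan k n j ≤ W)).finrank_eq,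
      finrank_coordSpan hj] at h1
    exact h1
  have hsurj : LinearMap.range f = ⊤ := by
    rw [eq_top_iff]
    intro u _
    have hu : IsUnit (x.submatrix β α).det := isUnit_iff_ne_zero.2 hdet
    set z := (x.submatrix β α)⁻¹ *ᵥ u with hz
    have hzu : (x.submatrix β α) *ᵥ z = u := by
      rw [hz, mulVec_mulVec, mul_nonsing_inv _ hu, one_mulVec]
    set v : Fin n → k := ∑ c, z c • (Pi.single (α c) 1 : Fin n → k) with hv
    have hvi : v ∈ coordSpan k n i := Submodule.sum_mem _ fun c _ =>
      Submodule.smul_mem _ _ (Submodule.subset_span ⟨α c, hα c, rfl⟩)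
    refine ⟨⟨toLin' x v, Submodule.mem_sup_left ⟨v, hvi, rfl⟩⟩, ?_⟩
    ext c
    rw [← hzu]
    change toLin' x v (β c) = _
    rw [hv, map_sum, Finset.sum_apply]
    simp [mulVec, dotProduct, mul_comm]
  have := LinearMap.finrank_range_add_finrank_ker f
  rw [hsurj, finrank_top, finrank_fin_fun] at this
  rw [rankFn, ← hW]
  omega

variable (k) in
/-- The matrix of a set of arcs: it sends the basis vector of each tail to that of the head, and
all other basis vectors to zero. -/
def arcMat (T : Finset (Fin n × Fin n)) : Matrix (Fin n) (Fin n) k :=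
  Matrix.of fun i j => if (i, j) ∈ T then 1 else 0

theorem arcMat_apply (T : Finset (Fin n × Fin n)) (i j : Fin n) :
    arcMat k T i j = if (i, j) ∈ T then 1 else 0 := rfl

theorem weylAct_arcMat (s : Equiv.Perm (Fin n)) (T : Finset (Fin n × Fin n)) :
    weylAct s (arcMat k T) = arcMat k (movePattern s T) := by
  ext i j
  simp only [arcMat_apply, mem_movePattern]
  rfl

theorem baseMat_eq (r : ℕ) : baseMat k n r = arcMat k (baseArcs n r) := by
  ext i j
  simp only [arcMat_apply, mem_baseArcs]
  rfl

theorem arcMat_injective {T T' : Finset (Fin n × Fin n)} (h : arcMat k T = arcMat k T') :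
    T = T' := by
  ext ⟨i, j⟩
  have := congrFun (congrFun h i) j
  rw [arcMat_apply, arcMat_apply] at this
  by_cases h1 : (i, j) ∈ T <;> by_cases h2 : (i, j) ∈ T' <;> simp_all

theorem orbitRep_eq {r : ℕ} (h : 2 * r ≤ n) (σ : Equiv.Perm (Fin n)) (w : Equiv.Perm (Fin r)) :
    orbitRep k h σ w = arcMat k (movePattern (σ * extend h w) (baseArcs n r)) := by
  rw [orbitRep, baseMat_eq, weylAct_arcMat]

/-- The minor cut out by the arcs counted by `arcCount T i j`. -/
theorem IsLinkPattern.exists_submatrix {T : Finset (Fin n × Fin n)} (hT : IsLinkPattern T)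
    (i j : ℕ) : ∃ β α : Fin (arcCount T i j) → Fin n, (∀ c, j ≤ (β c : ℕ)) ∧
      (∀ c, (α c : ℕ) < i) ∧ ((arcMat k T).submatrix β α) = 1 := by
  let e := ((T.filter fun e => j ≤ (e.1 : ℕ) ∧ (e.2 : ℕ) < i).equivFin).symm
  have he : ∀ c, (e c).1 ∈ T ∧ j ≤ ((e c).1.1 : ℕ) ∧ ((e c).1.2 : ℕ) < i := fun c =>
    Finset.mem_filter.1 (e c).2
  refine ⟨fun c => (e c).1.1, fun c => (e c).1.2, fun c => (he c).2.1, fun c => (he c).2.2, ?_⟩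
  ext c d
  rw [submatrix_apply, arcMat_apply, one_apply]
  by_cases hcd : c = d
  · subst hcd
    rw [if_pos rfl, if_pos (he c).1]
  · rw [if_neg hcd, if_neg]
    intro hmem
    have h1 := hT.head_inj _ hmem _ (he c).1 rfl
    have h2 := hT.tail_inj _ hmem _ (he d).1 rfl
    exact hcd (e.injective (Subtype.ext (h1.symm.trans h2)))

theorem rankFn_arcMat {T : Finset (Fin n × Fin n)} (hT : IsLinkPattern T) (i : ℕ) {j : ℕ}
    (hj : j ≤ n) : rankFn i j (arcMat k T) = j + arcCount T i j := by
  classical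
  refine le_antisymm ?_ ?_
  · set A := (Finset.univ.filter fun l : Fin n => (l : ℕ) < j) ∪
      (T.filter fun e => j ≤ (e.1 : ℕ) ∧ (e.2 : ℕ) < i).image Prod.fst with hA
    have hcard : A.card ≤ j + arcCount T i j := by
      refine (Finset.card_union_le _ _).trans ?_
      rw [Fin.card_filter_val_lt, min_eq_right hj]
      exact Nat.add_le_add_left Finset.card_image_le _
    refine le_trans ?_ hcard
    rw [← finrank_span_single (k := k) A, rankFn]
    refine Submodule.finrank_mono (sup_le ?_ ?_)
    · rw [coordSpan, Submodule.map_span_le]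
      rintro _ ⟨a, ha, rfl⟩
      have ha' : (a : ℕ) < i := ha
      rw [toLin'_apply, mulVec_single_one]
      by_cases hex : ∃ b, (b, a) ∈ T
      · obtain ⟨b, hb⟩ := hex
        have : (arcMat k T).col a = Pi.single b 1 := by
          ext c
          rw [col_apply, arcMat_apply, Pi.single_apply]
          refine if_congr ⟨fun hc => ?_, fun hc => hc ▸ hb⟩ rfl rfl
          exact congrArg Prod.fst (hT.tail_inj _ hc _ hb rfl)
        rw [this]
        refine Submodule.subset_span ⟨b, ?_, rfl⟩
        rw [Finset.mem_coe, hA, Finset.mem_union, Finset.mem_filter, Finset.mem_image]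
        by_cases hbj : (b : ℕ) < j
        · exact Or.inl ⟨Finset.mem_univ _, hbj⟩
        · exact Or.inr ⟨(b, a), Finset.mem_filter.2 ⟨hb, not_lt.1 hbj, ha'⟩, rfl⟩
      · have : (arcMat k T).col a = 0 := by
          ext c
          rw [col_apply, arcMat_apply, if_neg fun hc => hex ⟨c, hc⟩]
          rfl
        rw [this]
        exact Submodule.zero_mem _
    · rw [coordSpan]
      refine Submodule.span_mono (Set.image_mono fun l hl => ?_)
      rw [Finset.mem_coe, hA, Finset.mem_union, Finset.mem_filter]
      exact Or.inl ⟨Finset.mem_univ _, hl⟩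
  · obtain ⟨β, α, hβ, hα, h1⟩ := hT.exists_submatrix (k := k) i j
    exact le_rankFn_of_submatrix hj hβ hα (by rw [h1, det_one]; exact one_ne_zero)

/-- Semicontinuity of the rank functions, at the points given by link patterns. -/
theorem arcCount_le_of_mem_closure {S : Set (Matrix (Fin n) (Fin n) k)}
    {T : Finset (Fin n × Fin n)} (hT : IsLinkPattern T) (h : arcMat k T ∈ zariskiClosure S)
    {i j m : ℕ} (hj : j ≤ n) (hS : ∀ y ∈ S, rankFn i j y ≤ j + m) : arcCount T i j ≤ m := by
  obtain ⟨β, α, hβ, hα, h1⟩ := hT.exists_submatrix (k := k) i j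
  by_contra hc
  have h2 := submatrix_det_eq_zero (β := β) (α := α) (fun y hy => by
    by_contra hdet
    have h3 := le_rankFn_of_submatrix hj hβ hα hdet
    have h4 := hS y hy
    omega) h
  rw [h1, det_one] at h2
  exact one_ne_zero h2

theorem patternLE_of_mem_closure [IsAlgClosed k] {T T' : Finset (Fin n × Fin n)}
    (hT : IsLinkPattern T) (hT' : IsLinkPattern T')
    (h : arcMat k T' ∈ zariskiClosure (borelOrbit (arcMat k T))) : PatternLE T' T :=
  fun i _ _ hj => arcCount_le_of_mem_closure hT' h hj fun y hy => by
    rw [rankFn_eq_of_mem_borelOrbit hy, rankFn_arcMat hT i hj]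

/-- Distinct link patterns give distinct orbits. -/
theorem eq_of_mem_borelOrbit [IsAlgClosed k] {T T' : Finset (Fin n × Fin n)}
    (hT : IsLinkPattern T) (hT' : IsLinkPattern T') {y : Matrix (Fin n) (Fin n) k}
    (h : y ∈ borelOrbit (arcMat k T)) (h' : y ∈ borelOrbit (arcMat k T')) : T = T' :=
  eq_of_arcCount_eq fun i j _ hj => by
    have := (rankFn_eq_of_mem_borelOrbit h i j).symm.trans (rankFn_eq_of_mem_borelOrbit h' i j)
    rw [rankFn_arcMat hT i hj, rankFn_arcMat hT' i hj] at this
    omega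

theorem rank_arcMat {T : Finset (Fin n × Fin n)} (hT : IsLinkPattern T) :
    (arcMat k T).rank = T.card := by
  rw [← rankFn_eq_rank, rankFn_arcMat hT n (Nat.zero_le _), zero_add, arcCount,
    Finset.filter_true_of_mem]
  exact fun e _ => ⟨Nat.zero_le _, e.2.2⟩

theorem arcMat_mul_self {T : Finset (Fin n × Fin n)} (hT : IsLinkPattern T) :
    arcMat k T * arcMat k T = 0 := by
  ext i j
  rw [mul_apply]
  refine Finset.sum_eq_zero fun l _ => ?_
  rw [arcMat_apply, arcMat_apply]
  by_cases h1 : (i, l) ∈ T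
  · rw [if_pos h1, if_neg fun h2 => hT.head_ne_tail _ h2 _ h1 rfl, mul_zero]
  · rw [if_neg h1, zero_mul]

theorem arcMat_trace {T : Finset (Fin n × Fin n)} (hT : IsLinkPattern T) :
    (arcMat k T).trace = 0 :=
  Finset.sum_eq_zero fun i _ => by
    rw [diag_apply, arcMat_apply, if_neg]
    exact fun h => hT.head_ne_tail _ h _ h rfl

end Ranks

/-! ### The normal form of square-zero matrices -/

section NormalForm

open Matrix

variable {k : Type*} [Field k] {n : ℕ}

/-- A family of vectors adapted to the coordinate flag: the last non-zero coordinate of the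
`a`-th vector is the `a`-th one. -/
def Adapted (f : Fin n → Fin n → k) : Prop :=
  ∀ a, f a a ≠ 0 ∧ ∀ b, a < b → f a b = 0

theorem Adapted.det_ne_zero {f : Fin n → Fin n → k} (hf : Adapted f) :
    (Matrix.of f)ᵀ.det ≠ 0 := by
  have hu : (Matrix.of f)ᵀ.BlockTriangular id := fun i j hij => (hf j).2 i hij
  rw [det_of_isUpperTriangular hu]
  exact Finset.prod_ne_zero_iff.2 fun a _ => (hf a).1

theorem Adapted.linearIndependent {f : Fin n → Fin n → k} (hf : Adapted f) :
    LinearIndependent k f := by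
  have h := hf.det_ne_zero
  rw [det_transpose] at h
  exact linearIndependent_rows_of_isUnit
    ((isUnit_iff_isUnit_det _).2 (isUnit_iff_ne_zero.2 h))

/-- One step of the elimination, with `i` the first remaining index whose basis vector is not
killed by `x`. The vector `x f_i` replaces the basis vector `f_j` of the same leading index, and
multiples of `f_i` are subtracted from the other remaining vectors so that their images do not
involve the old `f_j`. Then the vectors other than `f_i` and `f_j` span an invariant subspace,
because `x ^ 2 = 0`. -/
theorem Adapted.eliminate {x : (Fin n → k) →ₗ[k] (Fin n → k)} (hx : ∀ v, x (x v) = 0)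
    {S : Finset (Fin n)} {f : Fin n → Fin n → k} (hf : Adapted f)
    (hS : ∀ a ∈ S, x (f a) ∈ Submodule.span k (f '' S)) {i : Fin n} (hi : i ∈ S)
    (hxi : x (f i) ≠ 0) (hmin : ∀ a ∈ S, a < i → x (f a) = 0) :
    ∃ j ∈ S, j ≠ i ∧ ∃ f' : Fin n → Fin n → k, Adapted f' ∧ f' i = f i ∧ f' j = x (f i) ∧
      (∀ a ∉ S, f' a = f a) ∧
      ∀ a ∈ (S.erase j).erase i,
        x (f' a) ∈ Submodule.span k (f' '' ((S.erase j).erase i : Finset (Fin n))) := by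
  classical
  have hex : ∀ a, ∃ c : Fin n → k, a ∈ S → x (f a) = ∑ b ∈ S, c b • f b := by
    intro a
    by_cases ha : a ∈ S
    · obtain ⟨c, hc⟩ := Submodule.mem_span_image_finset_iff_exists_fun k |>.1 (hS a ha)
      refine ⟨fun b => if hb : b ∈ S then c ⟨b, hb⟩ else 0, fun _ => ?_⟩
      rw [← hc, ← Finset.sum_coe_sort S]
      exact Finset.sum_congr rfl fun b _ => by simp
    · exact ⟨0, fun h => absurd h ha⟩
  choose d hd using hex
  set y := x (f i) with hy
  set c := d i with hc
  have hyc : y = ∑ b ∈ S, c b • f b := hd i hi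
  have hne : (S.filter fun b => c b ≠ 0).Nonempty := by
    by_contra hem
    rw [Finset.not_nonempty_iff_eq_empty, Finset.filter_eq_empty_iff] at hem
    refine hxi ?_
    rw [hyc]
    exact Finset.sum_eq_zero fun b hb => by
      have := hem hb
      rw [not_not] at this
      rw [this, zero_smul]
  set j := (S.filter fun b => c b ≠ 0).max' hne with hj
  obtain ⟨hjS, hcj⟩ := Finset.mem_filter.1 ((S.filter fun b => c b ≠ 0).max'_mem hne)
  rw [← hj] at hjS hcj
  have hmax : ∀ b ∈ S, j < b → c b = 0 := by
    intro b hb hlt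
    by_contra hcb
    exact absurd ((S.filter fun b => c b ≠ 0).le_max' b (Finset.mem_filter.2 ⟨hb, hcb⟩))
      (not_le.2 hlt)
  have hji : j ≠ i := by
    intro hji
    have h0 : x y = c i • y := by
      conv_lhs => rw [hyc]
      rw [map_sum, Finset.sum_eq_single i, map_smul]
      · intro b hb hbi
        rcases lt_or_gt_of_ne hbi with h | h
        · rw [map_smul, hmin b hb h, smul_zero]
        · rw [hmax b hb (hji ▸ h), zero_smul, map_zero]
      · exact fun h => absurd hi h
    rw [hy, hx] at h0
    rcases smul_eq_zero.1 h0.symm with h | h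
    · exact hcj (hji ▸ h)
    · exact hxi h
  have hyj : y j = c j * f j j := by
    rw [hyc, Finset.sum_apply, Finset.sum_eq_single j]
    · rfl
    · intro b hb hbj
      rw [Pi.smul_apply]
      rcases lt_or_gt_of_ne hbj with h | h
      · rw [(hf b).2 j h, smul_zero]
      · rw [hmax b hb h, zero_smul]
    · exact fun h => absurd hjS h
  have hyl : ∀ m, j < m → y m = 0 := by
    intro m hm
    rw [hyc, Finset.sum_apply]
    refine Finset.sum_eq_zero fun b hb => ?_
    rw [Pi.smul_apply]
    by_cases h : j < b
    · rw [hmax b hb h, zero_smul]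
    · rw [(hf b).2 m (lt_of_le_of_lt (not_lt.1 h) hm), smul_zero]
  set f' : Fin n → Fin n → k := fun a => if a = j then y else
    if a ∈ S ∧ i < a then f a - (d a j / c j) • f i else f a with hf'
  have f'j : f' j = y := by simp [hf']
  have f'i : f' i = f i := by simp [hf', hji.symm]
  have f'gt : ∀ a ∈ S, a ≠ j → i < a → f' a = f a - (d a j / c j) • f i := by
    intro a ha haj hia
    simp [hf', haj, ha, hia]
  have f'lt : ∀ a, a ≠ j → ¬ i < a → f' a = f a := by
    intro a haj hia
    simp [hf', haj, hia]
  refine ⟨j, hjS, hji, f', ?_, f'i, f'j, ?_, ?_⟩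
  · intro a
    by_cases haj : a = j
    · subst haj
      rw [f'j]
      exact ⟨by rw [hyj]; exact mul_ne_zero hcj (hf _).1, hyl⟩
    · by_cases ha : a ∈ S ∧ i < a
      · rw [f'gt a ha.1 haj ha.2]
        constructor
        · rw [Pi.sub_apply, Pi.smul_apply, (hf i).2 a ha.2, smul_zero, sub_zero]
          exact (hf a).1
        · intro b hb
          rw [Pi.sub_apply, Pi.smul_apply, (hf i).2 b (ha.2.trans hb), (hf a).2 b hb, smul_zero,
            sub_zero]
      · have : f' a = f a := by simp [hf', haj, ha]
        rw [this]
        exact hf a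
  · intro a ha
    have haj : a ≠ j := fun h => ha (h ▸ hjS)
    simp [hf', haj, ha]
  · set S' := (S.erase j).erase i with hS'
    have memS' : ∀ a, a ∈ S' ↔ a ≠ i ∧ a ≠ j ∧ a ∈ S := fun a => by
      rw [hS', Finset.mem_erase, Finset.mem_erase]
    set U := Submodule.span k (f '' (S.erase j : Finset (Fin n))) with hU
    have hfU : ∀ b ∈ S, b ≠ j → f b ∈ U := fun b hb hbj =>
      Submodule.subset_span ⟨b, Finset.mem_coe.2 (Finset.mem_erase.2 ⟨hbj, hb⟩), rfl⟩
    have h1 : ∀ a ∈ S', x (f' a) ∈ U := by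
      intro a ha
      obtain ⟨hai, haj, haS⟩ := (memS' a).1 ha
      by_cases hia : i < a
      · rw [f'gt a haS haj hia, map_sub, map_smul, hd a haS, ← hy, hyc, Finset.smul_sum,
          ← Finset.sum_sub_distrib]
        refine Submodule.sum_mem _ fun b hb => ?_
        rw [smul_smul, ← sub_smul]
        by_cases hbj : b = j
        · rw [hbj, div_mul_cancel₀ _ hcj, sub_self, zero_smul]
          exact Submodule.zero_mem _
        · exact Submodule.smul_mem _ _ (hfU b hb hbj)
      · rw [f'lt a haj hia, hmin a haS (lt_of_le_of_ne (not_lt.1 hia) hai)]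
        exact Submodule.zero_mem _
    have h2 : U ≤ Submodule.span k {f i} ⊔ Submodule.span k (f' '' S') := by
      rw [hU, Submodule.span_le]
      rintro _ ⟨b, hb, rfl⟩
      obtain ⟨hbj, hbS⟩ := Finset.mem_erase.1 (Finset.mem_coe.1 hb)
      have hfi : f i ∈ Submodule.span k {f i} := Submodule.mem_span_singleton_self _
      by_cases hbi : b = i
      · rw [hbi]
        exact Submodule.mem_sup_left hfi
      · have hfb : f' b ∈ Submodule.span k (f' '' S') :=
          Submodule.subset_span ⟨b, Finset.mem_coe.2 ((memS' b).2 ⟨hbi, hbj, hbS⟩), rfl⟩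
        by_cases hib : i < b
        · have : f b = (d b j / c j) • f i + f' b := by
            rw [f'gt b hbS hbj hib, add_sub_cancel]
          rw [this]
          exact Submodule.add_mem_sup (Submodule.smul_mem _ _ hfi) hfb
        · rw [← f'lt b hbj hib]
          exact Submodule.mem_sup_right hfb
    have h3 : y ∉ U := by
      intro hyU
      have h4 : c j • f j ∈ U := by
        have : c j • f j = y - ∑ b ∈ S.erase j, c b • f b := by
          rw [hyc, ← Finset.add_sum_erase S _ hjS, add_sub_cancel_right]
        rw [this]
        exact Submodule.sub_mem _ hyU (Submodule.sum_mem _ fun b hb =>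
          Submodule.smul_mem _ _ (hfU b (Finset.mem_of_mem_erase hb) (Finset.ne_of_mem_erase hb)))
      have h5 : f j ∈ U := by
        have := Submodule.smul_mem U (c j)⁻¹ h4
        rwa [smul_smul, inv_mul_cancel₀ hcj, one_smul] at this
      refine hf.linearIndependent.notMem_span_image ?_ h5
      simp
    intro a ha
    obtain ⟨v, hv, w, hw, hvw⟩ := Submodule.mem_sup.1 (h2 (h1 a ha))
    obtain ⟨β, rfl⟩ := Submodule.mem_span_singleton.1 hv
    have hxw : x w ∈ U := by
      have hle : Submodule.span k (f' '' S') ≤ U.comap x := by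
        rw [Submodule.span_le]
        rintro _ ⟨b, hb, rfl⟩
        exact h1 b (Finset.mem_coe.1 hb)
      exact hle hw
    have hβ : β = 0 := by
      by_contra hβ
      have h6 := congrArg x hvw
      rw [hx, map_add, map_smul, ← hy] at h6
      have h7 : β • y ∈ U := by
        rw [eq_neg_of_add_eq_zero_left h6]
        exact Submodule.neg_mem _ hxw
      have := Submodule.smul_mem U β⁻¹ h7
      rw [smul_smul, inv_mul_cancel₀ hβ, one_smul] at this
      exact h3 this
    rw [← hvw, hβ, zero_smul, zero_add]
    exact hw

/-- Iterating the elimination on the remaining set `S` of indices turns an adapted family, whose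
part indexed by `S` spans an invariant subspace, into one that `x` permutes up to zeros. -/
theorem Adapted.exists_pattern {x : (Fin n → k) →ₗ[k] (Fin n → k)} (hx : ∀ v, x (x v) = 0)
    (m : ℕ) : ∀ (S : Finset (Fin n)) (f : Fin n → Fin n → k), S.card = m → Adapted f →
      (∀ a ∈ S, x (f a) ∈ Submodule.span k (f '' S)) →
      ∃ g : Fin n → Fin n → k, Adapted g ∧ (∀ a ∉ S, g a = f a) ∧
        ∃ T : Finset (Fin n × Fin n), IsLinkPattern T ∧ (∀ e ∈ T, e.1 ∈ S ∧ e.2 ∈ S) ∧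
          ∀ a ∈ S, (∃ b, (b, a) ∈ T ∧ x (g a) = g b) ∨ (∀ b, (b, a) ∉ T) ∧ x (g a) = 0 := by
  classical
  induction m using Nat.strong_induction_on with
  | _ m ih =>
    intro S f hm hf hS
    by_cases hne : (S.filter fun a => x (f a) ≠ 0).Nonempty
    · set i := (S.filter fun a => x (f a) ≠ 0).min' hne with hi
      obtain ⟨hiS, hxi⟩ := Finset.mem_filter.1 ((S.filter fun a => x (f a) ≠ 0).min'_mem hne)
      rw [← hi] at hiS hxi
      have hmin : ∀ a ∈ S, a < i → x (f a) = 0 := by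
        intro a ha hlt
        by_contra hxa
        exact absurd ((S.filter fun a => x (f a) ≠ 0).min'_le a (Finset.mem_filter.2 ⟨ha, hxa⟩))
          (not_le.2 hlt)
      obtain ⟨j, hjS, hji, f', hf', f'i, f'j, f'S, hS'⟩ := hf.eliminate hx hS hiS hxi hmin
      set S' := (S.erase j).erase i with hSdef
      have memS' : ∀ a, a ∈ S' ↔ a ≠ i ∧ a ≠ j ∧ a ∈ S := fun a => by
        rw [hSdef, Finset.mem_erase, Finset.mem_erase]
      have hcard : S'.card < m := by
        rw [← hm]
        refine Finset.card_lt_card ⟨fun a ha => ((memS' a).1 ha).2.2, fun h => ?_⟩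
        exact ((memS' i).1 (h hiS)).1 rfl
      obtain ⟨g, hg, hgS, T, hT, hTS, hgT⟩ := ih _ hcard S' f' rfl hf' hS'
      have gi : g i = f i := by
        rw [hgS i fun h => ((memS' i).1 h).1 rfl, f'i]
      have gj : g j = x (f i) := by
        rw [hgS j fun h => ((memS' j).1 h).2.1 rfl, f'j]
      have notT : ∀ e ∈ T, e.1 ≠ i ∧ e.1 ≠ j ∧ e.2 ≠ i ∧ e.2 ≠ j := fun e he => by
        have h1 := (memS' _).1 (hTS e he).1
        have h2 := (memS' _).1 (hTS e he).2
        exact ⟨h1.1, h1.2.1, h2.1, h2.2.1⟩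
      refine ⟨g, hg, fun a ha => ?_, insert (j, i) T, ⟨?_, ?_, ?_⟩, ?_, ?_⟩
      · rw [hgS a fun h => ha ((memS' a).1 h).2.2, f'S a ha]
      · intro e he e' he' h
        rcases Finset.mem_insert.1 he with rfl | he <;>
          rcases Finset.mem_insert.1 he' with rfl | he'
        · rfl
        · exact absurd h.symm (notT _ he').2.1
        · exact absurd h (notT _ he).2.1
        · exact hT.head_inj _ he _ he' h
      · intro e he e' he' h
        rcases Finset.mem_insert.1 he with rfl | he <;>
          rcases Finset.mem_insert.1 he' with rfl | he'
        · rfl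
        · exact absurd h.symm (notT _ he').2.2.1
        · exact absurd h (notT _ he).2.2.1
        · exact hT.tail_inj _ he _ he' h
      · intro e he e' he'
        rcases Finset.mem_insert.1 he with rfl | he <;>
          rcases Finset.mem_insert.1 he' with rfl | he'
        · exact hji
        · exact (notT _ he').2.2.2.symm
        · exact (notT _ he).1
        · exact hT.head_ne_tail _ he _ he'
      · intro e he
        rcases Finset.mem_insert.1 he with rfl | he
        · exact ⟨hjS, hiS⟩
        · exact ⟨((memS' _).1 (hTS e he).1).2.2, ((memS' _).1 (hTS e he).2).2.2⟩
      · intro a ha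
        by_cases hai : a = i
        · exact Or.inl ⟨j, by rw [hai]; exact Finset.mem_insert_self _ _, by rw [hai, gi, gj]⟩
        · by_cases haj : a = j
          · refine Or.inr ⟨fun b hb => ?_, by rw [haj, gj, hx]⟩
            rcases Finset.mem_insert.1 hb with h | h
            · exact hai (congrArg Prod.snd h)
            · exact (notT _ h).2.2.2 haj
          · refine (hgT a ((memS' a).2 ⟨hai, haj, ha⟩)).imp (fun ⟨b, hb, hxb⟩ =>
              ⟨b, Finset.mem_insert_of_mem hb, hxb⟩) (fun ⟨hb, hxa⟩ => ⟨fun b hmem => ?_, hxa⟩)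
            rcases Finset.mem_insert.1 hmem with h | h
            · exact hai (congrArg Prod.snd h)
            · exact hb b h
    · rw [Finset.not_nonempty_iff_eq_empty, Finset.filter_eq_empty_iff] at hne
      refine ⟨f, hf, fun _ _ => rfl, ∅, ⟨by simp, by simp, by simp⟩, by simp, fun a ha =>
        Or.inr ⟨by simp, ?_⟩⟩
      exact not_not.1 (hne ha)

/-- Every square-zero matrix is conjugate under the Borel subgroup to that of a link pattern. -/
theorem exists_arcMat_orbit [IsAlgClosed k] {x : Matrix (Fin n) (Fin n) k} (hx : x * x = 0) :
    ∃ T : Finset (Fin n × Fin n), IsLinkPattern T ∧ x ∈ borelOrbit (arcMat k T) := by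
  have hx' : ∀ v, toLin' x (toLin' x v) = 0 := fun v => by
    rw [← LinearMap.comp_apply, ← toLin'_mul, hx, map_zero, LinearMap.zero_apply]
  have hf : Adapted fun a : Fin n => (Pi.single a 1 : Fin n → k) := fun a =>
    ⟨by simp, fun b hb => Pi.single_eq_of_ne hb.ne' _⟩
  obtain ⟨g, hg, -, T, hT, -, hgT⟩ := Adapted.exists_pattern hx' _ Finset.univ _ rfl hf
    (fun a _ => by
      have : Submodule.span k ((fun a : Fin n => (Pi.single a 1 : Fin n → k)) ''
          (Finset.univ : Finset (Fin n))) = ⊤ := by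
        rw [Finset.coe_univ, Set.image_univ]
        have := (Pi.basisFun k (Fin n)).span_eq
        convert this using 3
        funext a
        simp
      rw [this]
      trivial)
  refine ⟨T, hT, ?_⟩
  set b : Matrix (Fin n) (Fin n) k := (Matrix.of g)ᵀ with hb
  have hu : IsUnit b.det := isUnit_iff_ne_zero.2 hg.det_ne_zero
  refine mem_borelOrbit.2 ⟨b, b⁻¹, fun i j hij => (hg j).2 i hij, mul_nonsing_inv _ hu, ?_⟩
  have key : x * b = b * arcMat k T := by
    ext i a
    have h1 : (x * b) i a = toLin' x (g a) i := rfl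
    rw [h1, mul_apply]
    rcases hgT a (Finset.mem_univ a) with ⟨c, hc, hxc⟩ | ⟨hno, hxa⟩
    · rw [hxc, Finset.sum_eq_single c]
      · rw [arcMat_apply, if_pos hc, mul_one]
        rfl
      · intro e _ hec
        rw [arcMat_apply, if_neg, mul_zero]
        exact fun he => hec (congrArg Prod.fst (hT.tail_inj _ he _ hc rfl))
      · exact fun h => absurd (Finset.mem_univ _) h
    · rw [hxa, Finset.sum_eq_zero]
      · rfl
      · intro e _
        rw [arcMat_apply, if_neg (hno e), mul_zero]
  rw [← key, mul_assoc, mul_nonsing_inv _ hu, mul_one]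

end NormalForm

/-! ### Orbits attached to permutations and simple reflections -/

section Steps

open Matrix

variable {k : Type*} [Field k] {n r : ℕ}

theorem weylAct_mul_perm {R : Type*} (s t : Equiv.Perm (Fin n)) (x : Matrix (Fin n) (Fin n) R) :
    weylAct (s * t) x = weylAct s (weylAct t x) := by
  ext i j
  rfl

theorem weylAct_mul (s : Equiv.Perm (Fin n)) (x y : Matrix (Fin n) (Fin n) k) :
    weylAct s (x * y) = weylAct s x * weylAct s y := by
  simp only [weylAct, reindex_apply, submatrix_mul_equiv]

theorem weylAct_one_right (s : Equiv.Perm (Fin n)) :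
    weylAct s (1 : Matrix (Fin n) (Fin n) k) = 1 := by
  simp [weylAct]

theorem weylAct_simpleSwap_self {R : Type*} (p : ℕ) (hp : p + 1 < n)
    (x : Matrix (Fin n) (Fin n) R) :
    weylAct (simpleSwap p hp) (weylAct (simpleSwap p hp) x) = x := by
  rw [← weylAct_mul_perm, simpleSwap_mul_self]
  rfl

theorem weylAct_transvection (s : Equiv.Perm (Fin n)) (i j : Fin n) (t : k) :
    weylAct s (transvection i j t) = transvection (s i) (s j) t := by
  ext a b
  simp only [weylAct, reindex_apply, submatrix_apply, transvection, Matrix.add_apply, one_apply,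
    single_apply, Equiv.eq_symm_apply, Equiv.apply_symm_apply]

theorem blockTriangular_weylAct {p : ℕ} {hp : p + 1 < n} {b : Matrix (Fin n) (Fin n) k}
    (hb : b.BlockTriangular id) (h0 : b ⟨p, by omega⟩ ⟨p + 1, hp⟩ = 0) :
    (weylAct (simpleSwap p hp) b).BlockTriangular id := by
  intro i j hij
  have hij' : j < i := hij
  change b (simpleSwap p hp i) (simpleSwap p hp j) = 0
  by_cases hc : (j : ℕ) = p ∧ (i : ℕ) = p + 1
  · have e1 : simpleSwap p hp i = ⟨p, by omega⟩ := Fin.ext (by rw [simpleSwap_val]; simp [hc.2])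
    have e2 : simpleSwap p hp j = ⟨p + 1, hp⟩ := Fin.ext (by rw [simpleSwap_val]; simp [hc.1])
    rw [e1, e2, h0]
  · exact hb ((simpleSwap_lt_iff p hp hc (by rw [Fin.lt_def] at hij'; omega)).2 hij')

theorem transvection_mul_neg {i j : Fin n} (h : i ≠ j) (t : k) :
    transvection i j t * transvection i j (-t) = 1 := by
  rw [transvection_mul_transvection_same _ _ h, add_neg_cancel, transvection_zero]

theorem transvection_neg_mul {i j : Fin n} (h : i ≠ j) (t : k) :
    transvection i j (-t) * transvection i j t = 1 := by
  rw [transvection_mul_transvection_same _ _ h, neg_add_cancel, transvection_zero]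

theorem diag_ne_zero {b c : Matrix (Fin n) (Fin n) k} (hb : b.BlockTriangular id)
    (hbc : b * c = 1) (i : Fin n) : b i i ≠ 0 := by
  have h1 := congrArg det hbc
  rw [det_mul, det_one, det_of_isUpperTriangular hb] at h1
  exact Finset.prod_ne_zero_iff.1 (left_ne_zero_of_mul_eq_one h1) i (Finset.mem_univ i)

variable (k) in
/-- The matrix `v . x_r`. -/
def weylMat (r : ℕ) (v : Equiv.Perm (Fin n)) : Matrix (Fin n) (Fin n) k :=
  arcMat k (movePattern v (baseArcs n r))

theorem weylAct_weylMat (s v : Equiv.Perm (Fin n)) :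
    weylAct s (weylMat k r v) = weylMat k r (s * v) := by
  rw [weylMat, weylAct_arcMat, ← movePattern_mul]
  rfl

theorem weylMat_one : weylMat k r (1 : Equiv.Perm (Fin n)) = arcMat k (baseArcs n r) := by
  rw [weylMat, movePattern_one]

theorem weylAct_base (v : Equiv.Perm (Fin n)) :
    weylAct v (arcMat k (baseArcs n r)) = weylMat k r v := weylAct_arcMat v _

theorem permMat_mul_inv (s : Equiv.Perm (Fin n)) : permMat k s * permMat k s⁻¹ = 1 := by
  have := weylAct_eq s (1 : Matrix (Fin n) (Fin n) k)
  rw [weylAct_one_right, mul_one] at this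
  exact this.symm

/-- Bookkeeping for the passage between `x₋(t)` and `b s x₊(t⁻¹)`. -/
theorem mul_conj_cancel {M : Type*} [Monoid M] {s u u' : M} (hs : s * s = 1) (hu : u' * u = 1)
    (g y h : M) : g * u' * s * (s * (u * y * u') * s) * (s * (u * h)) = g * y * h := by
  calc g * u' * s * (s * (u * y * u') * s) * (s * (u * h))
      = g * (u' * (s * s * (u * (y * (u' * (s * s * (u * h))))))) := by simp only [mul_assoc]
    _ = g * (u' * u * (y * (u' * u * h))) := by simp only [hs, one_mul, mul_assoc]
    _ = g * y * h := by simp only [hu, one_mul, mul_assoc]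

/-- For `t ≠ 0` the element `x₋(t)` of the root subgroup of a negative simple root is `b s x₊(t⁻¹)`
with `b` upper triangular and `x₊` the root subgroup of the opposite root. -/
theorem blockTriangular_neg_root {p : ℕ} (hp : p + 1 < n) {t : k} (ht : t ≠ 0) :
    (transvection (⟨p + 1, hp⟩ : Fin n) ⟨p, by omega⟩ t *
      transvection (⟨p, by omega⟩ : Fin n) ⟨p + 1, hp⟩ (-t⁻¹) *
      permMat k (simpleSwap p hp)).BlockTriangular id := by
  intro i j hij
  have hij' : (j : ℕ) < i := Fin.lt_def.1 hij
  rw [mul_apply, Finset.sum_eq_single (simpleSwap p hp j)]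
  · have hs := simpleSwap_val p hp j
    rw [permMat, of_apply, if_pos rfl, mul_one, transvection, transvection, add_mul, one_mul,
      mul_add, mul_one, single_mul_single_same]
    simp only [Matrix.add_apply, one_apply, single_apply, Fin.ext_iff, hs]
    split_ifs <;> first | omega | simp [ht]
  · intro l _ hl
    rw [permMat, of_apply, if_neg hl, mul_zero]
  · exact fun hc => absurd (Finset.mem_univ _) hc

theorem arcMat_base_apply (i j : Fin n) :
    arcMat k (baseArcs n r) i j = if (j : ℕ) = i + (n - r) then 1 else 0 := by
  simp only [arcMat_apply, mem_baseArcs]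

theorem single_mul_base_of_ge {a b : Fin n} (hb : r ≤ (b : ℕ)) (t : k) :
    single a b t * arcMat k (baseArcs n r) = 0 := by
  ext i j
  rw [mul_apply]
  refine Finset.sum_eq_zero fun l _ => ?_
  rw [single_apply, arcMat_base_apply]
  split_ifs with h1 h2
  · obtain ⟨rfl, rfl⟩ := h1
    omega
  · exact mul_zero _
  · exact zero_mul _
  · exact zero_mul _

theorem base_mul_single_of_lt {a b : Fin n} (ha : (a : ℕ) < n - r) (t : k) :
    arcMat k (baseArcs n r) * single a b t = 0 := by
  ext i j
  rw [mul_apply]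
  refine Finset.sum_eq_zero fun l _ => ?_
  rw [single_apply, arcMat_base_apply]
  split_ifs with h1 h2
  · obtain ⟨rfl, rfl⟩ := h2
    omega
  · exact mul_zero _
  · exact zero_mul _
  · exact zero_mul _

theorem single_mul_base {a b c : Fin n} (hc : (c : ℕ) = b + (n - r)) (t : k) :
    single a b t * arcMat k (baseArcs n r) = single a c t := by
  ext i j
  rw [mul_apply, Finset.sum_eq_single b]
  · rw [single_apply, single_apply, arcMat_base_apply]
    have : c = j ↔ (j : ℕ) = b + (n - r) := by rw [Fin.ext_iff]; omega
    simp only [this, mul_ite, mul_one, mul_zero, ite_and]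
    split_ifs <;> rfl
  · intro l _ hl
    rw [single_apply, if_neg fun h => hl h.2.symm, zero_mul]
  · exact fun h => absurd (Finset.mem_univ _) h

theorem base_mul_single {a b c : Fin n} (hc : (c : ℕ) = a + (n - r)) (t : k) :
    arcMat k (baseArcs n r) * single c b t = single a b t := by
  ext i j
  rw [mul_apply, Finset.sum_eq_single c]
  · rw [single_apply, single_apply, arcMat_base_apply]
    have : a = i ↔ (c : ℕ) = i + (n - r) := by rw [Fin.ext_iff]; omega
    simp only [this, ite_mul, one_mul, zero_mul, ite_and]
    split_ifs <;> rfl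
  · intro l _ hl
    rw [single_apply, if_neg fun h => hl h.1.symm, mul_zero]
  · exact fun h => absurd (Finset.mem_univ _) h

/-! ### The linear space around `x_r` -/

/-- The positions of the entries that may be non-zero on the orbit of `x_r`. -/
abbrev BaseIndex (n r : ℕ) : Type := {e : Fin n × Fin n // (e.1 : ℕ) + (n - r) ≤ e.2}

variable (k n r) in
/-- Restriction of polynomial functions to the matrices supported on `BaseIndex n r`. -/
noncomputable def restrictBase :
    MvPolynomial (Fin n × Fin n) k →ₐ[k] MvPolynomial (BaseIndex n r) k :=
  MvPolynomial.aeval fun e => if h : (e.1 : ℕ) + (n - r) ≤ e.2 then MvPolynomial.X ⟨e, h⟩ else 0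

theorem restrictBase_surjective : Function.Surjective (restrictBase k n r) := by
  intro q
  refine ⟨MvPolynomial.rename Subtype.val q, ?_⟩
  rw [restrictBase, MvPolynomial.aeval_rename]
  have : (fun e : Fin n × Fin n => if h : (e.1 : ℕ) + (n - r) ≤ e.2 then
      (MvPolynomial.X ⟨e, h⟩ : MvPolynomial (BaseIndex n r) k) else 0) ∘ Subtype.val =
      MvPolynomial.X := by
    funext e
    simp only [Function.comp_apply]
    rw [dif_pos e.2]
  rw [this, MvPolynomial.aeval_X_left, AlgHom.id_apply]

theorem aeval_restrictBase {x : Matrix (Fin n) (Fin n) k}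
    (hx : ∀ i j : Fin n, x i j ≠ 0 → (i : ℕ) + (n - r) ≤ j)
    (p : MvPolynomial (Fin n × Fin n) k) :
    MvPolynomial.aeval (fun e : BaseIndex n r => x e.1.1 e.1.2) (restrictBase k n r p) =
      MvPolynomial.aeval (coords x) p := by
  rw [restrictBase, ← AlgHom.comp_apply, MvPolynomial.comp_aeval]
  congr 2
  funext e
  simp only [coords]
  split_ifs with h1
  · rw [MvPolynomial.aeval_X]
  · rw [map_zero]
    by_contra hc
    exact h1 (hx _ _ (Ne.symm hc))

/-! ### Descents -/

variable [IsAlgClosed k]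

/-- The root subgroup of a positive root made negative by `v` does not move `v . x_r` out of its
orbit: on `x_r` it acts trivially or like a root subgroup of the last diagonal block, whose
positive roots stay positive under `v`. -/
theorem BlockMono.root_mem (h : 2 * r ≤ n) {v : Equiv.Perm (Fin n)} (hv : BlockMono r v)
    {a b : Fin n} (hab : a < b) (hvab : v b < v a) (t : k) :
    weylAct v (transvection a b t * arcMat k (baseArcs n r) * transvection a b (-t)) ∈
      borelOrbit (weylMat k r v) := by
  have ha : (a : ℕ) < n - r := by
    by_contra hc
    exact absurd (hv a b hab (Or.inr (not_lt.1 hc))) hvab.not_gt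
  have hab' := Fin.lt_def.1 hab
  by_cases hb : (b : ℕ) < r
  · set a' : Fin n := ⟨a + (n - r), by omega⟩ with ha'
    set b' : Fin n := ⟨b + (n - r), by omega⟩ with hb'
    have hlt : a' < b' := Fin.lt_def.2 (by simp only [ha', hb']; omega)
    have key : transvection a b t * arcMat k (baseArcs n r) * transvection a b (-t) =
        transvection a' b' (-t) * arcMat k (baseArcs n r) * transvection a' b' t := by
      have e1 : transvection a b t * arcMat k (baseArcs n r) * transvection a b (-t) =
          arcMat k (baseArcs n r) + single a b' t := by
        rw [mul_assoc, transvection, transvection, mul_add, base_mul_single_of_lt ha, add_zero,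
          mul_one, add_mul, one_mul, single_mul_base (c := b') rfl]
      have e2 : transvection a' b' (-t) * arcMat k (baseArcs n r) * transvection a' b' t =
          arcMat k (baseArcs n r) + single a b' t := by
        rw [transvection, transvection, add_mul 1, one_mul,
          single_mul_base_of_ge (b := b') (by simp only [hb']; omega), add_zero, mul_add, mul_one,
          base_mul_single (c := a') rfl]
      rw [e1, e2]
    rw [key, weylAct_mul, weylAct_mul, weylAct_transvection, weylAct_transvection, weylAct_base]
    have hvlt := hv a' b' hlt (Or.inr (Nat.le_add_left _ _))
    exact mul_mul_mem_borelOrbit (blockTriangular_transvection (b := id) hvlt.le _)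
      (transvection_neg_mul hvlt.ne _) (self_mem_borelOrbit _)
  · have key : transvection a b t * arcMat k (baseArcs n r) * transvection a b (-t) =
        arcMat k (baseArcs n r) := by
      rw [mul_assoc, transvection, transvection, mul_add, base_mul_single_of_lt ha, add_zero,
        mul_one, add_mul, one_mul, single_mul_base_of_ge (not_lt.1 hb), add_zero]
    rw [key, weylAct_base]
    exact self_mem_borelOrbit _

/-- A descent of the block monotone permutation `v`: the values `p + 1` and `p` occur in this
order, at the positions `a < b`. -/
structure IsDescent (r : ℕ) (v : Equiv.Perm (Fin n)) (p : ℕ) (a b : Fin n) : Prop where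
  mono : BlockMono r v
  left : (v a : ℕ) = p + 1
  right : (v b : ℕ) = p
  lt : a < b

theorem IsDescent.simpleSwap_mono {v : Equiv.Perm (Fin n)} {p : ℕ} (hp : p + 1 < n) {a b : Fin n}
    (hd : IsDescent r v p a b) : BlockMono r (simpleSwap p hp * v) :=
  hd.mono.simpleSwap_mul hp hd.left hd.right hd.lt

theorem IsDescent.left_eq {v : Equiv.Perm (Fin n)} {p : ℕ} (hp : p + 1 < n) {a b : Fin n}
    (hd : IsDescent r v p a b) : (simpleSwap p hp * v) a = ⟨p, by omega⟩ :=
  Fin.ext (by rw [Equiv.Perm.mul_apply, simpleSwap_val]; simp [hd.left])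

theorem IsDescent.right_eq {v : Equiv.Perm (Fin n)} {p : ℕ} (hp : p + 1 < n) {a b : Fin n}
    (hd : IsDescent r v p a b) : (simpleSwap p hp * v) b = ⟨p + 1, hp⟩ :=
  Fin.ext (by rw [Equiv.Perm.mul_apply, simpleSwap_val]; simp [hd.right])

theorem simpleSwap_mul_cancel (p : ℕ) (hp : p + 1 < n) (v : Equiv.Perm (Fin n)) :
    simpleSwap p hp * (simpleSwap p hp * v) = v := by
  rw [← mul_assoc, simpleSwap_mul_self, one_mul]

theorem IsDescent.length_eq {v : Equiv.Perm (Fin n)} {p : ℕ} (hp : p + 1 < n) {a b : Fin n}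
    (hd : IsDescent r v p a b) : length v = length (simpleSwap p hp * v) + 1 := by
  have := length_simpleSwap_mul p hp (u := simpleSwap p hp * v) (a := a) (b := b)
    (by rw [hd.left_eq hp]) (by rw [hd.right_eq hp]) hd.lt
  rwa [simpleSwap_mul_cancel] at this

/-- The simple reflection `s` maps the orbit of `s v . x_r` into that of `v . x_r`. -/
theorem IsDescent.weylAct_mem (h : 2 * r ≤ n) {v : Equiv.Perm (Fin n)} {p : ℕ} (hp : p + 1 < n)
    {a b : Fin n} (hd : IsDescent r v p a b) {y : Matrix (Fin n) (Fin n) k}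
    (hy : y ∈ borelOrbit (weylMat k r (simpleSwap p hp * v))) :
    weylAct (simpleSwap p hp) y ∈ borelOrbit (weylMat k r v) := by
  obtain ⟨g, c, hg, hgc, rfl⟩ := mem_borelOrbit.1 hy
  set P : Fin n := ⟨p, by omega⟩ with hP
  set Q : Fin n := ⟨p + 1, hp⟩ with hQ
  have hPQ : P < Q := Fin.lt_def.2 (Nat.lt_succ_self p)
  set t := g P Q / g P P with ht
  -- Split off the root subgroup of the simple root on the right.
  set g' := g * transvection P Q (-t) with hg'
  have hg'u : g'.BlockTriangular id :=
    hg.mul (blockTriangular_transvection (b := id) hPQ.le _)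
  have hg0 : g' P Q = 0 := by
    rw [hg', mul_transvection_apply_same, ht]
    field_simp [diag_ne_zero hg hgc P]
    ring
  have hgc' : g' * (transvection P Q t * c) = 1 := by
    rw [hg', mul_assoc, ← mul_assoc (transvection P Q (-t)), transvection_neg_mul hPQ.ne, one_mul,
      hgc]
  have e1 : g = g' * transvection P Q t := by
    rw [hg', mul_assoc, transvection_neg_mul hPQ.ne, mul_one]
  have e2 : c = transvection P Q (-t) * (transvection P Q t * c) := by
    rw [← mul_assoc, transvection_neg_mul hPQ.ne, one_mul]
  have hroot : weylAct (simpleSwap p hp) (transvection P Q t *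
      weylMat k r (simpleSwap p hp * v) * transvection P Q (-t)) ∈ borelOrbit (weylMat k r v) := by
    rw [← weylAct_base (simpleSwap p hp * v), hP, hQ, ← hd.left_eq hp, ← hd.right_eq hp,
      ← weylAct_transvection, ← weylAct_transvection, ← weylAct_mul, ← weylAct_mul, ← weylAct_mul_perm,
      simpleSwap_mul_cancel]
    exact hd.mono.root_mem h hd.lt (Fin.lt_def.2 (by rw [hd.left, hd.right]; omega)) t
  have e3 : weylAct (simpleSwap p hp) (g * weylMat k r (simpleSwap p hp * v) * c) =
      weylAct (simpleSwap p hp) g' * weylAct (simpleSwap p hp) (transvection P Q t *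
        weylMat k r (simpleSwap p hp * v) * transvection P Q (-t)) *
        weylAct (simpleSwap p hp) (transvection P Q t * c) := by
    rw [← weylAct_mul, ← weylAct_mul]
    congr 1
    conv_lhs => rw [e1, e2]
    simp only [mul_assoc]
  rw [e3]
  refine mul_mul_mem_borelOrbit (blockTriangular_weylAct hg'u hg0) ?_ hroot
  rw [← weylAct_mul, hgc', weylAct_one_right]

/-- The orbit of `v . x_r` is swept out by the root subgroup of the simple root acting on the
`s`-translate of the orbit of `s v . x_r`. -/
theorem exists_transvection_weylAct {v : Equiv.Perm (Fin n)} {p : ℕ} (hp : p + 1 < n)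
    {z : Matrix (Fin n) (Fin n) k} (hz : z ∈ borelOrbit (weylMat k r v)) :
    ∃ t : k, ∃ y ∈ borelOrbit (weylMat k r (simpleSwap p hp * v)),
      z = transvection ⟨p, by omega⟩ ⟨p + 1, hp⟩ t * weylAct (simpleSwap p hp) y *
        transvection ⟨p, by omega⟩ ⟨p + 1, hp⟩ (-t) := by
  obtain ⟨g, c, hg, hgc, rfl⟩ := mem_borelOrbit.1 hz
  set P : Fin n := ⟨p, by omega⟩ with hP
  set Q : Fin n := ⟨p + 1, hp⟩ with hQ
  have hPQ : P < Q := Fin.lt_def.2 (Nat.lt_succ_self p)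
  set t := g P Q / g Q Q with ht
  set g' := transvection P Q (-t) * g with hg'
  have hg'u : g'.BlockTriangular id :=
    BlockTriangular.mul (blockTriangular_transvection (b := id) hPQ.le _) hg
  have hg0 : g' P Q = 0 := by
    rw [hg', transvection_mul_apply_same, ht]
    field_simp [diag_ne_zero hg hgc Q]
    ring
  have hgc' : g' * (c * transvection P Q t) = 1 := by
    rw [hg', mul_assoc, ← mul_assoc g, hgc, one_mul, transvection_neg_mul hPQ.ne]
  refine ⟨t, weylAct (simpleSwap p hp) (g' * weylMat k r v * (c * transvection P Q t)), ?_, ?_⟩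
  · rw [weylAct_mul, weylAct_mul, weylAct_weylMat]
    refine mul_mul_mem_borelOrbit (blockTriangular_weylAct hg'u hg0) ?_ (self_mem_borelOrbit _)
    rw [← weylAct_mul, hgc', weylAct_one_right]
  · rw [weylAct_simpleSwap_self, hg']
    have e1 := transvection_mul_neg hPQ.ne t
    simp only [mul_assoc]
    rw [e1, mul_one, ← mul_assoc (transvection P Q t), e1, one_mul]

/-- The orbit decreases, in the closure order, along a descent. -/
theorem IsDescent.subset_closure (h : 2 * r ≤ n) {v : Equiv.Perm (Fin n)} {p : ℕ}
    (hp : p + 1 < n) {a b : Fin n} (hd : IsDescent r v p a b) :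
    borelOrbit (weylMat k r (simpleSwap p hp * v)) ⊆
      zariskiClosure (borelOrbit (weylMat k r v)) := by
  intro y hy
  set P : Fin n := ⟨p, by omega⟩ with hP
  set Q : Fin n := ⟨p + 1, hp⟩ with hQ
  have hPQ : P < Q := Fin.lt_def.2 (Nat.lt_succ_self p)
  have hinf : Infinite k := IsAlgClosed.instInfinite
  -- The orbit of `y` under the negative simple root subgroup approaches `y` at the parameter `0`.
  have hcurve : ∀ t : k, t ≠ 0 →
      transvection Q P t * y * transvection Q P (-t) ∈ borelOrbit (weylMat k r v) := by
    intro t ht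
    have hmem := hd.weylAct_mem h hp (mul_mul_mem_borelOrbit
      (blockTriangular_transvection (b := id) hPQ.le t⁻¹) (transvection_mul_neg hPQ.ne t⁻¹) hy)
    have hB := blockTriangular_neg_root (k := k) hp ht
    have hss : permMat k (simpleSwap p hp) * permMat k (simpleSwap p hp)⁻¹ = 1 :=
      permMat_mul_inv _
    have hinv : (simpleSwap p hp)⁻¹ = simpleSwap p hp := Equiv.swap_inv _ _
    rw [hinv] at hss
    have hBC : transvection Q P t * transvection P Q (-t⁻¹) * permMat k (simpleSwap p hp) *
        (permMat k (simpleSwap p hp) * (transvection P Q t⁻¹ * transvection Q P (-t))) = 1 := by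
      have e := mul_conj_cancel hss (transvection_neg_mul hPQ.ne t⁻¹) (transvection Q P t) 1
        (transvection Q P (-t))
      rwa [mul_one, transvection_mul_neg hPQ.ne t⁻¹, mul_one, hss, mul_one, mul_one,
        transvection_mul_neg hPQ.ne'] at e
    rw [weylAct_eq, hinv] at hmem
    rw [← mul_conj_cancel hss (transvection_neg_mul hPQ.ne t⁻¹)]
    exact mul_mul_mem_borelOrbit hB hBC hmem
  have hM := eval_zero_mem_zariskiClosure (S := borelOrbit (weylMat k r v))
    (transvection Q P (Polynomial.X : Polynomial k) * y.map Polynomial.C *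
      transvection Q P (-(Polynomial.X : Polynomial k)))
  have heval : ∀ t : k, (transvection Q P (Polynomial.X : Polynomial k) * y.map Polynomial.C *
      transvection Q P (-(Polynomial.X : Polynomial k))).map (Polynomial.eval t) =
      transvection Q P t * y * transvection Q P (-t) := by
    intro t
    have hmap : ∀ A : Matrix (Fin n) (Fin n) (Polynomial k),
        A.map (Polynomial.eval t) = (Polynomial.evalRingHom t).mapMatrix A := fun A => rfl
    have htr : ∀ q : Polynomial k, (Polynomial.evalRingHom t).mapMatrix (transvection Q P q) =
        transvection Q P (Polynomial.eval t q) := by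
      intro q
      ext i j
      simp only [transvection, RingHom.mapMatrix_apply, map_apply, Matrix.add_apply, one_apply,
        single_apply, map_add, Polynomial.coe_evalRingHom]
      split_ifs <;> simp
    have hy' : (Polynomial.evalRingHom t).mapMatrix (y.map Polynomial.C) = y := by
      ext i j
      simp
    rw [hmap, map_mul, map_mul, htr, htr, hy', Polynomial.eval_neg, Polynomial.eval_X]
  have := hM fun t ht => by
    rw [heval]
    exact hcurve t ht
  rw [heval] at this
  simpa using this

theorem IsDescent.closure_subset (h : 2 * r ≤ n) {v : Equiv.Perm (Fin n)} {p : ℕ}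
    (hp : p + 1 < n) {a b : Fin n} (hd : IsDescent r v p a b) :
    zariskiClosure (borelOrbit (weylMat k r (simpleSwap p hp * v))) ⊆
      zariskiClosure (borelOrbit (weylMat k r v)) :=
  zariskiClosure_subset (hd.subset_closure h hp)

theorem IsDescent.weylAct_mem_closure (h : 2 * r ≤ n) {v : Equiv.Perm (Fin n)} {p : ℕ}
    (hp : p + 1 < n) {a b : Fin n} (hd : IsDescent r v p a b) {y : Matrix (Fin n) (Fin n) k}
    (hy : y ∈ zariskiClosure (borelOrbit (weylMat k r (simpleSwap p hp * v)))) :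
    weylAct (simpleSwap p hp) y ∈ zariskiClosure (borelOrbit (weylMat k r v)) := by
  rw [weylAct_eq]
  refine mul_mul_mem_zariskiClosure (fun z hz => ?_) hy
  rw [← weylAct_eq]
  exact subset_zariskiClosure _ (hd.weylAct_mem h hp hz)

/-! ### The orbit of `x_r` -/

/-- The orbit of `x_r` contains the matrices supported on `BaseIndex n r` whose entries at the arcs
of `x_r` do not vanish. -/
theorem mem_borelOrbit_base (h : 2 * r ≤ n) {x : Matrix (Fin n) (Fin n) k}
    (hx : ∀ i j : Fin n, x i j ≠ 0 → (i : ℕ) + (n - r) ≤ j)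
    (hdiag : ∀ i j : Fin n, (j : ℕ) = i + (n - r) → x i j ≠ 0) :
    x ∈ borelOrbit (arcMat k (baseArcs n r)) := by
  have hx' : ∀ i j : Fin n, (j : ℕ) < i + (n - r) → x i j = 0 := fun i j hij => by
    by_contra hc
    have := hx i j hc
    omega
  -- The columns of `g` are the images under `x` of the last `r` basis vectors, followed by basis
  -- vectors, so that `g * x_r = x`; moreover `x * g = x`.
  let g : Matrix (Fin n) (Fin n) k := Matrix.of fun i j =>
    if hj : (j : ℕ) < r then x i ⟨j + (n - r), by omega⟩ else if i = j then 1 else 0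
  have gu : g.BlockTriangular id := by
    intro i j hij
    have hij' : (j : ℕ) < i := Fin.lt_def.1 hij
    simp only [g, of_apply]
    split_ifs with h1 h2
    · exact hx' _ _ (by simp only; omega)
    · rw [h2] at hij'
      omega
    · rfl
  have gdet : g.det ≠ 0 := by
    rw [det_of_isUpperTriangular gu]
    refine Finset.prod_ne_zero_iff.2 fun i _ => ?_
    simp only [g, of_apply, if_true]
    split_ifs with h1
    · exact hdiag _ _ rfl
    · exact one_ne_zero
  have hunit : IsUnit g.det := isUnit_iff_ne_zero.2 gdet
  have e1 : g * arcMat k (baseArcs n r) = x := by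
    ext i j
    rw [mul_apply]
    by_cases hj : n - r ≤ (j : ℕ)
    · rw [Finset.sum_eq_single ⟨j - (n - r), by omega⟩]
      · rw [arcMat_base_apply, if_pos (by simp only; omega), mul_one]
        simp only [g, of_apply]
        rw [dif_pos (by omega)]
        congr 1
        exact Fin.ext (by simp only; omega)
      · intro l _ hl
        rw [arcMat_base_apply, if_neg, mul_zero]
        exact fun hc => hl (Fin.ext (by simp only at hc ⊢; omega))
      · exact fun hc => absurd (Finset.mem_univ _) hc
    · rw [hx' i j (by omega)]
      refine Finset.sum_eq_zero fun l _ => ?_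
      rw [arcMat_base_apply, if_neg (by omega), mul_zero]
  have e2 : x * g = x := by
    ext i j
    rw [mul_apply, Finset.sum_eq_single j]
    · simp only [g, of_apply, if_true]
      split_ifs with h1
      · rw [hx' i j (by omega), zero_mul]
      · rw [mul_one]
    · intro l _ hl
      by_cases hli : (l : ℕ) < i + (n - r)
      · rw [hx' i l hli, zero_mul]
      · simp only [g, of_apply, if_neg hl]
        split_ifs with h1
        · rw [hx' l _ (by simp only; omega), mul_zero]
        · rw [mul_zero]
    · exact fun hc => absurd (Finset.mem_univ _) hc
  refine mem_borelOrbit.2 ⟨g, g⁻¹, gu, mul_nonsing_inv _ hunit, ?_⟩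
  rw [e1]
  conv_rhs => rw [← e2]
  rw [mul_assoc, mul_nonsing_inv _ hunit, mul_one]

theorem le_of_mem_borelOrbit_base {x : Matrix (Fin n) (Fin n) k}
    (hx : x ∈ borelOrbit (arcMat k (baseArcs n r))) (i j : Fin n) (hij : x i j ≠ 0) :
    (i : ℕ) + (n - r) ≤ j := by
  obtain ⟨b, c, hb, hbc, rfl⟩ := mem_borelOrbit.1 hx
  have hc := blockTriangular_of_mul_eq_one hb hbc
  by_contra hlt
  apply hij
  rw [mul_apply]
  refine Finset.sum_eq_zero fun m _ => ?_
  by_cases hmj : j < m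
  · rw [hc hmj, mul_zero]
  · rw [mul_apply, Finset.sum_eq_zero, zero_mul]
    intro l _
    by_cases hli : l < i
    · rw [hb hli, zero_mul]
    · rw [arcMat_base_apply, if_neg, mul_zero]
      rw [Fin.lt_def] at hmj hli
      omega

/-- The closure of the orbit of `x_r` is the linear space of matrices supported on
`BaseIndex n r`. -/
theorem idealOf_base (h : 2 * r ≤ n) :
    idealOf (borelOrbit (arcMat k (baseArcs n r))) = RingHom.ker (restrictBase k n r) := by
  have hinf : Infinite k := IsAlgClosed.instInfinite
  ext p
  rw [RingHom.mem_ker, idealOf, MvPolynomial.mem_vanishingIdeal_iff, Set.forall_mem_image]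
  constructor
  · intro hp
    -- The orbit is the locus in the linear space where the product of these entries is invertible.
    set D : MvPolynomial (BaseIndex n r) k := ∏ i : Fin r,
      MvPolynomial.X ⟨(⟨i, by omega⟩, ⟨i + (n - r), by omega⟩), le_rfl⟩ with hD
    have hD0 : D ≠ 0 := Finset.prod_ne_zero_iff.2 fun i _ => MvPolynomial.X_ne_zero _
    have hprod : restrictBase k n r p * D = 0 := by
      refine MvPolynomial.funext fun z => ?_
      rw [map_mul, map_zero]
      by_cases hDz : MvPolynomial.eval z D = 0
      · rw [hDz, mul_zero]
      · let x : Matrix (Fin n) (Fin n) k := Matrix.of fun i j =>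
          if hij : (i : ℕ) + (n - r) ≤ j then z ⟨(i, j), hij⟩ else 0
        have hx : ∀ i j : Fin n, x i j ≠ 0 → (i : ℕ) + (n - r) ≤ j := by
          intro i j hij
          by_contra hc
          exact hij (dif_neg hc)
        have hxz : (fun e : BaseIndex n r => x e.1.1 e.1.2) = z := by
          funext e
          exact dif_pos e.2
        have hmem : x ∈ borelOrbit (arcMat k (baseArcs n r)) := by
          refine mem_borelOrbit_base h hx fun i j hij => ?_
          rw [hD, map_prod, Finset.prod_eq_zero_iff] at hDz
          push Not at hDz
          have := hDz ⟨i, by omega⟩ (Finset.mem_univ _)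
          rw [MvPolynomial.eval_X] at this
          have e1 : x i j = z ⟨(i, j), hij.ge⟩ := dif_pos hij.ge
          rw [e1]
          convert this using 3
          exact Prod.ext rfl (Fin.ext hij)
        have h1 := aeval_restrictBase hx p
        rw [hp hmem, hxz, MvPolynomial.aeval_eq_eval] at h1
        rw [show MvPolynomial.eval z (restrictBase k n r p) = 0 from h1, zero_mul]
    exact (mul_eq_zero.1 hprod).resolve_right hD0
  · intro hp x hx
    rw [← aeval_restrictBase (le_of_mem_borelOrbit_base hx), hp, map_zero]

theorem mem_closure_base (h : 2 * r ≤ n) {x : Matrix (Fin n) (Fin n) k}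
    (hx : ∀ i j : Fin n, x i j ≠ 0 → (i : ℕ) + (n - r) ≤ j) :
    x ∈ zariskiClosure (borelOrbit (arcMat k (baseArcs n r))) := by
  rw [mem_zariskiClosure]
  intro p hp
  have hp' : p ∈ idealOf (borelOrbit (arcMat k (baseArcs n r))) := by
    rw [idealOf, MvPolynomial.mem_vanishingIdeal_iff, Set.forall_mem_image]
    exact fun y hy => hp y hy
  rw [idealOf_base h, RingHom.mem_ker] at hp'
  rw [← aeval_restrictBase hx, hp', map_zero]

end Steps

/-! ### The closure order -/

section ClosureOrder

variable {k : Type*} [Field k] {n r : ℕ}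

/-- Induction along descents: a block monotone permutation other than `1` has a descent, and
removing it gives a shorter block monotone permutation. -/
theorem BlockMono.descent_induction {motive : (v : Equiv.Perm (Fin n)) → BlockMono r v → Prop}
    (one : motive 1 (BlockMono.one r))
    (step : ∀ (v : Equiv.Perm (Fin n)) (p : ℕ) (hp : p + 1 < n) (a b : Fin n)
      (hd : IsDescent r v p a b),
      motive (simpleSwap p hp * v) (hd.simpleSwap_mono hp) → motive v hd.mono)
    {v : Equiv.Perm (Fin n)} (hv : BlockMono r v) : motive v hv := by
  induction hl : length v using Nat.strong_induction_on generalizing v with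
  | _ l ih =>
    by_cases hv1 : v = 1
    · subst hv1
      exact one
    · obtain ⟨p, hp, a, b, ha, hb, hab⟩ := exists_descent hv1
      have hd : IsDescent r v p a b := ⟨hv, ha, hb, hab⟩
      have := hd.length_eq hp
      exact step v p hp a b hd (ih _ (by omega) (hd.simpleSwap_mono hp) rfl)

theorem IsDescent.length_lt {v : Equiv.Perm (Fin n)} {p : ℕ} (hp : p + 1 < n) {a b : Fin n}
    (hd : IsDescent r v p a b) :
    length (simpleSwap p hp * v) < length (simpleSwap p hp * (simpleSwap p hp * v)) := by
  rw [simpleSwap_mul_cancel, hd.length_eq hp]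
  exact Nat.lt_succ_self _

theorem simpleSwap_movePattern_cancel (p : ℕ) (hp : p + 1 < n) (T : Finset (Fin n × Fin n)) :
    movePattern (simpleSwap p hp) (movePattern (simpleSwap p hp) T) = T := by
  rw [← movePattern_mul, simpleSwap_mul_self, movePattern_one]

theorem movePattern_base_isLinkPattern (h : 2 * r ≤ n) (v : Equiv.Perm (Fin n)) :
    IsLinkPattern (movePattern v (baseArcs n r)) := (baseArcs_isLinkPattern h).move v

/-- A link pattern of full size below `v . x_r` in the rank order is `τ . x_r` for some `τ` below
`v` in the Bruhat order. -/
theorem PatternLE.exists_bruhat (h : 2 * r ≤ n) {v : Equiv.Perm (Fin n)} (hv : BlockMono r v)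
    {T : Finset (Fin n × Fin n)} (hT : IsLinkPattern T) (hc : T.card = r)
    (hle : PatternLE T (movePattern v (baseArcs n r))) :
    ∃ τ, Bruhat τ v ∧ movePattern τ (baseArcs n r) = T := by
  induction hv using BlockMono.descent_induction generalizing T with
  | one =>
    rw [movePattern_one] at hle
    exact ⟨1, Relation.ReflTransGen.refl, by rw [movePattern_one, hle.eq_base hT hc h]⟩
  | step v p hp a b hd ih =>
    have hl := hd.length_lt hp
    rcases (movePattern_base_isLinkPattern h v).lift hT hle p hp with h1 | h1
    · rw [← movePattern_mul] at h1
      obtain ⟨τ, hτ, rfl⟩ := ih hT hc h1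
      have := hτ.trans (bruhat_simpleSwap_mul hl)
      rw [simpleSwap_mul_cancel] at this
      exact ⟨τ, this, rfl⟩
    · rw [← movePattern_mul (simpleSwap p hp) v] at h1
      obtain ⟨τ, hτ, hτT⟩ := ih (hT.move _) (by rw [card_movePattern, hc]) h1
      have := hτ.simpleSwap_mul hl
      rw [simpleSwap_mul_cancel] at this
      exact ⟨_, this, by rw [movePattern_mul, hτT, simpleSwap_movePattern_cancel]⟩

variable [IsAlgClosed k]

/-- The rank inequalities describe the link patterns in the closure of an orbit. -/
theorem PatternLE.mem_closure (h : 2 * r ≤ n) {v : Equiv.Perm (Fin n)} (hv : BlockMono r v)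
    {T : Finset (Fin n × Fin n)} (hT : IsLinkPattern T)
    (hle : PatternLE T (movePattern v (baseArcs n r))) :
    arcMat k T ∈ zariskiClosure (borelOrbit (weylMat k r v)) := by
  induction hv using BlockMono.descent_induction generalizing T with
  | one =>
    rw [weylMat_one]
    rw [movePattern_one] at hle
    refine mem_closure_base h fun i j hij => ?_
    rw [arcMat_apply, ite_ne_right_iff] at hij
    exact hle.base_arc hij.1
  | step v p hp a b hd ih =>
    rcases (movePattern_base_isLinkPattern h v).lift hT hle p hp with h1 | h1
    · rw [← movePattern_mul] at h1
      exact hd.closure_subset h hp (ih hT h1)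
    · rw [← movePattern_mul (simpleSwap p hp) v] at h1
      have := hd.weylAct_mem_closure h hp (ih (hT.move _) h1)
      rwa [weylAct_arcMat, simpleSwap_movePattern_cancel] at this

theorem Bruhat.mem_closure (h : 2 * r ≤ n) {v : Equiv.Perm (Fin n)} (hv : BlockMono r v)
    {τ : Equiv.Perm (Fin n)} (hτ : Bruhat τ v) :
    weylMat k r τ ∈ zariskiClosure (borelOrbit (weylMat k r v)) := by
  induction hv using BlockMono.descent_induction generalizing τ with
  | one =>
    rw [bruhat_one hτ]
    exact subset_zariskiClosure _ (self_mem_borelOrbit _)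
  | step v p hp a b hd ih =>
    rcases hτ.lift p hp with h1 | h1
    · exact hd.closure_subset h hp (ih h1)
    · have := hd.weylAct_mem_closure h hp (ih h1)
      rwa [weylAct_weylMat, simpleSwap_mul_cancel] at this

end ClosureOrder

/-! ### Dimensions -/

section Dimension

universe u

/-- The Krull dimension of a finitely generated algebra over a field is at most its transcendence
degree: by Noether normalisation the algebra is integral over a polynomial ring. -/
theorem ringKrullDim_le_of_trdeg_le {k A : Type u} [Field k] [CommRing A] [Nontrivial A]
    [Algebra k A] [Algebra.FiniteType k A] {N : ℕ} (h : Algebra.trdeg k A ≤ N) :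
    ringKrullDim A ≤ N := by
  obtain ⟨s, g, hg, hint⟩ := exists_integral_inj_algHom_of_fg k A
  have h1 : s ≤ N := by
    have := (trdeg_le_of_injective g hg).trans h
    rw [MvPolynomial.trdeg_of_isDomain] at this
    simpa using this
  let _ := g.toRingHom.toAlgebra
  have : Algebra.IsIntegral (MvPolynomial (Fin s) k) A := ⟨hint⟩
  have h2 : ringKrullDim A ≤ ringKrullDim (MvPolynomial (Fin s) k) :=
    Order.krullDim_le_of_strictMono
      (PrimeSpectrum.comap (algebraMap (MvPolynomial (Fin s) k) A))
      fun I J hIJ => Ideal.IsIntegral.comap_lt_comap hIJ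
  rw [MvPolynomial.ringKrullDim_of_isNoetherianRing, ringKrullDim_eq_zero_of_field, zero_add,
    Nat.card_eq_fintype_card, Fintype.card_fin] at h2
  exact h2.trans (by exact_mod_cast h1)

theorem trdeg_polynomial {k A : Type u} [Field k] [CommRing A] [IsDomain A] [Algebra k A] :
    Algebra.trdeg k (Polynomial A) = Algebra.trdeg k A + 1 := by
  rw [← trdeg_add_eq k A (A := Polynomial A), Polynomial.trdeg_of_isDomain]

theorem card_baseIndex {n r : ℕ} (h : 2 * r ≤ n) :
    Fintype.card (BaseIndex n r) = (r + 1).choose 2 := by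
  -- Shifting the column index by `n - r` gives the pairs `i ≤ j < r`.
  let e : BaseIndex n r ≃ Σ j : Fin r, Fin (j + 1) :=
    { toFun := fun e => ⟨⟨e.1.2 - (n - r), by have := e.2; omega⟩, ⟨e.1.1, by
        have := e.2
        simp only
        omega⟩⟩
      invFun := fun e => ⟨(⟨e.2, by omega⟩, ⟨e.1 + (n - r), by omega⟩), by
        simp only
        omega⟩
      left_inv := fun e => by
        have := e.2
        refine Subtype.ext (Prod.ext rfl (Fin.ext ?_))
        simp only
        omega
      right_inv := fun e => by
        obtain ⟨⟨j, hj⟩, ⟨i, hi⟩⟩ := e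
        have : j + (n - r) - (n - r) = j := Nat.add_sub_cancel _ _
        simp only [Sigma.mk.injEq, this, true_and]
        congr! }
  rw [Fintype.card_congr e, Fintype.card_sigma]
  simp only [Fintype.card_fin]
  rw [Fin.sum_univ_eq_sum_range (fun j => j + 1) r]
  clear e h
  induction r with
  | zero => rfl
  | succ r ih =>
    rw [Finset.sum_range_succ, ih, Nat.choose_succ_succ' (r + 1) 1, Nat.choose_one_right, add_comm]

open Matrix

variable {k : Type u} [Field k] {n r : ℕ}

/-- Evaluation of polynomial functions on `S` at a point of `S`. -/
noncomputable def evalAt (S : Set (Matrix (Fin n) (Fin n) k)) (z : S) :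
    MvPolynomial (Fin n × Fin n) k ⧸ idealOf S →ₐ[k] k :=
  Ideal.Quotient.liftₐ _ (MvPolynomial.aeval (coords z.1)) fun _ hp =>
    (MvPolynomial.mem_vanishingIdeal_iff.1 hp) _ ⟨z.1, z.2, rfl⟩

theorem evalAt_mk (S : Set (Matrix (Fin n) (Fin n) k)) (z : S)
    (p : MvPolynomial (Fin n × Fin n) k) :
    evalAt S z (Ideal.Quotient.mk _ p) = MvPolynomial.aeval (coords z.1) p := rfl

theorem eq_zero_of_evalAt {S : Set (Matrix (Fin n) (Fin n) k)}
    {a : MvPolynomial (Fin n × Fin n) k ⧸ idealOf S} (h : ∀ z : S, evalAt S z a = 0) : a = 0 := by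
  obtain ⟨p, rfl⟩ := Ideal.Quotient.mk_surjective a
  rw [Ideal.Quotient.eq_zero_iff_mem, idealOf, MvPolynomial.mem_vanishingIdeal_iff,
    Set.forall_mem_image]
  exact fun z hz => h ⟨z, hz⟩

/-- The point `x(t) (s y s⁻¹) x(-t)` with coordinates polynomials in `t` over the coordinate ring
of `S`, where `y` is the generic point of `S` and `x` the root subgroup at the entry `(i, j)`. -/
noncomputable def sweepMat (S : Set (Matrix (Fin n) (Fin n) k)) (s : Equiv.Perm (Fin n))
    (i j : Fin n) :
    Matrix (Fin n) (Fin n) (Polynomial (MvPolynomial (Fin n × Fin n) k ⧸ idealOf S)) :=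
  transvection i j Polynomial.X * weylAct s (Matrix.of fun a b =>
    Polynomial.C (Ideal.Quotient.mk _ (MvPolynomial.X (a, b)))) *
      transvection i j (-Polynomial.X)

/-- The comorphism of the map `(t, y) ↦ x(t) (s y s⁻¹) x(-t)` from `𝔸¹ × S` to matrices. -/
noncomputable def sweepHom (S : Set (Matrix (Fin n) (Fin n) k)) (s : Equiv.Perm (Fin n))
    (i j : Fin n) : MvPolynomial (Fin n × Fin n) k →ₐ[k]
      Polynomial (MvPolynomial (Fin n × Fin n) k ⧸ idealOf S) :=
  MvPolynomial.aeval fun e => sweepMat S s i j e.1 e.2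

theorem map_transvection {R R' : Type*} [CommRing R] [CommRing R'] (f : R →+* R') (i j : Fin n)
    (t : R) : f.mapMatrix (transvection i j t) = transvection i j (f t) := by
  ext a b
  simp only [transvection, RingHom.mapMatrix_apply, map_apply, Matrix.add_apply, one_apply,
    single_apply, map_add]
  split_ifs <;> simp

theorem eval_sweepHom (S : Set (Matrix (Fin n) (Fin n) k)) (s : Equiv.Perm (Fin n))
    (i j : Fin n) (z : S) (t : k) (p : MvPolynomial (Fin n × Fin n) k) :
    Polynomial.eval t ((sweepHom S s i j p).map (evalAt S z).toRingHom) =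
      MvPolynomial.aeval
        (coords (transvection i j t * weylAct s z.1 * transvection i j (-t))) p := by
  let ev : Polynomial (MvPolynomial (Fin n × Fin n) k ⧸ idealOf S) →ₐ[k] k :=
    (Polynomial.aeval t).comp (Polynomial.mapAlgHom (evalAt S z))
  suffices h : ev.comp (sweepHom S s i j) =
      MvPolynomial.aeval (coords (transvection i j t * weylAct s z.1 * transvection i j (-t))) from
    congrFun (congrArg DFunLike.coe h) p
  refine MvPolynomial.algHom_ext fun e => ?_
  rw [AlgHom.comp_apply, sweepHom, MvPolynomial.aeval_X, MvPolynomial.aeval_X]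
  have hX : ev Polynomial.X = t := by simp [ev]
  have hM : (ev : _ →+* k).mapMatrix (weylAct s (Matrix.of fun a b =>
      Polynomial.C (Ideal.Quotient.mk (idealOf S) (MvPolynomial.X (a, b))))) =
      weylAct s z.1 := by
    ext a b
    simp [ev, weylAct, evalAt_mk, coords]
  have h1 : (ev : _ →+* k).mapMatrix (sweepMat S s i j) =
      transvection i j t * weylAct s z.1 * transvection i j (-t) := by
    rw [sweepMat]
    have hT : ∀ q, (ev : _ →+* k).mapMatrix (transvection i j q) = transvection i j (ev q) :=
      fun q => map_transvection (ev : _ →+* k) i j q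
    rw [map_mul, map_mul, hT, hT, hM, map_neg, hX]
  exact congrFun (congrFun h1 e.1) e.2

/-- If the image of `𝔸¹ × S` is `S'`, then the coordinate ring of `S'` embeds into the polynomial
ring over that of `S`. -/
theorem idealOf_eq_ker_sweepHom [Infinite k] {S S' : Set (Matrix (Fin n) (Fin n) k)}
    {s : Equiv.Perm (Fin n)} {i j : Fin n}
    (hmem : ∀ t : k, ∀ z ∈ S, transvection i j t * weylAct s z * transvection i j (-t) ∈ S')
    (hsurj : ∀ y ∈ S', ∃ t : k, ∃ z ∈ S,
      y = transvection i j t * weylAct s z * transvection i j (-t)) :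
    idealOf S' = RingHom.ker (sweepHom S s i j) := by
  ext p
  rw [RingHom.mem_ker, idealOf, MvPolynomial.mem_vanishingIdeal_iff, Set.forall_mem_image]
  constructor
  · intro hp
    refine Polynomial.ext fun m => ?_
    rw [Polynomial.coeff_zero]
    refine eq_zero_of_evalAt fun z => ?_
    have h0 : (sweepHom S s i j p).map (evalAt S z).toRingHom = 0 := by
      refine Polynomial.funext fun t => ?_
      rw [eval_sweepHom, Polynomial.eval_zero]
      exact hp (hmem t z.1 z.2)
    have := congrArg (fun q => Polynomial.coeff q m) h0
    rwa [Polynomial.coeff_map, Polynomial.coeff_zero] at this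
  · intro hp y hy
    obtain ⟨t, z, hz, rfl⟩ := hsurj y hy
    rw [← eval_sweepHom S s i j ⟨z, hz⟩, hp, Polynomial.map_zero, Polynomial.eval_zero]

theorem idealOf_le_of_subset_closure {S S' : Set (Matrix (Fin n) (Fin n) k)}
    (h : S ⊆ zariskiClosure S') : idealOf S' ≤ idealOf S := by
  intro p hp
  rw [idealOf, MvPolynomial.mem_vanishingIdeal_iff, Set.forall_mem_image]
  exact fun y hy => h hy p hp

variable [IsAlgClosed k]

theorem IsDescent.not_mem_closure (h : 2 * r ≤ n) {v : Equiv.Perm (Fin n)} {p : ℕ}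
    (hp : p + 1 < n) {a b : Fin n} (hd : IsDescent r v p a b) :
    weylMat k r v ∉ zariskiClosure (borelOrbit (weylMat k r (simpleSwap p hp * v))) := by
  intro hc
  have hpat := movePattern_base_isLinkPattern (r := r) (n := n) h
  have h1 := patternLE_of_mem_closure (hpat _) (hpat v) hc
  have h2 := patternLE_of_mem_closure (k := k) (hpat v) (hpat _)
    (hd.subset_closure h hp (self_mem_borelOrbit _))
  have h3 := BlockMono.eq_of_movePattern_eq h hd.mono (hd.simpleSwap_mono hp)
    (eq_of_arcCount_eq fun i j hi hj => le_antisymm (h1 i j hi hj) (h2 i j hi hj))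
  have := hd.length_eq hp
  rw [← h3] at this
  omega

/-- The closure of the smaller orbit is a proper subset of that of the larger one. -/
theorem IsDescent.idealOf_lt (h : 2 * r ≤ n) {v : Equiv.Perm (Fin n)} {p : ℕ}
    (hp : p + 1 < n) {a b : Fin n} (hd : IsDescent r v p a b) :
    idealOf (borelOrbit (weylMat k r v)) <
      idealOf (borelOrbit (weylMat k r (simpleSwap p hp * v))) := by
  refine lt_of_le_not_ge (idealOf_le_of_subset_closure (hd.subset_closure h hp)) fun hle => ?_
  refine hd.not_mem_closure (k := k) h hp (mem_zariskiClosure.2 fun q hq => ?_)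
  have hq' : q ∈ idealOf (borelOrbit (weylMat k r (simpleSwap p hp * v))) := by
    rw [idealOf, MvPolynomial.mem_vanishingIdeal_iff, Set.forall_mem_image]
    exact fun y hy => hq y hy
  exact MvPolynomial.mem_vanishingIdeal_iff.1 (hle hq') _ ⟨_, self_mem_borelOrbit _, rfl⟩

theorem IsDescent.idealOf_eq (h : 2 * r ≤ n) {v : Equiv.Perm (Fin n)} {p : ℕ}
    (hp : p + 1 < n) {a b : Fin n} (hd : IsDescent r v p a b) :
    idealOf (borelOrbit (weylMat k r v)) =
      RingHom.ker (sweepHom (borelOrbit (weylMat k r (simpleSwap p hp * v))) (simpleSwap p hp)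
        ⟨p, by omega⟩ ⟨p + 1, hp⟩) := by
  have hinf : Infinite k := IsAlgClosed.instInfinite
  have hlt : (⟨p, by omega⟩ : Fin n) < ⟨p + 1, hp⟩ := Fin.lt_def.2 (Nat.lt_succ_self p)
  exact idealOf_eq_ker_sweepHom
    (fun t z hz => mul_mul_mem_borelOrbit (blockTriangular_transvection (b := id) hlt.le t)
      (transvection_mul_neg hlt.ne t) (hd.weylAct_mem h hp hz))
    fun y hy => exists_transvection_weylAct hp hy

/-- The statements carried by the induction for the dimension: irreducibility, an upper bound for
the transcendence degree of the coordinate ring, and a lower bound for its Krull dimension. -/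
theorem dimension_aux (h : 2 * r ≤ n) {v : Equiv.Perm (Fin n)} (hv : BlockMono r v) :
    (idealOf (borelOrbit (weylMat k r v))).IsPrime ∧
    Algebra.trdeg k (MvPolynomial (Fin n × Fin n) k ⧸ idealOf (borelOrbit (weylMat k r v))) ≤
      (length v + (r + 1).choose 2 : ℕ) ∧
    ((length v + (r + 1).choose 2 : ℕ) : WithBot ℕ∞) ≤
      dimension (borelOrbit (weylMat k r v)) := by
  induction hv using BlockMono.descent_induction with
  | one =>
    have h1 : length (1 : Equiv.Perm (Fin n)) = 0 := by
      rw [length, Finset.card_eq_zero, Finset.filter_eq_empty_iff]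
      exact fun e _ he => he.1.asymm he.2
    have e := Ideal.quotientKerAlgEquivOfSurjective
      (restrictBase_surjective (k := k) (n := n) (r := r))
    rw [weylMat_one, h1, zero_add, dimension, idealOf_base h]
    refine ⟨RingHom.ker_isPrime _, ?_, ?_⟩
    · rw [e.trdeg_eq, MvPolynomial.trdeg_of_isDomain, Cardinal.mk_fintype, card_baseIndex h]
      simp
    · rw [ringKrullDim_eq_of_ringEquiv e.toRingEquiv,
        MvPolynomial.ringKrullDim_of_isNoetherianRing, ringKrullDim_eq_zero_of_field, zero_add,
        Nat.card_eq_fintype_card, card_baseIndex h]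
  | step v p hp a b hd ih =>
    obtain ⟨ih1, ih2, ih3⟩ := ih
    have hlen := hd.length_eq hp
    have hker := hd.idealOf_eq (k := k) h hp
    have hprime : (idealOf (borelOrbit (weylMat k r v))).IsPrime := by
      rw [hker]
      exact RingHom.ker_isPrime _
    refine ⟨hprime, ?_, ?_⟩
    · have h1 : Algebra.trdeg k (MvPolynomial (Fin n × Fin n) k ⧸
          idealOf (borelOrbit (weylMat k r v))) ≤ Algebra.trdeg k (Polynomial
          (MvPolynomial (Fin n × Fin n) k ⧸
            idealOf (borelOrbit (weylMat k r (simpleSwap p hp * v))))) := by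
        rw [hker]
        exact trdeg_le_of_injective (Ideal.kerLiftAlg _) (Ideal.kerLiftAlg_injective _)
      refine h1.trans ?_
      rw [trdeg_polynomial, hlen, add_right_comm, Nat.cast_succ]
      gcongr
    · obtain ⟨hle, q, hq, hqv⟩ := SetLike.lt_iff_le_and_exists.1 (hd.idealOf_lt (k := k) h hp)
      have h1 := ringKrullDim_succ_le_of_surjective (Ideal.Quotient.factor hle)
        (Ideal.Quotient.factor_surjective hle)
        (r := Ideal.Quotient.mk _ q)
        (mem_nonZeroDivisors_of_ne_zero fun h0 => hqv (Ideal.Quotient.eq_zero_iff_mem.1 h0))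
        (by rw [Ideal.Quotient.factor_mk]; exact Ideal.Quotient.eq_zero_iff_mem.2 hq)
      refine le_trans ?_ h1
      rw [hlen, add_right_comm, Nat.cast_succ]
      exact add_le_add_left ih3 1

theorem dimension_borelOrbit (h : 2 * r ≤ n) {v : Equiv.Perm (Fin n)} (hv : BlockMono r v) :
    dimension (borelOrbit (weylMat k r v)) =
      ((length v + (r + 1).choose 2 : ℕ) : WithBot ℕ∞) := by
  obtain ⟨h1, h2, h3⟩ := dimension_aux (k := k) h hv
  exact le_antisymm (ringKrullDim_le_of_trdeg_le h2) h3

end Dimension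

/-! ### The orbits of square-zero matrices of given rank -/

section Main

open Matrix

variable {k : Type*} [Field k] {n r : ℕ}

/-- The cosets of the stabiliser of `x_r` are the fibres of `τ ↦ τ . x_r`. -/
theorem mk_eq_mk_iff (u v : Equiv.Perm (Fin n)) :
    (QuotientGroup.mk u : Equiv.Perm (Fin n) ⧸ weylStab k n r) = QuotientGroup.mk v ↔
      movePattern u (baseArcs n r) = movePattern v (baseArcs n r) := by
  rw [QuotientGroup.eq]
  change weylAct (u⁻¹ * v) (baseMat k n r) = baseMat k n r ↔ _
  rw [baseMat_eq, weylAct_arcMat]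
  constructor
  · intro he
    have := congrArg (movePattern u) (arcMat_injective he)
    rw [← movePattern_mul, mul_inv_cancel_left] at this
    exact this.symm
  · intro he
    rw [movePattern_mul, ← he, ← movePattern_mul, inv_mul_cancel, movePattern_one]

variable [IsAlgClosed k]

theorem mem_rankOrbit_of_mem_borelOrbit {T : Finset (Fin n × Fin n)} (hT : IsLinkPattern T)
    {y : Matrix (Fin n) (Fin n) k} (hy : y ∈ borelOrbit (arcMat k T)) :
    y ∈ rankOrbit k n T.card := by
  have hrk := rankFn_eq_of_mem_borelOrbit hy n 0
  rw [rankFn_eq_rank, rankFn_eq_rank, rank_arcMat hT] at hrk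
  obtain ⟨b, c, -, hbc, rfl⟩ := mem_borelOrbit.1 hy
  have hcb : c * b = 1 := mul_eq_one_comm.1 hbc
  refine ⟨⟨?_, ?_⟩, hrk⟩
  · rw [trace_mul_cycle, hcb, one_mul, arcMat_trace hT]
  · rw [mul_assoc, ← mul_assoc c, ← mul_assoc c, hcb, one_mul, mul_assoc b,
      ← mul_assoc (arcMat k T), arcMat_mul_self hT, zero_mul, mul_zero]

theorem borelOrbit_subset_closure_iff {x y : Matrix (Fin n) (Fin n) k} :
    borelOrbit x ⊆ zariskiClosure (borelOrbit y) ↔ x ∈ zariskiClosure (borelOrbit y) :=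
  borelOrbit_subset_iff fun b c z hb hbc hz => mul_mul_mem_closure_borelOrbit b c z hb hbc hz

theorem iUnion_borelOrbit (h : 2 * r ≤ n) :
    (⋃ p : minReps n r × Equiv.Perm (Fin r), borelOrbit (orbitRep k h p.1 p.2)) =
      rankOrbit k n r := by
  ext x
  rw [Set.mem_iUnion]
  constructor
  · rintro ⟨p, hp⟩
    rw [orbitRep_eq] at hp
    have := mem_rankOrbit_of_mem_borelOrbit (movePattern_base_isLinkPattern h _) hp
    rwa [card_movePattern, card_baseArcs (by omega)] at this
  · rintro ⟨hx, hrk⟩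
    obtain ⟨T, hT, hxT⟩ := exists_arcMat_orbit hx.2
    have hc := (mem_rankOrbit_of_mem_borelOrbit hT hxT).2
    obtain ⟨σ, hσ, w, rfl⟩ := exists_minReps_movePattern hT (hc.symm.trans hrk) h
    refine ⟨(⟨σ, hσ⟩, w), ?_⟩
    rwa [orbitRep_eq]

theorem pairwise_disjoint_borelOrbit (h : 2 * r ≤ n) :
    Pairwise fun p q : minReps n r × Equiv.Perm (Fin r) =>
      Disjoint (borelOrbit (orbitRep k h p.1 p.2)) (borelOrbit (orbitRep k h q.1 q.2)) := by
  rintro ⟨⟨σ, hσ⟩, w⟩ ⟨⟨σ', hσ'⟩, w'⟩ hne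
  refine Set.disjoint_left.2 fun y hy hy' => hne ?_
  rw [orbitRep_eq] at hy hy'
  have hpat := movePattern_base_isLinkPattern (n := n) h
  obtain ⟨rfl, rfl⟩ := minReps_mul_extend_injective h hσ hσ'
    (BlockMono.eq_of_movePattern_eq h (blockMono_of_mem_minReps h hσ w)
      (blockMono_of_mem_minReps h hσ' w') (eq_of_mem_borelOrbit (hpat _) (hpat _) hy hy'))
  rfl

theorem closure_order (h : 2 * r ≤ n) {u v : Equiv.Perm (Fin n)} (hv : BlockMono r v) :
    weylMat k r u ∈ zariskiClosure (borelOrbit (weylMat k r v)) ↔ ∃ τ, Bruhat τ v ∧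
      (QuotientGroup.mk u : Equiv.Perm (Fin n) ⧸ weylStab k n r) = QuotientGroup.mk τ := by
  have hpat := movePattern_base_isLinkPattern (n := n) h
  constructor
  · intro hu
    obtain ⟨τ, hτ, he⟩ := PatternLE.exists_bruhat h hv (hpat u)
      (by rw [card_movePattern, card_baseArcs (by omega)]) (patternLE_of_mem_closure (hpat v) (hpat u) hu)
    exact ⟨τ, hτ, (mk_eq_mk_iff u τ).2 he.symm⟩
  · rintro ⟨τ, hτ, he⟩
    have := hτ.mem_closure (k := k) h hv
    rwa [weylMat.eq_def k r τ, ← (mk_eq_mk_iff u τ).1 he] at this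

/-- A square-zero matrix lies in the closure of the orbit of `v . x_r` if and only if it satisfies
the rank inequalities. -/
theorem mem_closure_iff_rankFn_le (h : 2 * r ≤ n) {v : Equiv.Perm (Fin n)} (hv : BlockMono r v)
    {x : Matrix (Fin n) (Fin n) k} (hx : x * x = 0) :
    x ∈ zariskiClosure (borelOrbit (weylMat k r v)) ↔ ∀ i j : ℕ, 1 ≤ i → i ≤ n → j ≤ n →
      rankFn i j x ≤ rankFn i j (weylMat k r v) := by
  have hpat := movePattern_base_isLinkPattern (n := n) h v
  obtain ⟨T, hT, hxT⟩ := exists_arcMat_orbit hx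
  have hrank : ∀ i j : ℕ, j ≤ n → rankFn i j x = j + arcCount T i j ∧
      rankFn i j (weylMat k r v) = j + arcCount (movePattern v (baseArcs n r)) i j :=
    fun i j hj => ⟨by rw [rankFn_eq_of_mem_borelOrbit hxT, rankFn_arcMat hT i hj],
      rankFn_arcMat hpat i hj⟩
  constructor
  · intro hxv i j _ hi hj
    have h1 := borelOrbit_subset_closure_iff.2 hxv (mem_borelOrbit_symm hxT)
    have := patternLE_of_mem_closure hpat hT h1 i j hi hj
    rw [(hrank i j hj).1, (hrank i j hj).2]
    omega
  · intro hle
    refine borelOrbit_subset_closure_iff.2 (PatternLE.mem_closure h hv hT ?_) hxT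
    intro i j hi hj
    -- The inequalities for `i = 0` are not assumed, but there are no arcs to count.
    rcases Nat.eq_zero_or_pos i with rfl | hi0
    · rw [arcCount, Finset.filter_false_of_mem fun e _ he => absurd he.2 (Nat.not_lt_zero _)]
      exact Nat.zero_le _
    · have := hle i j hi0 hi hj
      rw [(hrank i j hj).1, (hrank i j hj).2] at this
      omega

end Main

end SquareZero

theorem mainTheorem9 {k : Type*} [Field k] [IsAlgClosed k] (n r : ℕ) (hr : 2 * r ≤ n) :
    -- the orbits are parametrised by pairs, without repetition
    ((⋃ p : SquareZero.minReps n r × Equiv.Perm (Fin r),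
        SquareZero.borelOrbit (SquareZero.orbitRep k hr p.1 p.2)) = SquareZero.rankOrbit k n r ∧
      Pairwise fun p q : SquareZero.minReps n r × Equiv.Perm (Fin r) =>
        Disjoint (SquareZero.borelOrbit (SquareZero.orbitRep k hr p.1 p.2))
          (SquareZero.borelOrbit (SquareZero.orbitRep k hr q.1 q.2))) ∧
    -- the closure order inside the set of square-zero matrices of rank `r`
    (∀ σ ∈ SquareZero.minReps n r, ∀ σ' ∈ SquareZero.minReps n r,
      ∀ w w' : Equiv.Perm (Fin r),
        SquareZero.borelOrbit (SquareZero.orbitRep k hr σ' w') ⊆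
            SquareZero.rankOrbit k n r ∩
              SquareZero.zariskiClosure (SquareZero.borelOrbit (SquareZero.orbitRep k hr σ w)) ↔
          ∃ τ : Equiv.Perm (Fin n),
            SquareZero.Bruhat τ (σ * SquareZero.extend hr w) ∧
            (QuotientGroup.mk (σ' * SquareZero.extend hr w') :
                Equiv.Perm (Fin n) ⧸ SquareZero.weylStab k n r) = QuotientGroup.mk τ) ∧
    -- the dimension of the orbits
    (∀ σ ∈ SquareZero.minReps n r, ∀ w : Equiv.Perm (Fin r),
      SquareZero.dimension (SquareZero.borelOrbit (SquareZero.orbitRep k hr σ w)) =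
        ((SquareZero.length σ + SquareZero.length w + (r + 1).choose 2 : ℕ) : WithBot ℕ∞)) ∧
    -- the rank inequalities defining the closures
    (∀ σ ∈ SquareZero.minReps n r, ∀ w : Equiv.Perm (Fin r),
      SquareZero.Z k hr σ w =
        {x | x ∈ SquareZero.N2 k n ∧ ∀ i j : ℕ, 1 ≤ i → i ≤ n → j ≤ n →
          SquareZero.rankFn i j x ≤
            SquareZero.rankFn i j (SquareZero.orbitRep k hr σ w)}) := by
  refine ⟨⟨SquareZero.iUnion_borelOrbit hr, SquareZero.pairwise_disjoint_borelOrbit hr⟩, ?_, ?_, ?_⟩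
  · intro σ hσ σ' _ w w'
    rw [Set.subset_inter_iff, SquareZero.orbitRep_eq hr σ w, SquareZero.orbitRep_eq hr σ' w',
      SquareZero.borelOrbit_subset_closure_iff]
    have key := SquareZero.closure_order (k := k) hr (u := σ' * SquareZero.extend hr w')
      (SquareZero.blockMono_of_mem_minReps hr hσ w)
    refine ⟨fun hc => key.1 hc.2, fun hc => ⟨fun y hy => ?_, key.2 hc⟩⟩
    have := SquareZero.mem_rankOrbit_of_mem_borelOrbit
      (SquareZero.movePattern_base_isLinkPattern hr _) hy
    rwa [SquareZero.card_movePattern, SquareZero.card_baseArcs (by omega)] at this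
  · intro σ hσ w
    rw [SquareZero.orbitRep_eq, ← SquareZero.length_mul_extend hr hσ w]
    exact SquareZero.dimension_borelOrbit hr (SquareZero.blockMono_of_mem_minReps hr hσ w)
  · intro σ hσ w
    rw [SquareZero.Z, SquareZero.orbitRep_eq]
    ext x
    rw [Set.mem_inter_iff, Set.mem_ofPred_eq]
    exact and_congr_right fun hx => SquareZero.mem_closure_iff_rankFn_le hr
      (SquareZero.blockMono_of_mem_minReps hr hσ w) hx.2
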